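/- **Proposition.** Let $n\ge 1$ and let $K_n$ be the unipotent group scheme attached to the $\mathbb{Z}$-Lie lattice $$\mathcal K_n=\Big\langle x_1,\dots,x_{2n},\,y_{ij}\ (1\le i,j\le n)\ \Big|\ [x_i,x_{n+j}]=y_{ij},\ \sum_{i=1}^n y_{ii}=0\Big\rangle_{\mathbb{Z}},$$ where all products of generators that do not follow from the given ones are trivial. Explicitly, for a commutative ring $R$, $K_n(R)=R^n\times R^n\times\big(\mathrm{Mat}_n(R)/R\cdot 1\big)$ with $$(a,b,c)(a',b',c')=\big(a+a',\,b+b',\,c+c'+[a_ib'_j]_{ij}\big).$$ For a topological group $G$, let $\tilde r_d(G)$ be the number of continuous irreducible $d$-dimensional complex representations of $G$, up to isomorphism and twisting by continuous one-dimensional representations, and, if all these numbers are finite, let $\zeta_G(s)=\sum_{d\ge1}\tilde r_d(G)\,d^{-s}$. The topological representation zeta function $\zeta_{K_n,\mathrm{top}}(s)\in\mathbb{Q}(s)$ is obtained as follows. Let $W(X,Y)\in\mathbb{Q}(X,Y)$ be such that, for every number field $F$ with ring of integers $\mathcal{O}$ and for all but finitely many nonzero primes $\mathfrak p$ of $\mathcal{O}$,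 with $q=|\mathcal{O}/\mathfrak p|$, all the numbers $\tilde r_d(K_n(\mathcal{O}_{\mathfrak p}))$ are finite and, for all complex $s$ in some right half-plane, $W$ is defined at $(q,q^{-s})$ and $\zeta_{K_n(\mathcal{O}_{\mathfrak p})}(s)$ converges to $W(q,q^{-s})$. Suppose that $W(q,q^{-s})$, expanded in $q-1$ by $q=1+(q-1)$ and $q^{-s}=\sum_{k\ge0}\binom{-s}{k}(q-1)^k$, lies in $\mathbb{Q}(s)[[q-1]]$. Then $\zeta_{K_n,\mathrm{top}}(s)$ is the constant term of this expansion. Such a $W$ exists, and $\zeta_{K_n,\mathrm{top}}(s)$ does not depend on its choice. The invariant $$\omega(K_n)=s\big(\zeta_{K_n,\mathrm{top}}(s)-1\big)\big|_{s=\infty}$$ exists and satisfies $$\omega(K_n)=n^2-H_n,\qquad H_n=\sum_{k=1}^n\frac1k .$$ In particular, $\omega(K_n)>0$ for $n\ge2$, that is, whenever $K_n$ is nonabelian. -/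

import Mathlib

open scoped NumberField

/-! ### The unipotent group schemes `K_n` -/

/-- The centre of the Lie lattice of `K_n` over `R`: the module spanned by the `y i j`, subject to
the single relation `∑ i, y i i = 0`. The class of the matrix `c` stands for `∑ c i j • y i j`, and
the relation is the identity matrix. -/
abbrev KCentre (n : ℕ) (R : Type*) [CommRing R] : Type _ :=
  Matrix (Fin n) (Fin n) R ⧸ Submodule.span R {(1 : Matrix (Fin n) (Fin n) R)}

/-- The `R`-points of the unipotent group scheme `K_n` of class at most two attached to the Lie
lattice `⟨x_1, …, x_{2n}, y_{ij} ∣ [x_i, x_{n+j}] = y_{ij}, ∑ y_{ii} = 0⟩`: the element `(a, b, c)`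
has coordinates `a` along `x_1, …, x_n`, `b` along `x_{n+1}, …, x_{2n}`, and central part `c`. -/
@[ext]
structure KGroup (n : ℕ) (R : Type*) [CommRing R] where
  a : Fin n → R
  b : Fin n → R
  c : KCentre n R

namespace KGroup

variable {n : ℕ} {R : Type*} [CommRing R]

/-- The value `∑ a_i b_j y_{ij}` of the bilinear map underlying the Lie bracket. -/
def pairing (a b : Fin n → R) : KCentre n R :=
  Submodule.Quotient.mk (Matrix.vecMulVec a b)

theorem pairing_add_left (a a' b : Fin n → R) :
    pairing (a + a') b = pairing a b + pairing a' b := by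
  simp only [pairing, Matrix.add_vecMulVec, Submodule.Quotient.mk_add]

theorem pairing_add_right (a b b' : Fin n → R) :
    pairing a (b + b') = pairing a b + pairing a b' := by
  simp only [pairing, Matrix.vecMulVec_add, Submodule.Quotient.mk_add]

theorem pairing_zero_left (b : Fin n → R) : pairing (0 : Fin n → R) b = 0 := by
  simpa using pairing_add_left (0 : Fin n → R) 0 b

theorem pairing_zero_right (a : Fin n → R) : pairing a (0 : Fin n → R) = 0 := by
  simpa using pairing_add_right a (0 : Fin n → R) 0

theorem pairing_neg_left (a b : Fin n → R) : pairing (-a) b = -pairing a b := by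
  rw [eq_neg_iff_add_eq_zero, ← pairing_add_left, neg_add_cancel, pairing_zero_left]

instance : Mul (KGroup n R) :=
  ⟨fun g h => ⟨g.a + h.a, g.b + h.b, g.c + h.c + pairing g.a h.b⟩⟩

instance : One (KGroup n R) := ⟨⟨0, 0, 0⟩⟩

instance : Inv (KGroup n R) := ⟨fun g => ⟨-g.a, -g.b, -g.c + pairing g.a g.b⟩⟩

theorem mul_def (g h : KGroup n R) :
    g * h = ⟨g.a + h.a, g.b + h.b, g.c + h.c + pairing g.a h.b⟩ := rfl

theorem one_def : (1 : KGroup n R) = ⟨0, 0, 0⟩ := rfl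

theorem inv_def (g : KGroup n R) : g⁻¹ = ⟨-g.a, -g.b, -g.c + pairing g.a g.b⟩ := rfl

instance : Group (KGroup n R) :=
  Group.ofLeftAxioms
    (fun g h k => by
      simp only [mul_def, pairing_add_left, pairing_add_right, KGroup.mk.injEq]
      refine ⟨add_assoc _ _ _, add_assoc _ _ _, ?_⟩
      abel)
    (fun g => by simp [mul_def, one_def, pairing_zero_left])
    (fun g => by simp [mul_def, one_def, inv_def, pairing_neg_left])

/-- Commutators in `K_n(R)` are given by the Lie bracket of the lattice. -/
theorem commutator_eq (g h : KGroup n R) :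
    g * h * g⁻¹ * h⁻¹ = ⟨0, 0, pairing g.a h.b - pairing h.a g.b⟩ := by
  rw [mul_inv_eq_iff_eq_mul, mul_inv_eq_iff_eq_mul]
  simp only [mul_def, zero_add, pairing_zero_left, KGroup.mk.injEq]
  refine ⟨add_comm _ _, add_comm _ _, ?_⟩
  abel

/-- For a topological ring `R`, the set `K_n(R)` carries the topology of
`R ^ n × R ^ n × (centre)`. -/
instance [TopologicalSpace R] : TopologicalSpace (KGroup n R) :=
  TopologicalSpace.induced
    (fun g => ((g.a, g.b, g.c) : (Fin n → R) × (Fin n → R) × KCentre n R)) inferInstance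

end KGroup

/-! ### Representation zeta functions -/

/-- The continuous irreducible complex representations of a topological group on `ℂ ^ d`. -/
def ContIrrep (G : Type*) [Group G] [TopologicalSpace G] (d : ℕ) : Type _ :=
  {ρ : Representation ℂ G (Fin d → ℂ) //
    ρ.IsIrreducible ∧ ∀ v, Continuous fun g => ρ g v}

/-- `ρ` and `ρ'` are twist equivalent: `ρ ≅ χ ⊗ ρ'` for a continuous one-dimensional
representation `χ`. -/
def TwistEquivalent {G : Type*} [Group G] [TopologicalSpace G] {d : ℕ}
    (ρ ρ' : ContIrrep G d) : Prop :=
  ∃ (χ : G →* ℂˣ) (e : (Fin d → ℂ) ≃ₗ[ℂ] (Fin d → ℂ)),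
    (Continuous fun g => (χ g : ℂ)) ∧
      ∀ g v, e (ρ.1 g v) = (χ g : ℂ) • ρ'.1 g (e v)

theorem twistEquivalent_equivalence (G : Type*) [Group G] [TopologicalSpace G] (d : ℕ) :
    Equivalence (TwistEquivalent (G := G) (d := d)) where
  refl ρ := ⟨1, LinearEquiv.refl ℂ _, by simpa using continuous_const, by simp⟩
  symm := by
    rintro ρ ρ' ⟨χ, e, hχ, h⟩
    refine ⟨χ⁻¹, e.symm, ?_, fun g v => ?_⟩
    · simpa [Pi.inv_def] using hχ.inv₀ fun g => (χ g).ne_zero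
    · rw [LinearEquiv.symm_apply_eq, map_smul, h]
      simp [smul_smul]
  trans := by
    rintro ρ ρ' ρ'' ⟨χ, e, hχ, h⟩ ⟨χ', e', hχ', h'⟩
    refine ⟨χ * χ', e.trans e', ?_, fun g v => ?_⟩
    · simpa [Pi.mul_def] using hχ.mul hχ'
    · simp [h, h', smul_smul]

/-- Twist classes of continuous irreducible `d`-dimensional complex representations of `G`. -/
def TwistClass (G : Type*) [Group G] [TopologicalSpace G] (d : ℕ) : Type _ :=
  Quotient (⟨TwistEquivalent, twistEquivalent_equivalence G d⟩ : Setoid (ContIrrep G d))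

/-- The representation zeta function `∑_d r_d d ^ (-s)` of `G`, where `r_d` is the (finite) number
of twist classes in dimension `d`, converges to `f s` on some right half-plane. -/
def HasRepZeta (G : Type*) [Group G] [TopologicalSpace G] (f : ℂ → ℂ) : Prop :=
  (∀ d, Finite (TwistClass G d)) ∧
    ∃ σ : ℝ, ∀ s : ℂ, σ < s.re →
      LSeriesHasSum (fun d => (Nat.card (TwistClass G d) : ℂ)) s (f s)

/-! ### Topological representation zeta functions -/

/-- The substitution `X ↦ q`, `Y ↦ q ^ (-s)` in a polynomial `P(X, Y)`. -/
noncomputable def evalAt (P : MvPolynomial (Fin 2) ℚ) (q : ℕ) (s : ℂ) : ℂ :=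
  MvPolynomial.aeval ![(q : ℂ), (q : ℂ) ^ (-s)] P

/-- The expansion of `P(q, q ^ (-s))` in powers of `T = q - 1`, with coefficients in `ℚ(s)`:
the substitution `X ↦ 1 + T`, `Y ↦ (1 + T) ^ (-s) = ∑_k binom(-s, k) T ^ k`. -/
noncomputable def expansion (P : MvPolynomial (Fin 2) ℚ) : PowerSeries (RatFunc ℚ) :=
  MvPolynomial.aeval
    ![1 + PowerSeries.X,
      PowerSeries.binomialSeries (RatFunc ℚ) (-RatFunc.X : RatFunc ℚ)] P

/-- The rational function `Z(s)` is the topological representation zeta function of `K_n`: there is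
a rational function `W = P / Q` in two variables over `ℚ` such that, for every number field `F`
with ring of integers `𝓞 F` and almost all nonzero primes `v` of `𝓞 F`, with residue field
cardinality `q`, the local representation zeta function of `K_n((𝓞 F)_v)` is `W(q, q ^ (-s))`, and
`Z` is the constant term of the expansion of `W(q, q ^ (-s))` as a power series in `q - 1`. -/
def IsTopRepZeta (n : ℕ) (Z : RatFunc ℚ) : Prop :=
  ∃ P Q : MvPolynomial (Fin 2) ℚ, Q ≠ 0 ∧
    (∀ (F : Type) [Field F] [NumberField F],
      ∀ᶠ v : IsDedekindDomain.HeightOneSpectrum (𝓞 F) in Filter.cofinite,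
        (∃ σ : ℝ, ∀ s : ℂ, σ < s.re → evalAt Q (Ideal.absNorm v.asIdeal) s ≠ 0) ∧
        HasRepZeta (KGroup n (v.adicCompletionIntegers F))
          fun s => evalAt P (Ideal.absNorm v.asIdeal) s / evalAt Q (Ideal.absNorm v.asIdeal) s) ∧
    ∃ E : PowerSeries (RatFunc ℚ),
      E * expansion Q = expansion P ∧ PowerSeries.constantCoeff E = Z

/-- The rational function `f` takes the finite value `c` at the point `∞` of the projective line. -/
def HasValueAtInfinity (f : RatFunc ℚ) (c : ℚ) : Prop :=
  Filter.Tendsto (fun z : ℂ => f.eval (algebraMap ℚ ℂ) z) (Filter.cocompact ℂ) (nhds (c : ℂ))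

/-- The statement `s (Z(s) - 1)|_{s = ∞} = c`. -/
def HasOmega (Z : RatFunc ℚ) (c : ℚ) : Prop :=
  HasValueAtInfinity (RatFunc.X * (Z - 1)) c

/-!
Let `R` be a discrete valuation ring with finite residue field of cardinality `q`, carrying the
topology defined by the powers of its maximal ideal.

*Representations.* By Schur's lemma the centre of `K_n(R)` acts on a continuous irreducible
representation through a character `ψ`, and `ψ` is a twist invariant because the centre is
generated by commutators. Conversely `ψ` determines the twist class: the group acts on the
homomorphisms between two irreducible representations with the same `ψ` through commuting
operators, and a common eigenvector is an isomorphism up to a twist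
(`Representation.IsIrreducible.exists_twist`). Every `ψ` with an open left radical
`L_ψ = {a ∈ R ^ n | ψ (∑ a_i b_j y_{ij}) = 1 for all b}` occurs, in the Schrödinger model on
functions on `R ^ n ⧸ L_ψ` (`KGroup.schroedinger`). So the twist classes of dimension `d` are the
`ψ` with `[R ^ n : L_ψ] = d` (`KGroup.nonempty_twistClass_equiv`).

*Counting.* For a lattice `L ≤ R ^ n`, the characters `ψ` with `L ≤ L_ψ` are those that kill the
matrices with columns in `L`. There are `[R ^ n : L] ^ n / q ^ m` of them, `m` being the least
exponent with `m_R ^ m R ^ n ≤ L`; the division by `q ^ m` comes from the relation that kills the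
scalar matrices. Counting the pairs `L ≤ L_ψ` in two ways, with `L_ψ ≅ R ^ n`, shows that the
representation zeta function is a quotient: the zeta function of lattices in `R ^ n` weighted by
`q ^ (-m)`, at an argument shifted by `n`, divided by the unweighted one
(`KGroup.mk_card_radical_eq_repSeries`).

*The lattice zeta functions.* Sorting lattices by their reduction modulo the maximal ideal gives a
recursion with Gaussian binomial coefficients (`latticeSum_eq_latticeCoeff`). It depends on `R` only
through `q`, so the local factors interpolate to a rational function of `q` and `q ^ (-s)`. At
`q = 1` the weighted and the unweighted zeta function in rank `n` have poles of order `n`, with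
leading coefficients that the recursion computes (`hasConstantTerm_latticeSeries`); the quotient is
`∏ (s - k + 1) / (s - 2 n + k + 1 / k)` over `1 ≤ k ≤ n`, from which `n ^ 2 - H_n` is read off
(`hasOmega_latticeLeading_div`).

*Uniqueness.* Two rational functions that interpolate the local factors agree at `(q, q ^ (-s))` for
infinitely many `q` and all `s` in a half-plane, hence are equal; and the expansion in powers of
`q - 1` is injective on polynomials, because the powers `(1 + T) ^ (i - j s)` are eigenvectors of
`(1 + T) d/dT` with distinct eigenvalues (`expansion_ne_zero`).
-/

open Filter Topology IsLocalRing

/-! ### Rational power series -/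

/-- The coefficients of a rational power series grow at most exponentially. -/
theorem exists_norm_coeff_le_of_mul_eq_polynomial {F : PowerSeries ℂ} {p q : Polynomial ℂ}
    (hq : q.coeff 0 = 1) (h : F * (q : PowerSeries ℂ) = p) :
    ∃ M : ℝ, 1 ≤ M ∧ ∀ k, ‖PowerSeries.coeff k F‖ ≤ M ^ (k + 1) := by
  -- the constant term of `q` is `1`, so each coefficient of `F` is a combination of earlier ones
  set cp : ℝ := ∑ i ∈ p.support, ‖p.coeff i‖ with hcp
  set cq : ℝ := ∑ i ∈ q.support, ‖q.coeff i‖ with hcq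
  have hcp0 : 0 ≤ cp := Finset.sum_nonneg fun _ _ => norm_nonneg _
  have hcq0 : 0 ≤ cq := Finset.sum_nonneg fun _ _ => norm_nonneg _
  have hM : (1 : ℝ) ≤ 1 + cp + cq := by linarith
  refine ⟨1 + cp + cq, hM, fun k => ?_⟩
  induction k using Nat.strong_induction_on with
  | _ k ih =>
  have hk := congrArg (PowerSeries.coeff k) h
  rw [PowerSeries.coeff_mul, Polynomial.coeff_coe,
    Finset.Nat.sum_antidiagonal_eq_sum_range_succ_mk, Finset.sum_range_succ] at hk
  simp only [Polynomial.coeff_coe, Nat.sub_self, hq, mul_one] at hk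
  have hF : PowerSeries.coeff k F = p.coeff k -
      ∑ i ∈ Finset.range k, PowerSeries.coeff i F * q.coeff (k - i) := by
    rw [← hk]; ring
  have hp : ‖p.coeff k‖ ≤ cp := by
    by_cases hs : k ∈ p.support
    · exact Finset.single_le_sum (f := fun i => ‖p.coeff i‖) (fun _ _ => norm_nonneg _) hs
    · rw [Polynomial.notMem_support_iff.mp hs, norm_zero]; exact hcp0
  have hsum : ‖∑ i ∈ Finset.range k, PowerSeries.coeff i F * q.coeff (k - i)‖ ≤
      cq * (1 + cp + cq) ^ k := by
    calc _ ≤ ∑ i ∈ Finset.range k, ‖q.coeff (k - i)‖ * (1 + cp + cq) ^ k := by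
          refine norm_sum_le_of_le _ fun i hi => ?_
          rw [norm_mul, mul_comm]
          have hi' := Finset.mem_range.mp hi
          refine mul_le_mul_of_nonneg_left ((ih i hi').trans ?_) (norm_nonneg _)
          exact pow_le_pow_right₀ hM hi'
      _ = (∑ i ∈ Finset.range k, ‖q.coeff (k - i)‖) * (1 + cp + cq) ^ k := by
          rw [Finset.sum_mul]
      _ ≤ _ := by
          refine mul_le_mul_of_nonneg_right ?_ (by positivity)
          rw [← Finset.sum_image (s := Finset.range k) (g := fun i => k - i)
            (f := fun i => ‖q.coeff i‖)
            (fun a ha b hb hab => by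
              have := Finset.mem_range.mp ha
              have := Finset.mem_range.mp hb
              simp only at hab
              lia)]
          rw [hcq]
          rw [← Finset.sum_filter_ne_zero]
          refine Finset.sum_le_sum_of_subset_of_nonneg (fun i hi => ?_) fun _ _ _ => norm_nonneg _
          exact Polynomial.mem_support_iff.mpr (norm_ne_zero_iff.mp (Finset.mem_filter.mp hi).2)
  rw [hF]
  have h1 : (1 : ℝ) ≤ (1 + cp + cq) ^ k := one_le_pow₀ hM
  calc _ ≤ cp + cq * (1 + cp + cq) ^ k := (norm_sub_le _ _).trans (add_le_add hp hsum)
    _ ≤ (1 + cp + cq) ^ (k + 1) := by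
      rw [pow_succ]; nlinarith

/-- A formal power series that is a quotient `p / q` of polynomials converges to `p / q` near
the origin. -/
theorem exists_hasSum_of_mul_eq_polynomial {F : PowerSeries ℂ} {p q : Polynomial ℂ}
    (hq : q ≠ 0) (h : F * (q : PowerSeries ℂ) = p) :
    ∃ ρ : ℝ, 0 < ρ ∧ ∀ t : ℂ, t ≠ 0 → ‖t‖ < ρ → q.eval t ≠ 0 ∧
      HasSum (fun k => PowerSeries.coeff k F * t ^ k) (p.eval t / q.eval t) := by
  -- divide `p` and `q` by the power of the variable that divides `q`
  obtain ⟨a, q₁, hq₁, rfl⟩ : ∃ (a : ℕ) (q₁ : Polynomial ℂ),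
      q₁.coeff 0 ≠ 0 ∧ q = Polynomial.X ^ a * q₁ := by
    obtain ⟨q₁, h1, h2⟩ := Polynomial.exists_eq_pow_rootMultiplicity_mul_and_not_dvd q hq 0
    refine ⟨_, q₁, ?_, by simpa using h1⟩
    rwa [map_zero, sub_zero, Polynomial.X_dvd_iff] at h2
  obtain ⟨p₁, rfl⟩ : Polynomial.X ^ a ∣ p := by
    rw [Polynomial.X_pow_dvd_iff]
    intro d hd
    have hX : (PowerSeries.X : PowerSeries ℂ) ^ a ∣ (p : PowerSeries ℂ) := by
      rw [← h]
      exact ⟨F * q₁, by push_cast; ring⟩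
    simpa using PowerSeries.X_pow_dvd_iff.mp hX d hd
  have h' : F * (q₁ : PowerSeries ℂ) = p₁ := by
    have hX : (PowerSeries.X : PowerSeries ℂ) ^ a ≠ 0 := pow_ne_zero _ PowerSeries.X_ne_zero
    apply mul_left_cancel₀ hX
    push_cast at h
    rw [← h]; ring
  set c := q₁.coeff 0 with hc
  have h'' : F * ((Polynomial.C c⁻¹ * q₁ : Polynomial ℂ) : PowerSeries ℂ) =
      (Polynomial.C c⁻¹ * p₁ : Polynomial ℂ) := by
    push_cast
    rw [← h']; ring
  obtain ⟨M, hM1, hM⟩ := exists_norm_coeff_le_of_mul_eq_polynomial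
    (by rw [Polynomial.coeff_C_mul, inv_mul_cancel₀ hq₁]) h''
  have hM0 : 0 < M := by linarith
  obtain ⟨δ, hδ, hδ'⟩ : ∃ δ : ℝ, 0 < δ ∧ ∀ t : ℂ, ‖t‖ < δ → q₁.eval t ≠ 0 := by
    have hcont : ContinuousAt (fun t => q₁.eval t) (0 : ℂ) := q₁.continuous.continuousAt
    have hne := hcont.eventually_ne (y := (0 : ℂ)) (by
      rw [← Polynomial.coeff_zero_eq_eval_zero]; exact hq₁)
    obtain ⟨δ, hδ, hb⟩ := Metric.eventually_nhds_iff.mp hne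
    exact ⟨δ, hδ, fun t ht => hb (by simpa using ht)⟩
  refine ⟨min δ M⁻¹, by positivity, fun t ht htρ => ?_⟩
  have hqt := hδ' t (htρ.trans_le (min_le_left _ _))
  have htM : ‖t‖ * M < 1 := by
    have := htρ.trans_le (min_le_right _ _)
    rwa [lt_inv_comm₀ (norm_pos_iff.mpr ht) hM0, ← one_div, lt_div_iff₀ (norm_pos_iff.mpr ht),
      mul_comm] at this
  have hsn : Summable fun k => ‖PowerSeries.coeff k F * t ^ k‖ := by
    refine Summable.of_nonneg_of_le (fun _ => norm_nonneg _) (fun k => ?_)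
      ((summable_geometric_of_lt_one (by positivity) htM).mul_left M)
    rw [norm_mul, norm_pow, mul_pow]
    calc _ ≤ M ^ (k + 1) * ‖t‖ ^ k := mul_le_mul_of_nonneg_right (hM k) (by positivity)
      _ = _ := by ring
  have hpoly (r : Polynomial ℂ) : HasSum (fun k => r.coeff k * t ^ k) (r.eval t) := by
    rw [Polynomial.eval_eq_sum, Polynomial.sum_def]
    exact hasSum_sum_of_ne_finset_zero fun k hk => by
      rw [Polynomial.notMem_support_iff.mp hk, zero_mul]
  have hpolyn (r : Polynomial ℂ) : Summable fun k => ‖r.coeff k * t ^ k‖ :=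
    summable_of_ne_finset_zero (s := r.support) fun k hk => by
      rw [Polynomial.notMem_support_iff.mp hk, zero_mul, norm_zero]
  have hcauchy := tsum_mul_tsum_eq_tsum_sum_antidiagonal_of_summable_norm hsn (hpolyn q₁)
  rw [(hpoly q₁).tsum_eq] at hcauchy
  have hp : (∑' n : ℕ, ∑ kl ∈ Finset.HasAntidiagonal.antidiagonal n,
      PowerSeries.coeff kl.1 F * t ^ kl.1 * (q₁.coeff kl.2 * t ^ kl.2)) = p₁.eval t := by
    rw [← (hpoly p₁).tsum_eq]
    refine tsum_congr fun k => ?_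
    have := congrArg (PowerSeries.coeff k) h'
    rw [PowerSeries.coeff_mul, Polynomial.coeff_coe] at this
    rw [← this, Finset.sum_mul]
    refine Finset.sum_congr rfl fun ij hij => ?_
    rw [Polynomial.coeff_coe, ← Finset.HasAntidiagonal.mem_antidiagonal.mp hij, pow_add]
    ring
  rw [hp] at hcauchy
  refine ⟨by simp [ht, hqt], ?_⟩
  have : (Polynomial.X ^ a * p₁).eval t / (Polynomial.X ^ a * q₁).eval t =
      ∑' k, PowerSeries.coeff k F * t ^ k := by
    simp only [Polynomial.eval_mul, Polynomial.eval_pow, Polynomial.eval_X]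
    rw [mul_div_mul_left _ _ (pow_ne_zero _ ht), ← hcauchy, mul_div_cancel_right₀ _ hqt]
  rw [this]
  exact hsn.of_norm.hasSum

/-! ### Specialization at `q` -/

/-- The substitution `X ↦ q`, with `Y` becoming the variable of a complex polynomial. -/
noncomputable def specialize (q : ℕ) : MvPolynomial (Fin 2) ℚ →ₐ[ℚ] Polynomial ℂ :=
  MvPolynomial.aeval ![(q : Polynomial ℂ), Polynomial.X]

theorem evalAt_eq_eval_specialize (P : MvPolynomial (Fin 2) ℚ) (q : ℕ) (s : ℂ) :
    evalAt P q s = (specialize q P).eval ((q : ℂ) ^ (-s)) := by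
  have : (MvPolynomial.aeval ![(q : ℂ), (q : ℂ) ^ (-s)] : MvPolynomial (Fin 2) ℚ →ₐ[ℚ] ℂ) =
      ((Polynomial.aeval ((q : ℂ) ^ (-s)) : Polynomial ℂ →ₐ[ℂ] ℂ).restrictScalars ℚ).comp
        (specialize q) := by
    ext i
    fin_cases i <;> simp [specialize]
  rw [evalAt, this]
  simp

theorem coeff_specialize (P : MvPolynomial (Fin 2) ℚ) (q j : ℕ) :
    (specialize q P).coeff j =
      ∑ m ∈ P.support with m 1 = j, ((P.coeff m : ℚ) : ℂ) * (q : ℂ) ^ (m 0) := by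
  conv_lhs => rw [P.as_sum]
  rw [map_sum, Polynomial.finsetSum_coeff, Finset.sum_filter]
  refine Finset.sum_congr rfl fun m _ => ?_
  rw [specialize, MvPolynomial.aeval_monomial]
  simp only [Finsupp.prod_fintype, pow_zero, implies_true, Fin.prod_univ_two,
    Matrix.cons_val_zero, Matrix.cons_val_one]
  have : (algebraMap ℚ (Polynomial ℂ) (P.coeff m)) * ((q : Polynomial ℂ) ^ (m 0) *
      Polynomial.X ^ (m 1)) = Polynomial.C (((P.coeff m : ℚ) : ℂ) * (q : ℂ) ^ (m 0)) *
      Polynomial.X ^ (m 1) := by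
    simp [mul_assoc, IsScalarTower.algebraMap_apply ℚ ℂ (Polynomial ℂ)]
  rw [this, Polynomial.coeff_C_mul_X_pow]
  simp only [eq_comm]

/-- A nonzero coefficient, as a polynomial in `X`, vanishes at finitely many `q` only. -/
theorem exists_specialize_ne_zero {P : MvPolynomial (Fin 2) ℚ} (hP : P ≠ 0) :
    ∃ q₀ : ℕ, ∀ q, q₀ ≤ q → specialize q P ≠ 0 := by
  obtain ⟨m, hm⟩ := MvPolynomial.ne_zero_iff.mp hP
  -- the coefficient of `Y ^ (m 1)`, as a polynomial in `X`
  set f : Polynomial ℂ := ∑ k ∈ P.support with k 1 = m 1,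
    Polynomial.monomial (k 0) ((P.coeff k : ℚ) : ℂ) with hf
  have hf0 : f ≠ 0 := by
    intro h0
    have hc := congrArg (fun g => Polynomial.coeff g (m 0)) h0
    simp only [hf, Polynomial.finsetSum_coeff, Polynomial.coeff_monomial,
      Polynomial.coeff_zero] at hc
    rw [Finset.sum_eq_single m] at hc
    · simp at hc; exact hm hc
    · intro k hk hne
      rw [if_neg]
      intro h1
      apply hne
      ext i
      fin_cases i
      · exact h1
      · exact (Finset.mem_filter.mp hk).2
    · intro hn
      exact (hn (Finset.mem_filter.mpr ⟨MvPolynomial.mem_support_iff.mpr hm, rfl⟩)).elim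
  obtain ⟨B, hB⟩ : ∃ B : ℕ, ∀ q : ℕ, f.eval (q : ℂ) = 0 → q < B := by
    have hfin : {q : ℕ | f.eval (q : ℂ) = 0}.Finite := by
      refine Set.Finite.of_finite_image (f := fun q : ℕ => (q : ℂ)) ?_ Nat.cast_injective.injOn
      refine (f.roots.toFinset.finite_toSet).subset ?_
      rintro _ ⟨q, hq, rfl⟩
      simpa [hf0] using hq
    obtain ⟨B, hB⟩ := hfin.bddAbove
    exact ⟨B + 1, fun q hq => Nat.lt_succ_of_le (hB hq)⟩
  refine ⟨B, fun q hq h0 => ?_⟩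
  refine absurd (hB q ?_) (by lia)
  have := congrArg (fun g => Polynomial.coeff g (m 1)) h0
  simp only [coeff_specialize, Polynomial.coeff_zero] at this
  rw [hf, Polynomial.eval_finsetSum]
  simpa using this

/-- In a far enough right half-plane, `q ^ (-s)` is small. -/
theorem exists_norm_natCast_cpow_neg_lt {q : ℕ} (hq : 2 ≤ q) {ρ : ℝ} (hρ : 0 < ρ) :
    ∃ σ : ℝ, ∀ s : ℂ, σ < s.re → (q : ℂ) ^ (-s) ≠ 0 ∧ ‖(q : ℂ) ^ (-s)‖ < ρ := by
  have hq1 : (1 : ℝ) < q := by exact_mod_cast hq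
  refine ⟨-Real.logb q ρ, fun s hs => ⟨?_, ?_⟩⟩
  · rw [Complex.cpow_def_of_ne_zero (by exact_mod_cast (by lia : q ≠ 0))]
    exact Complex.exp_ne_zero _
  · rw [Complex.norm_natCast_cpow_of_pos (by lia)]
    calc (q : ℝ) ^ (-s).re < (q : ℝ) ^ (Real.logb q ρ) := by
          apply Real.rpow_lt_rpow_of_exponent_lt hq1
          rw [Complex.neg_re]; linarith
      _ = ρ := Real.rpow_logb (by linarith) (by linarith) hρ

theorem exists_evalAt_ne_zero {P : MvPolynomial (Fin 2) ℚ} (hP : P ≠ 0) :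
    ∃ q₀ : ℕ, ∀ q, q₀ ≤ q → ∃ σ : ℝ, ∀ s : ℂ, σ < s.re → evalAt P q s ≠ 0 := by
  obtain ⟨q₀, h⟩ := exists_specialize_ne_zero hP
  refine ⟨max q₀ 2, fun q hq => ?_⟩
  obtain ⟨ρ, hρ, hsum⟩ := exists_hasSum_of_mul_eq_polynomial (F := 0) (p := 0)
    (h q (le_of_max_le_left hq)) (by simp)
  obtain ⟨σ, hσ⟩ := exists_norm_natCast_cpow_neg_lt (le_of_max_le_right hq) hρ
  refine ⟨σ, fun s hs => ?_⟩
  rw [evalAt_eq_eval_specialize]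
  exact (hsum _ (hσ s hs).1 (hσ s hs).2).1

/-! ### Expansion in powers of `q - 1` -/

/-- The series `(1 + T) ^ r` over `ℚ(s)`. -/
noncomputable abbrev onePlusPow (r : RatFunc ℚ) : PowerSeries (RatFunc ℚ) :=
  PowerSeries.binomialSeries (RatFunc ℚ) r

theorem onePlusPow_nsmul (r : RatFunc ℚ) (k : ℕ) : onePlusPow (k * r) = onePlusPow r ^ k := by
  induction k with
  | zero => simp
  | succ k ih =>
    rw [Nat.cast_succ, add_mul, one_mul, onePlusPow, PowerSeries.binomialSeries_add, pow_succ]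
    rw [← ih]

theorem coeff_onePlusPow_succ (r : RatFunc ℚ) (k : ℕ) :
    ((k : RatFunc ℚ) + 1) * PowerSeries.coeff (k + 1) (onePlusPow r) =
      (r - k) * PowerSeries.coeff k (onePlusPow r) := by
  have h := Ring.choose_smul_choose r (Nat.le_succ k)
  rw [Nat.choose_succ_self_right, Nat.succ_sub (le_refl k), Nat.sub_self,
    Ring.choose_one_right] at h
  simp only [PowerSeries.binomialSeries_coeff, smul_eq_mul, mul_one]
  rw [nsmul_eq_mul] at h
  push_cast at h
  rw [h, mul_comm]

/-- The operator `(1 + T) d/dT`. -/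
noncomputable def eulerOp : Module.End (RatFunc ℚ) (PowerSeries (RatFunc ℚ)) :=
  LinearMap.mulLeft (RatFunc ℚ) (1 + PowerSeries.X) ∘ₗ
    (PowerSeries.derivative (RatFunc ℚ)).toLinearMap

theorem hasEigenvector_eulerOp (r : RatFunc ℚ) :
    eulerOp.HasEigenvector r (onePlusPow r) := by
  refine ⟨Module.End.mem_eigenspace_iff.mpr ?_, fun h => ?_⟩
  · ext k
    have h0 := coeff_onePlusPow_succ r k
    simp only [eulerOp, LinearMap.comp_apply, LinearMap.mulLeft_apply, Derivation.coeFn_coe,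
      add_mul, one_mul, map_add, PowerSeries.coeff_smul, smul_eq_mul]
    change PowerSeries.coeff k (PowerSeries.derivative _ _) + _ = _
    rw [PowerSeries.coeff_derivative]
    cases k with
    | zero => simp
    | succ k =>
      rw [PowerSeries.coeff_succ_X_mul]
      rw [PowerSeries.coeff_derivative]
      push_cast at h0 ⊢
      linear_combination h0
  · have := congrArg PowerSeries.constantCoeff h
    simp at this

/-- The powers `(1 + T) ^ r` are eigenvectors of `(1 + T) d/dT` with distinct eigenvalues `r`. -/
theorem linearIndependent_onePlusPow : LinearIndependent (RatFunc ℚ) onePlusPow := by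
  have h := Module.End.eigenvectors_linearIndependent eulerOp Set.univ
    (fun r => onePlusPow r) (fun r => hasEigenvector_eulerOp r)
  exact h.comp (fun r => ⟨r, Set.mem_univ r⟩) fun a b hab => by simpa using hab

theorem expansion_mul (P Q : MvPolynomial (Fin 2) ℚ) :
    expansion (P * Q) = expansion P * expansion Q := map_mul _ _ _

theorem expansion_add (P Q : MvPolynomial (Fin 2) ℚ) :
    expansion (P + Q) = expansion P + expansion Q := map_add _ _ _

theorem expansion_sub (P Q : MvPolynomial (Fin 2) ℚ) :
    expansion (P - Q) = expansion P - expansion Q := map_sub _ _ _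

theorem expansion_zero : expansion 0 = 0 := map_zero _

theorem expansion_one : expansion 1 = 1 := map_one _

theorem expansion_X_zero : expansion (MvPolynomial.X 0) = 1 + PowerSeries.X := by
  simp [expansion]

theorem expansion_X_one : expansion (MvPolynomial.X 1) = onePlusPow (-RatFunc.X) := by
  simp [expansion]

theorem one_add_X_eq_onePlusPow : (1 + PowerSeries.X : PowerSeries (RatFunc ℚ)) = onePlusPow 1 := by
  simpa using (PowerSeries.binomialSeries_nat (R := RatFunc ℚ) (A := RatFunc ℚ) 1).symm

theorem expansion_monomial (m : Fin 2 →₀ ℕ) (c : ℚ) :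
    expansion (MvPolynomial.monomial m c) =
      (algebraMap ℚ (RatFunc ℚ) c) •
        onePlusPow ((m 0 : RatFunc ℚ) - (m 1 : RatFunc ℚ) * RatFunc.X) := by
  rw [expansion, MvPolynomial.aeval_monomial]
  simp only [Finsupp.prod_fintype, pow_zero, implies_true, Fin.prod_univ_two,
    Matrix.cons_val_zero, Matrix.cons_val_one]
  rw [one_add_X_eq_onePlusPow, ← onePlusPow_nsmul, ← onePlusPow_nsmul, onePlusPow,
    onePlusPow, ← PowerSeries.binomialSeries_add, Algebra.smul_def,
    ← IsScalarTower.algebraMap_apply]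
  congr 2
  ring

theorem ratFunc_natCast_sub_mul_X_injective :
    Function.Injective fun m : Fin 2 →₀ ℕ => (m 0 : RatFunc ℚ) - (m 1 : RatFunc ℚ) * RatFunc.X := by
  intro m m' h
  have h' : algebraMap (Polynomial ℚ) (RatFunc ℚ)
        ((m 0 : Polynomial ℚ) - (m 1 : Polynomial ℚ) * Polynomial.X) =
      algebraMap (Polynomial ℚ) (RatFunc ℚ)
        ((m' 0 : Polynomial ℚ) - (m' 1 : Polynomial ℚ) * Polynomial.X) := by
    simpa using h
  have h2 := RatFunc.algebraMap_injective ℚ h'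
  have e0 := congrArg (Polynomial.eval 0) h2
  have e1 := congrArg (Polynomial.eval 1) h2
  simp only [Polynomial.eval_sub, Polynomial.eval_natCast, Polynomial.eval_mul, Polynomial.eval_X,
    mul_zero, sub_zero, Nat.cast_inj] at e0
  simp only [Polynomial.eval_sub, Polynomial.eval_natCast, Polynomial.eval_mul, Polynomial.eval_X,
    mul_one, e0, sub_right_inj, Nat.cast_inj] at e1
  ext i
  fin_cases i
  · exact e0
  · exact e1

/-- The series `1 + T` and `(1 + T) ^ (-s)` are algebraically independent over `ℚ`. -/
theorem expansion_ne_zero {P : MvPolynomial (Fin 2) ℚ} (hP : P ≠ 0) : expansion P ≠ 0 := by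
  intro h
  apply hP
  have hli := linearIndependent_onePlusPow.comp _ ratFunc_natCast_sub_mul_X_injective
  rw [P.as_sum] at h
  have hs : ∑ m ∈ P.support, (algebraMap ℚ (RatFunc ℚ) (P.coeff m)) •
      (onePlusPow ∘ fun m : Fin 2 →₀ ℕ =>
        (m 0 : RatFunc ℚ) - (m 1 : RatFunc ℚ) * RatFunc.X) m = 0 := by
    rw [← h, expansion, map_sum]
    exact Finset.sum_congr rfl fun m _ => (expansion_monomial m _).symm
  ext m
  by_cases hm : m ∈ P.support
  · have := linearIndependent_iff'.mp hli _ _ hs m hm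
    simpa using this
  · simpa using hm

/-! ### Families of power series that are rational in `q` -/

/-- The power series `w q` over `ℂ`, indexed by natural numbers `q`, are for all large `q` the
specializations at `X = q` of a single element `P / Q` of `ℚ(X, Y)`, with `Y` the variable of
`w q`, and the expansion of `P / Q` in powers of `q - 1` is the power series `E`. -/
def IsRationalFamily (w : ℕ → PowerSeries ℂ) (E : PowerSeries (RatFunc ℚ)) : Prop :=
  ∃ P Q : MvPolynomial (Fin 2) ℚ, Q ≠ 0 ∧ E * expansion Q = expansion P ∧
    ∃ q₀ : ℕ, ∀ q, q₀ ≤ q → w q * (specialize q Q : PowerSeries ℂ) = specialize q P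

namespace IsRationalFamily

variable {w w' : ℕ → PowerSeries ℂ} {E E' : PowerSeries (RatFunc ℚ)}

theorem of_mvPolynomial (P : MvPolynomial (Fin 2) ℚ) :
    IsRationalFamily (fun q => specialize q P) (expansion P) :=
  ⟨P, 1, one_ne_zero, by rw [expansion_one, mul_one], 0, fun q _ => by simp⟩

theorem add (h : IsRationalFamily w E) (h' : IsRationalFamily w' E') :
    IsRationalFamily (fun q => w q + w' q) (E + E') := by
  obtain ⟨P, Q, hQ, hE, q₀, h⟩ := h
  obtain ⟨P', Q', hQ', hE', q₁, h'⟩ := h'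
  refine ⟨P * Q' + P' * Q, Q * Q', mul_ne_zero hQ hQ', ?_, max q₀ q₁, fun q hq => ?_⟩
  · rw [expansion_add, expansion_mul, expansion_mul, expansion_mul, ← hE, ← hE']
    ring
  · have h1 := h q (le_of_max_le_left hq)
    have h2 := h' q (le_of_max_le_right hq)
    simp only [map_add, map_mul, Polynomial.coe_add, Polynomial.coe_mul, ← h1, ← h2]
    ring

theorem mul (h : IsRationalFamily w E) (h' : IsRationalFamily w' E') :
    IsRationalFamily (fun q => w q * w' q) (E * E') := by
  obtain ⟨P, Q, hQ, hE, q₀, h⟩ := h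
  obtain ⟨P', Q', hQ', hE', q₁, h'⟩ := h'
  refine ⟨P * P', Q * Q', mul_ne_zero hQ hQ', ?_, max q₀ q₁, fun q hq => ?_⟩
  · rw [expansion_mul, expansion_mul, ← hE, ← hE']
    ring
  · have h1 := h q (le_of_max_le_left hq)
    have h2 := h' q (le_of_max_le_right hq)
    simp only [map_mul, Polynomial.coe_mul, ← h1, ← h2]
    ring

/-- If `v * w = w'` and `w`, `w'` are rational families, then so is the quotient `v`. -/
theorem div {v : ℕ → PowerSeries ℂ} {D : PowerSeries (RatFunc ℚ)}
    (h : IsRationalFamily w E) (h' : IsRationalFamily w' E') (hE0 : E ≠ 0) (hD : D * E = E')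
    (q₀ : ℕ) (hv : ∀ q, q₀ ≤ q → v q * w q = w' q) : IsRationalFamily v D := by
  obtain ⟨P, Q, hQ, hE, q₁, h⟩ := h
  obtain ⟨P', Q', hQ', hE', q₂, h'⟩ := h'
  have hP : P ≠ 0 := by
    rintro rfl
    rw [expansion_zero] at hE
    exact (mul_ne_zero hE0 (expansion_ne_zero hQ)) hE
  refine ⟨P' * Q, P * Q', mul_ne_zero hP hQ', ?_, max q₀ (max q₁ q₂), fun q hq => ?_⟩
  · rw [expansion_mul, expansion_mul, ← hE, ← hE', ← hD]
    ring
  · have h0 := hv q (le_of_max_le_left hq)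
    have h1 := h q (le_of_max_le_left (le_of_max_le_right hq))
    have h2 := h' q (le_of_max_le_right (le_of_max_le_right hq))
    simp only [map_mul, Polynomial.coe_mul, ← h1, ← h2, ← h0]
    ring

theorem sum {ι : Type*} (s : Finset ι) {w : ι → ℕ → PowerSeries ℂ}
    {E : ι → PowerSeries (RatFunc ℚ)} (h : ∀ i ∈ s, IsRationalFamily (w i) (E i)) :
    IsRationalFamily (fun q => ∑ i ∈ s, w i q) (∑ i ∈ s, E i) := by
  classical
  induction s using Finset.induction_on with
  | empty =>
    simpa [expansion_zero] using of_mvPolynomial 0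
  | insert i s hi ih =>
    simp only [Finset.sum_insert hi]
    exact (h i (Finset.mem_insert_self i s)).add
      (ih fun j hj => h j (Finset.mem_insert_of_mem hj))

theorem prod {ι : Type*} (s : Finset ι) {w : ι → ℕ → PowerSeries ℂ}
    {E : ι → PowerSeries (RatFunc ℚ)} (h : ∀ i ∈ s, IsRationalFamily (w i) (E i)) :
    IsRationalFamily (fun q => ∏ i ∈ s, w i q) (∏ i ∈ s, E i) := by
  classical
  induction s using Finset.induction_on with
  | empty =>
    simpa [expansion_one] using of_mvPolynomial 1
  | insert i s hi ih =>
    simp only [Finset.prod_insert hi]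
    exact (h i (Finset.mem_insert_self i s)).mul
      (ih fun j hj => h j (Finset.mem_insert_of_mem hj))

end IsRationalFamily

@[simp]
theorem Polynomial.coe_natCast_powerSeries (q : ℕ) :
    ((q : Polynomial ℂ) : PowerSeries ℂ) = (q : PowerSeries ℂ) :=
  map_natCast Polynomial.coeToPowerSeries.ringHom q

/-! ### Leading terms at `q = 1` -/

/-- The family `w` is rational, and its expansion in powers of `q - 1` has constant term `c`. -/
def HasConstantTerm (w : ℕ → PowerSeries ℂ) (c : RatFunc ℚ) : Prop :=
  ∃ E, IsRationalFamily w E ∧ PowerSeries.constantCoeff E = c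

namespace HasConstantTerm

variable {w w' v : ℕ → PowerSeries ℂ} {c c' : RatFunc ℚ}

theorem add (h : HasConstantTerm w c) (h' : HasConstantTerm w' c') :
    HasConstantTerm (fun q => w q + w' q) (c + c') := by
  obtain ⟨E, hE, rfl⟩ := h
  obtain ⟨E', hE', rfl⟩ := h'
  exact ⟨_, hE.add hE', map_add _ _ _⟩

theorem mul (h : HasConstantTerm w c) (h' : HasConstantTerm w' c') :
    HasConstantTerm (fun q => w q * w' q) (c * c') := by
  obtain ⟨E, hE, rfl⟩ := h
  obtain ⟨E', hE', rfl⟩ := h'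
  exact ⟨_, hE.mul hE', map_mul _ _ _⟩

theorem sum {ι : Type*} (s : Finset ι) {w : ι → ℕ → PowerSeries ℂ} {c : ι → RatFunc ℚ}
    (h : ∀ i ∈ s, HasConstantTerm (w i) (c i)) :
    HasConstantTerm (fun q => ∑ i ∈ s, w i q) (∑ i ∈ s, c i) := by
  choose! E hE hc using h
  exact ⟨_, IsRationalFamily.sum s hE, by rw [map_sum]; exact Finset.sum_congr rfl hc⟩

theorem prod {ι : Type*} (s : Finset ι) {w : ι → ℕ → PowerSeries ℂ} {c : ι → RatFunc ℚ}
    (h : ∀ i ∈ s, HasConstantTerm (w i) (c i)) :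
    HasConstantTerm (fun q => ∏ i ∈ s, w i q) (∏ i ∈ s, c i) := by
  choose! E hE hc using h
  exact ⟨_, IsRationalFamily.prod s hE, by rw [map_prod]; exact Finset.prod_congr rfl hc⟩

theorem of_mvPolynomial (P : MvPolynomial (Fin 2) ℚ) :
    HasConstantTerm (fun q => specialize q P) (PowerSeries.constantCoeff (expansion P)) :=
  ⟨_, IsRationalFamily.of_mvPolynomial P, rfl⟩

theorem one : HasConstantTerm (fun _ => 1) 1 := by
  simpa [expansion_one] using of_mvPolynomial 1

theorem natCast : HasConstantTerm (fun q => (q : PowerSeries ℂ)) 1 := by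
  simpa [expansion_X_zero, specialize] using of_mvPolynomial (MvPolynomial.X 0)

theorem natCast_sub_one : HasConstantTerm (fun q => (q : PowerSeries ℂ) - 1) 0 := by
  have h := of_mvPolynomial (MvPolynomial.X 0 - 1)
  rw [expansion_sub, expansion_X_zero, expansion_one, add_sub_cancel_left] at h
  simpa [specialize] using h

theorem X : HasConstantTerm (fun _ => PowerSeries.X) 1 := by
  simpa [expansion_X_one, specialize] using of_mvPolynomial (MvPolynomial.X 1)

theorem pow (h : HasConstantTerm w c) (k : ℕ) : HasConstantTerm (fun q => w q ^ k) (c ^ k) := by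
  simpa using prod (Finset.range k) (fun _ _ => h)

theorem div (h : HasConstantTerm w c) (h' : HasConstantTerm w' c') (hc : c ≠ 0)
    (q₀ : ℕ) (hv : ∀ q, q₀ ≤ q → v q * w q = w' q) : HasConstantTerm v (c' / c) := by
  obtain ⟨E, hE, rfl⟩ := h
  obtain ⟨E', hE', rfl⟩ := h'
  have hE0 : E ≠ 0 := by
    rintro rfl
    simp at hc
  refine ⟨E' * E⁻¹, hE.div hE' hE0 ?_ q₀ hv, ?_⟩
  · rw [mul_assoc, PowerSeries.inv_mul_cancel _ hc, mul_one]
  · rw [map_mul, PowerSeries.constantCoeff_inv, div_eq_mul_inv]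

end HasConstantTerm

/-- The expansion of the family `w` is divisible by `q - 1`, and the quotient has constant
term `c`. -/
def HasFirstOrderTerm (w : ℕ → PowerSeries ℂ) (c : RatFunc ℚ) : Prop :=
  ∃ E, IsRationalFamily w (PowerSeries.X * E) ∧ PowerSeries.constantCoeff E = c

theorem HasFirstOrderTerm.div {w w' v : ℕ → PowerSeries ℂ} {c c' : RatFunc ℚ}
    (h : HasFirstOrderTerm w c) (h' : HasFirstOrderTerm w' c') (hc : c ≠ 0)
    (q₀ : ℕ) (hv : ∀ q, q₀ ≤ q → v q * w q = w' q) : HasConstantTerm v (c' / c) := by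
  obtain ⟨E, hE, rfl⟩ := h
  obtain ⟨E', hE', rfl⟩ := h'
  have hE0 : PowerSeries.X * E ≠ 0 := by
    refine mul_ne_zero PowerSeries.X_ne_zero ?_
    rintro rfl
    simp at hc
  refine ⟨E' * E⁻¹, hE.div hE' hE0 ?_ q₀ hv, ?_⟩
  · calc E' * E⁻¹ * (PowerSeries.X * E) = PowerSeries.X * E' * (E⁻¹ * E) := by ring
      _ = _ := by rw [PowerSeries.inv_mul_cancel _ hc, mul_one]
  · rw [map_mul, PowerSeries.constantCoeff_inv, div_eq_mul_inv]

theorem exists_onePlusPow_sub_eq_X_mul (a b : RatFunc ℚ) :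
    ∃ E, onePlusPow a - onePlusPow b = PowerSeries.X * E ∧
      PowerSeries.constantCoeff E = a - b := by
  obtain ⟨E, hE⟩ := (PowerSeries.X_dvd_iff (φ := onePlusPow a - onePlusPow b)).mpr (by simp)
  refine ⟨E, hE, ?_⟩
  have := congrArg (PowerSeries.coeff 1) hE
  rw [← zero_add 1, PowerSeries.coeff_succ_X_mul, map_sub,
    PowerSeries.coeff_zero_eq_constantCoeff_apply] at this
  rw [← this]
  simp

theorem expansion_X_zero_pow (i : ℕ) : expansion (MvPolynomial.X 0 ^ i) = onePlusPow i := by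
  rw [onePlusPow, PowerSeries.binomialSeries_nat, expansion, map_pow]
  exact congrArg (· ^ i) expansion_X_zero

theorem hasFirstOrderTerm_pow_sub_pow (i j : ℕ) :
    HasFirstOrderTerm (fun q => (q : PowerSeries ℂ) ^ i - (q : PowerSeries ℂ) ^ j)
      ((i : RatFunc ℚ) - j) := by
  obtain ⟨E, hE, hc⟩ := exists_onePlusPow_sub_eq_X_mul i j
  refine ⟨E, ?_, hc⟩
  have h := IsRationalFamily.of_mvPolynomial (MvPolynomial.X 0 ^ i - MvPolynomial.X 0 ^ j)
  rw [expansion_sub, expansion_X_zero_pow, expansion_X_zero_pow, hE] at h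
  simpa [specialize] using h

theorem hasFirstOrderTerm_pow_sub_pow_mul (d a b : ℕ) :
    HasFirstOrderTerm (fun q => (q : PowerSeries ℂ) ^ d -
        (q : PowerSeries ℂ) ^ a * PowerSeries.X ^ b)
      ((d : RatFunc ℚ) - ((a : RatFunc ℚ) - (b : RatFunc ℚ) * RatFunc.X)) := by
  obtain ⟨E, hE, hc⟩ :=
    exists_onePlusPow_sub_eq_X_mul d ((a : RatFunc ℚ) - (b : RatFunc ℚ) * RatFunc.X)
  refine ⟨E, ?_, hc⟩
  have h := IsRationalFamily.of_mvPolynomial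
    (MvPolynomial.X 0 ^ d - MvPolynomial.X 0 ^ a * MvPolynomial.X 1 ^ b)
  have hb : expansion (MvPolynomial.X 1 ^ b) = onePlusPow (-((b : RatFunc ℚ) * RatFunc.X)) := by
    rw [expansion, map_pow, ← mul_neg, onePlusPow_nsmul]
    exact congrArg (· ^ b) expansion_X_one
  rw [expansion_sub, expansion_mul, expansion_X_zero_pow, expansion_X_zero_pow, hb, onePlusPow,
    onePlusPow, onePlusPow, ← PowerSeries.binomialSeries_add, ← sub_eq_add_neg, hE] at h
  simpa [specialize] using h

theorem HasConstantTerm.natCast_sub_one_mul {w : ℕ → PowerSeries ℂ} {c : RatFunc ℚ}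
    (h : HasConstantTerm w c) :
    HasFirstOrderTerm (fun q => ((q : PowerSeries ℂ) - 1) * w q) c := by
  obtain ⟨E, hE, rfl⟩ := h
  refine ⟨E, ?_, rfl⟩
  have h := IsRationalFamily.of_mvPolynomial (MvPolynomial.X 0 - 1)
  rw [expansion_sub, expansion_X_zero, expansion_one, add_sub_cancel_left] at h
  simpa [specialize] using h.mul hE

/-! ### The zeta function of lattices, formally -/

/-- The Gaussian binomial coefficient, as a quotient; it is meant for `r ≤ n` and `2 ≤ q`. -/
noncomputable def gaussBinom (q n r : ℕ) : ℂ :=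
  ∏ i ∈ Finset.range r, ((q : ℂ) ^ n - (q : ℂ) ^ i) / ((q : ℂ) ^ r - (q : ℂ) ^ i)

theorem natCast_pow_sub_pow_ne_zero {q : ℕ} (hq : 2 ≤ q) {i r : ℕ} (h : i < r) :
    (q : ℂ) ^ r - (q : ℂ) ^ i ≠ 0 := by
  rw [sub_ne_zero]
  exact_mod_cast (Nat.pow_lt_pow_right (by lia : 1 < q) h).ne'

theorem gaussBinom_zero (q n : ℕ) : gaussBinom q n 0 = 1 := Finset.prod_range_zero _

theorem hasConstantTerm_gaussBinom (n r : ℕ) :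
    HasConstantTerm (fun q => PowerSeries.C (gaussBinom q n r))
      (∏ i ∈ Finset.range r, ((n : RatFunc ℚ) - i) / ((r : RatFunc ℚ) - i)) := by
  simp only [gaussBinom, map_prod]
  refine HasConstantTerm.prod _ fun i hi => ?_
  have hir := Finset.mem_range.mp hi
  refine HasFirstOrderTerm.div (hasFirstOrderTerm_pow_sub_pow r i)
    (hasFirstOrderTerm_pow_sub_pow n i) ?_ 2 fun q hq => ?_
  · rw [sub_ne_zero]
    exact_mod_cast hir.ne'
  · have h (j : ℕ) : (q : PowerSeries ℂ) ^ j = PowerSeries.C ((q : ℂ) ^ j) := by simp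
    rw [h, h, h, ← map_sub, ← map_sub, ← map_mul,
      div_mul_cancel₀ _ (natCast_pow_sub_pow_ne_zero hq hir)]

/-- The coefficients of the weighted zeta function of lattices, defined by recursion:
`latticeCoeff q x n e` is the sum of `x ^ m` over the lattices of index `q ^ e` in the free module
of rank `n` over a discrete valuation ring with residue field of cardinality `q`, where `m` is the
exponent of the quotient (see `latticeSum_eq_latticeCoeff`). -/
noncomputable def latticeCoeff (q : ℕ) (x : ℂ) : ℕ → ℕ → ℂ
  | _, 0 => 1
  | n, e + 1 => x * ∑ r ∈ Finset.range n, if r ≤ e then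
      gaussBinom q n (n - (r + 1)) * (q : ℂ) ^ ((e - r) * (n - (r + 1))) *
        latticeCoeff q x (r + 1) (e - r) else 0
  termination_by _ e => e
  decreasing_by lia

/-- The weighted zeta function of lattices, with the variable multiplied by `q ^ k`. -/
noncomputable def latticeSeries (q : ℕ) (x : ℂ) (n k : ℕ) : PowerSeries ℂ :=
  PowerSeries.mk fun e => (q : ℂ) ^ (k * e) * latticeCoeff q x n e

/-- The recursion. The summand `r + 1 = n` is a multiple of the series on the left. -/
theorem latticeSeries_eq (q : ℕ) (x : ℂ) (n k : ℕ) :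
    latticeSeries q x n k = 1 + PowerSeries.C x * ∑ r ∈ Finset.range n,
      PowerSeries.C (gaussBinom q n (n - (r + 1))) * (q : PowerSeries ℂ) ^ (k * (r + 1)) *
        PowerSeries.X ^ (r + 1) * latticeSeries q x (r + 1) (k + (n - (r + 1))) := by
  have hq (j : ℕ) : (q : PowerSeries ℂ) ^ j = PowerSeries.C ((q : ℂ) ^ j) := by simp
  ext e
  cases e with
  | zero =>
    rw [latticeSeries, PowerSeries.coeff_mk, latticeCoeff]
    simp [PowerSeries.coeff_zero_eq_constantCoeff]
  | succ e =>
    rw [latticeSeries, PowerSeries.coeff_mk, latticeCoeff, map_add, PowerSeries.coeff_C_mul,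
      PowerSeries.coeff_one, if_neg (by lia), zero_add, map_sum, mul_left_comm, Finset.mul_sum]
    congr 1
    refine Finset.sum_congr rfl fun r _ => ?_
    rw [hq, ← map_mul, mul_assoc (PowerSeries.C _), PowerSeries.coeff_C_mul,
      PowerSeries.coeff_X_pow_mul']
    by_cases hr : r ≤ e
    · rw [if_pos hr, if_pos (by lia), latticeSeries, PowerSeries.coeff_mk, Nat.add_sub_add_right]
      have : k * (e + 1) = k * (r + 1) + k * (e - r) := by
        rw [← mul_add]; congr 1; lia
      rw [this, add_mul k, pow_add, pow_add]
      ring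
    · rw [if_neg hr, if_neg (by lia), mul_zero, mul_zero]

/-- The leading coefficient at `q = 1` of the zeta function of lattices of rank `n` with weights
`q ^ (-d m)` and argument shifted by `k`. Explicitly it is
`n! / ∏ (j (s - k - n + j) + d)` with the product over `1 ≤ j ≤ n`. -/
noncomputable def latticeLeading (d : ℕ) : ℕ → ℕ → RatFunc ℚ
  | 0, _ => 1
  | n + 1, k => ((n : RatFunc ℚ) + 1) * latticeLeading d n (k + 1) /
      ((d : RatFunc ℚ) + ((n : RatFunc ℚ) + 1) * (RatFunc.X - (k : RatFunc ℚ)))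

theorem natCast_add_mul_X_sub_ne_zero (d n k : ℕ) :
    (d : RatFunc ℚ) + ((n : RatFunc ℚ) + 1) * (RatFunc.X - (k : RatFunc ℚ)) ≠ 0 := by
  have h : algebraMap (Polynomial ℚ) (RatFunc ℚ)
      ((d : Polynomial ℚ) + ((n : Polynomial ℚ) + 1) * (Polynomial.X - (k : Polynomial ℚ))) =
      (d : RatFunc ℚ) + ((n : RatFunc ℚ) + 1) * (RatFunc.X - (k : RatFunc ℚ)) := by simp
  rw [← h]
  refine RatFunc.algebraMap_ne_zero fun h0 => ?_
  have := congrArg (Polynomial.eval ((k : ℚ) + 1)) h0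
  simp at this
  have : (0 : ℚ) < d + (n + 1) := by positivity
  linarith

theorem hasConstantTerm_inv_natCast_pow (d : ℕ) :
    HasConstantTerm (fun q => PowerSeries.C (((q : ℂ) ^ d)⁻¹)) 1 := by
  simpa using HasConstantTerm.div (HasConstantTerm.natCast.pow d) HasConstantTerm.one (by simp) 1
    fun q hq => (by
      have h : (q : PowerSeries ℂ) ^ d = PowerSeries.C ((q : ℂ) ^ d) := by simp
      rw [h, ← map_mul, inv_mul_cancel₀ (pow_ne_zero _ (by exact_mod_cast (by lia : q ≠ 0))),
        map_one])

/-- The lattice zeta function has a pole of order `n` at `q = 1`. In the recursion, the sublattices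
with zero reduction contribute a multiple of the function itself; among the others only those whose
reduction is a line contribute to the leading coefficient. -/
theorem hasConstantTerm_latticeSeries (d n k : ℕ) :
    HasConstantTerm (fun q => ((q : PowerSeries ℂ) - 1) ^ n *
      latticeSeries q (((q : ℂ) ^ d)⁻¹) n k) (latticeLeading d n k) := by
  induction n using Nat.strong_induction_on generalizing k with
  | _ n ih =>
  cases n with
  | zero =>
    simpa [latticeSeries_eq _ _ 0, latticeLeading] using HasConstantTerm.one
  | succ n =>
    have hterm : HasConstantTerm (fun q => ((q : PowerSeries ℂ) - 1) ^ n +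
        PowerSeries.C (((q : ℂ) ^ d)⁻¹) * ∑ r ∈ Finset.range n,
          PowerSeries.C (gaussBinom q (n + 1) (n + 1 - (r + 1))) *
            (q : PowerSeries ℂ) ^ (k * (r + 1)) * PowerSeries.X ^ (r + 1) *
            (((q : PowerSeries ℂ) - 1) ^ (n - (r + 1)) *
            (((q : PowerSeries ℂ) - 1) ^ (r + 1) *
              latticeSeries q (((q : ℂ) ^ d)⁻¹) (r + 1) (k + (n + 1 - (r + 1))))))
        (((n : RatFunc ℚ) + 1) * latticeLeading d n (k + 1)) := by
      have h1 := (HasConstantTerm.natCast_sub_one.pow n).add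
        ((hasConstantTerm_inv_natCast_pow d).mul (HasConstantTerm.sum (Finset.range n)
          fun r hr => (((hasConstantTerm_gaussBinom (n + 1) (n + 1 - (r + 1))).mul
            (HasConstantTerm.natCast.pow (k * (r + 1)))).mul (HasConstantTerm.X.pow (r + 1))).mul
            ((HasConstantTerm.natCast_sub_one.pow (n - (r + 1))).mul
              (ih (r + 1) (by have := Finset.mem_range.mp hr; lia) (k + (n + 1 - (r + 1)))))))
      refine (congrArg (HasConstantTerm _) ?_).mp h1
      -- at `q = 1` the powers of `q - 1` kill all summands but the one with `r + 1 = n`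
      cases n with
      | zero => simp [latticeLeading]
      | succ n =>
        rw [Finset.sum_range_succ, Finset.sum_eq_zero]
        · rw [Nat.add_sub_cancel_left]
          simp
        · intro r hr
          have hr' := Finset.mem_range.mp hr
          rw [zero_pow (by lia)]
          simp
    have h2 := HasFirstOrderTerm.div
      (hasFirstOrderTerm_pow_sub_pow_mul d (k * (n + 1)) (n + 1))
      ((HasConstantTerm.natCast.pow d).mul hterm).natCast_sub_one_mul ?_ 2
      (v := fun q => ((q : PowerSeries ℂ) - 1) ^ (n + 1) *
        latticeSeries q (((q : ℂ) ^ d)⁻¹) (n + 1) k) fun q hq => ?_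
    · refine (congrArg (HasConstantTerm _) ?_).mp h2
      rw [latticeLeading, one_pow, one_mul]
      congr 1
      push_cast
      ring
    · convert natCast_add_mul_X_sub_ne_zero d n k using 1
      push_cast
      ring
    · have hx : (q : PowerSeries ℂ) ^ d * PowerSeries.C (((q : ℂ) ^ d)⁻¹) = 1 := by
        have h : (q : PowerSeries ℂ) ^ d = PowerSeries.C ((q : ℂ) ^ d) := by simp
        rw [h, ← map_mul, mul_inv_cancel₀ (pow_ne_zero _ (by exact_mod_cast (by lia : q ≠ 0))),
          map_one]
      have hrec := latticeSeries_eq q (((q : ℂ) ^ d)⁻¹) (n + 1) k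
      rw [Finset.sum_range_succ, Nat.sub_self, gaussBinom_zero, map_one, add_zero] at hrec
      have hsum : ∑ r ∈ Finset.range n,
          PowerSeries.C (gaussBinom q (n + 1) (n + 1 - (r + 1))) *
            (q : PowerSeries ℂ) ^ (k * (r + 1)) * PowerSeries.X ^ (r + 1) *
            (((q : PowerSeries ℂ) - 1) ^ (n - (r + 1)) *
            (((q : PowerSeries ℂ) - 1) ^ (r + 1) *
              latticeSeries q (((q : ℂ) ^ d)⁻¹) (r + 1) (k + (n + 1 - (r + 1))))) =
          ((q : PowerSeries ℂ) - 1) ^ n * ∑ r ∈ Finset.range n,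
          PowerSeries.C (gaussBinom q (n + 1) (n + 1 - (r + 1))) *
            (q : PowerSeries ℂ) ^ (k * (r + 1)) * PowerSeries.X ^ (r + 1) *
              latticeSeries q (((q : ℂ) ^ d)⁻¹) (r + 1) (k + (n + 1 - (r + 1))) := by
        rw [Finset.mul_sum]
        refine Finset.sum_congr rfl fun r hr => ?_
        have hr' := Finset.mem_range.mp hr
        rw [← pow_sub_mul_pow ((q : PowerSeries ℂ) - 1) (show r + 1 ≤ n by lia)]
        ring
      rw [hsum]
      generalize latticeSeries q (((q : ℂ) ^ d)⁻¹) (n + 1) k = A at hrec ⊢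
      generalize (q : PowerSeries ℂ) - 1 = t
      rw [pow_succ t]
      linear_combination (t ^ n * t * (q : PowerSeries ℂ) ^ d) * hrec +
        (t ^ n * t * (q : PowerSeries ℂ) ^ (k * (n + 1)) * PowerSeries.X ^ (n + 1) * A) * hx

/-! ### The formal representation zeta function -/

/-- The representation zeta function of `K_n` in terms of the variable `q ^ (-s)`: a quotient of
two lattice zeta functions. -/
noncomputable def repSeries (n q : ℕ) : PowerSeries ℂ :=
  latticeSeries q (q : ℂ)⁻¹ n n * (latticeSeries q 1 n 0)⁻¹

theorem constantCoeff_latticeSeries (q : ℕ) (x : ℂ) (n k : ℕ) :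
    PowerSeries.constantCoeff (latticeSeries q x n k) = 1 := by
  rw [← PowerSeries.coeff_zero_eq_constantCoeff_apply, latticeSeries, PowerSeries.coeff_mk,
    latticeCoeff]
  simp

theorem eq_repSeries {n q : ℕ} {F : PowerSeries ℂ}
    (h : F * latticeSeries q 1 n 0 = latticeSeries q (q : ℂ)⁻¹ n n) : F = repSeries n q := by
  rw [repSeries, ← h, mul_assoc, PowerSeries.mul_inv_cancel, mul_one]
  rw [constantCoeff_latticeSeries]
  exact one_ne_zero

theorem latticeLeading_ne_zero (d n k : ℕ) : latticeLeading d n k ≠ 0 := by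
  induction n generalizing k with
  | zero => exact one_ne_zero
  | succ n ih =>
    refine div_ne_zero (mul_ne_zero ?_ (ih _)) (natCast_add_mul_X_sub_ne_zero d n k)
    exact_mod_cast Nat.succ_ne_zero n

theorem hasConstantTerm_repSeries (n : ℕ) :
    HasConstantTerm (repSeries n) (latticeLeading 1 n n / latticeLeading 0 n 0) := by
  refine HasConstantTerm.div (hasConstantTerm_latticeSeries 0 n 0)
    (hasConstantTerm_latticeSeries 1 n n) (latticeLeading_ne_zero 0 n 0) 0 fun q _ => ?_
  simp only [pow_zero, inv_one, pow_one, repSeries]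
  calc _ = (q - 1) ^ n * (latticeSeries q (q : ℂ)⁻¹ n n * ((latticeSeries q 1 n 0)⁻¹ *
        latticeSeries q 1 n 0)) := by ring
    _ = _ := by
      rw [PowerSeries.inv_mul_cancel, mul_one]
      rw [constantCoeff_latticeSeries]
      exact one_ne_zero

/-! ### The value at infinity -/


theorem eventually_eval_denom_ne_zero (f : RatFunc ℚ) :
    ∀ᶠ z : ℂ in cocompact ℂ, Polynomial.eval₂ (algebraMap ℚ ℂ) z f.denom ≠ 0 := by
  have hfin : {z : ℂ | Polynomial.eval₂ (algebraMap ℚ ℂ) z f.denom = 0}.Finite := by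
    have h0 : f.denom.map (algebraMap ℚ ℂ) ≠ 0 := by
      rw [Polynomial.map_ne_zero_iff (algebraMap ℚ ℂ).injective]
      exact f.denom_ne_zero
    refine ((f.denom.map (algebraMap ℚ ℂ)).roots.toFinset.finite_toSet).subset fun z hz => ?_
    rw [Set.mem_ofPred_eq, ← Polynomial.eval_map] at hz
    simp [h0, Polynomial.IsRoot, hz]
  exact (hfin.isCompact.compl_mem_cocompact : _)

/-- The evaluation of rational functions is multiplicative away from the poles only. -/
theorem eventually_eval_mul (f g : RatFunc ℚ) : ∀ᶠ z : ℂ in cocompact ℂ,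
    (f * g).eval (algebraMap ℚ ℂ) z = f.eval (algebraMap ℚ ℂ) z * g.eval (algebraMap ℚ ℂ) z := by
  filter_upwards [eventually_eval_denom_ne_zero f, eventually_eval_denom_ne_zero g] with z hf hg
  exact RatFunc.eval_mul _ _ hf hg

theorem eventually_eval_add (f g : RatFunc ℚ) : ∀ᶠ z : ℂ in cocompact ℂ,
    (f + g).eval (algebraMap ℚ ℂ) z = f.eval (algebraMap ℚ ℂ) z + g.eval (algebraMap ℚ ℂ) z := by
  filter_upwards [eventually_eval_denom_ne_zero f, eventually_eval_denom_ne_zero g] with z hf hg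
  exact RatFunc.eval_add _ _ hf hg

namespace HasValueAtInfinity

variable {f g : RatFunc ℚ} {c d : ℚ}

theorem add (hf : HasValueAtInfinity f c) (hg : HasValueAtInfinity g d) :
    HasValueAtInfinity (f + g) (c + d) := by
  unfold HasValueAtInfinity
  push_cast
  exact (Tendsto.add hf hg).congr' <|
    (eventually_eval_add f g).mono fun _ h => h.symm

theorem mul (hf : HasValueAtInfinity f c) (hg : HasValueAtInfinity g d) :
    HasValueAtInfinity (f * g) (c * d) := by
  unfold HasValueAtInfinity
  push_cast
  exact (Tendsto.mul hf hg).congr' <|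
    (eventually_eval_mul f g).mono fun _ h => h.symm

theorem const (c : ℚ) : HasValueAtInfinity (RatFunc.C c) c := by
  unfold HasValueAtInfinity
  simp only [RatFunc.eval_C]
  exact tendsto_const_nhds

theorem inv_X_add (a : ℚ) : HasValueAtInfinity (RatFunc.X + RatFunc.C a)⁻¹ 0 := by
  have h0 : (RatFunc.X + RatFunc.C a : RatFunc ℚ) ≠ 0 := by
    intro h
    have : algebraMap (Polynomial ℚ) (RatFunc ℚ) (Polynomial.X + Polynomial.C a) = 0 := by
      simpa using h
    exact Polynomial.X_add_C_ne_zero a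
      (RatFunc.algebraMap_injective ℚ (by rw [this, map_zero]))
  have hinf : Tendsto (fun z : ℂ => z + (a : ℂ)) (cocompact ℂ) (cocompact ℂ) :=
    (Homeomorph.addRight (a : ℂ)).isClosedEmbedding.tendsto_cocompact
  unfold HasValueAtInfinity
  rw [Rat.cast_zero]
  refine (tendsto_inv₀_cobounded.comp (hinf.mono_right ?_)).congr' ?_
  · rw [Metric.cobounded_eq_cocompact]
  · filter_upwards [eventually_eval_mul (RatFunc.X + RatFunc.C a)⁻¹ (RatFunc.X + RatFunc.C a),
      eventually_eval_add RatFunc.X (RatFunc.C a)] with z hm ha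
    rw [inv_mul_cancel₀ h0, RatFunc.eval_one, ha, RatFunc.eval_X, RatFunc.eval_C] at hm
    exact (eq_inv_of_mul_eq_one_left hm.symm).symm

end HasValueAtInfinity

namespace HasOmega

variable {Z Z' : RatFunc ℚ} {c c' : ℚ}

theorem hasValueAtInfinity (h : HasOmega Z c) : HasValueAtInfinity Z 1 := by
  have h1 := (HasValueAtInfinity.mul (HasValueAtInfinity.inv_X_add 0) h).add
    (HasValueAtInfinity.const 1)
  have : (RatFunc.X + RatFunc.C (0 : ℚ))⁻¹ * (RatFunc.X * (Z - 1)) + RatFunc.C 1 = Z := by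
    rw [map_zero, add_zero, map_one, inv_mul_cancel_left₀ RatFunc.X_ne_zero, sub_add_cancel]
  rwa [this, zero_mul, zero_add] at h1

theorem one : HasOmega 1 0 := by
  have := HasValueAtInfinity.const 0
  rw [map_zero] at this
  rw [HasOmega, sub_self, mul_zero]
  exact this

theorem mul (h : HasOmega Z c) (h' : HasOmega Z' c') : HasOmega (Z * Z') (c + c') := by
  have h1 := (HasValueAtInfinity.mul h h'.hasValueAtInfinity).add h'
  rw [mul_one] at h1
  have : RatFunc.X * (Z - 1) * Z' + RatFunc.X * (Z' - 1) = RatFunc.X * (Z * Z' - 1) := by ring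
  rwa [this] at h1

theorem div_X_add (a b : ℚ) :
    HasOmega ((RatFunc.X + RatFunc.C a) / (RatFunc.X + RatFunc.C b)) (a - b) := by
  have h0 : (RatFunc.X + RatFunc.C b : RatFunc ℚ) ≠ 0 := by
    intro h
    have : algebraMap (Polynomial ℚ) (RatFunc ℚ) (Polynomial.X + Polynomial.C b) = 0 := by
      simpa using h
    exact Polynomial.X_add_C_ne_zero b
      (RatFunc.algebraMap_injective ℚ (by rw [this, map_zero]))
  -- `s ((s + a) / (s + b) - 1) = (a - b) (1 - b / (s + b))`
  have h1 := (HasValueAtInfinity.const (a - b)).mul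
    ((HasValueAtInfinity.const 1).add
      ((HasValueAtInfinity.const (-b)).mul (HasValueAtInfinity.inv_X_add b)))
  rw [HasOmega]
  convert h1 using 1
  · simp only [map_sub, map_one, map_neg]
    field_simp
    ring
  · ring

end HasOmega

/-- The step from `n` to `n + 1` multiplies the quotient of the leading coefficients by
`(s - b) / (s - a + 1 / (n + 1))`, and `HasOmega` turns products into sums. -/
theorem hasOmega_latticeLeading_div (n a b : ℕ) :
    HasOmega (latticeLeading 1 n a / latticeLeading 0 n b)
      (n * ((a : ℚ) - b) - ∑ k ∈ Finset.Icc 1 n, 1 / (k : ℚ)) := by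
  induction n generalizing a b with
  | zero => simpa [latticeLeading] using HasOmega.one
  | succ n ih =>
    have hn : ((n : RatFunc ℚ) + 1) ≠ 0 := by exact_mod_cast Nat.succ_ne_zero n
    have h := (ih (a + 1) (b + 1)).mul (HasOmega.div_X_add (-b) (-a + 1 / ((n : ℚ) + 1)))
    convert h using 1
    · have h1 := natCast_add_mul_X_sub_ne_zero 1 n a
      have h2 := natCast_add_mul_X_sub_ne_zero 0 n b
      have h3 := latticeLeading_ne_zero 0 n (b + 1)
      have h4 : (RatFunc.X + RatFunc.C (-a + 1 / ((n : ℚ) + 1)) : RatFunc ℚ) =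
          (((1 : ℕ) : RatFunc ℚ) + ((n : RatFunc ℚ) + 1) * (RatFunc.X - (a : RatFunc ℚ))) /
            ((n : RatFunc ℚ) + 1) := by
        simp only [map_add, map_neg, map_div₀, map_one, map_natCast]
        field_simp
        push_cast
        ring
      have h5 : (RatFunc.X + RatFunc.C (-(b : ℚ)) : RatFunc ℚ) =
          (((0 : ℕ) : RatFunc ℚ) + ((n : RatFunc ℚ) + 1) * (RatFunc.X - (b : RatFunc ℚ))) /
            ((n : RatFunc ℚ) + 1) := by
        simp only [map_neg, map_natCast]
        field_simp
        push_cast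
        ring
      rw [h4, h5, latticeLeading, latticeLeading]
      generalize ((1 : ℕ) : RatFunc ℚ) + ((n : RatFunc ℚ) + 1) *
        (RatFunc.X - (a : RatFunc ℚ)) = u at h1 ⊢
      generalize ((0 : ℕ) : RatFunc ℚ) + ((n : RatFunc ℚ) + 1) *
        (RatFunc.X - (b : RatFunc ℚ)) = v at h2 ⊢
      field_simp
    · rw [Finset.sum_Icc_succ_top (by lia)]
      push_cast
      ring

/-! ### Uniqueness of the topological zeta function -/

theorem evalAt_mul (P Q : MvPolynomial (Fin 2) ℚ) (q : ℕ) (s : ℂ) :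
    evalAt (P * Q) q s = evalAt P q s * evalAt Q q s := map_mul _ _ _

theorem evalAt_sub (P Q : MvPolynomial (Fin 2) ℚ) (q : ℕ) (s : ℂ) :
    evalAt (P - Q) q s = evalAt P q s - evalAt Q q s := map_sub _ _ _

theorem eventually_le_absNorm (F : Type*) [Field F] [NumberField F] (q₀ : ℕ) :
    ∀ᶠ v : IsDedekindDomain.HeightOneSpectrum (𝓞 F) in cofinite,
      q₀ ≤ Ideal.absNorm v.asIdeal := by
  rw [eventually_cofinite]
  refine Set.Finite.of_finite_image (f := fun v => v.asIdeal)
    ((Ideal.finite_setOfPred_absNorm_le (S := 𝓞 F) q₀).subset ?_) ?_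
  · rintro _ ⟨v, hv, rfl⟩
    exact (not_le.mp hv).le
  · exact fun v _ w _ h => IsDedekindDomain.HeightOneSpectrum.ext h

instance : Infinite (IsDedekindDomain.HeightOneSpectrum (𝓞 ℚ)) :=
  Infinite.of_surjective _ (Rat.HeightOneSpectrum.primesEquiv (R := 𝓞 ℚ)).surjective

/-- Two rational functions that interpolate the same local zeta functions agree, since they agree
at `(q, q ^ (-s))` for infinitely many `q` and all `s` in a right half-plane. -/
theorem IsTopRepZeta.unique {n : ℕ} {Z Z' : RatFunc ℚ} (h : IsTopRepZeta n Z)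
    (h' : IsTopRepZeta n Z') : Z = Z' := by
  obtain ⟨P, Q, hQ, hloc, E, hE, rfl⟩ := h
  obtain ⟨P', Q', hQ', hloc', E', hE', rfl⟩ := h'
  have hPQ : P * Q' - P' * Q = 0 := by
    by_contra hne
    obtain ⟨q₀, hq₀⟩ := exists_evalAt_ne_zero hne
    obtain ⟨v, ⟨⟨σ₁, h1⟩, -, σ₂, h2⟩, ⟨⟨σ₃, h3⟩, -, σ₄, h4⟩, hv⟩ :=
      ((hloc ℚ).and ((hloc' ℚ).and (eventually_le_absNorm ℚ q₀))).exists
    obtain ⟨σ₅, h5⟩ := hq₀ _ hv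
    set M := max σ₁ (max σ₂ (max σ₃ (max σ₄ σ₅))) with hM
    have hs : ∀ σ ≤ M, σ < (((M + 1 : ℝ) : ℂ)).re := fun σ hσ => by
      rw [Complex.ofReal_re]; linarith
    have e1 := h1 _ (hs σ₁ (by simp [hM]))
    have e2 := h2 _ (hs σ₂ (by simp [hM]))
    have e3 := h3 _ (hs σ₃ (by simp [hM]))
    have e4 := h4 _ (hs σ₄ (by simp [hM]))
    refine h5 _ (hs σ₅ (by simp [hM])) ?_
    have := e2.unique e4
    rw [div_eq_div_iff e1 e3] at this
    rw [evalAt_sub, evalAt_mul, evalAt_mul, this, sub_self]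
  have hEE : (E - E') * (expansion Q * expansion Q') = 0 := by
    have := congrArg expansion hPQ
    rw [expansion_sub, expansion_mul, expansion_mul, expansion_zero, ← hE, ← hE'] at this
    linear_combination this
  rw [sub_eq_zero.mp ((mul_eq_zero.mp hEE).resolve_right
    (mul_ne_zero (expansion_ne_zero hQ) (expansion_ne_zero hQ')))]

/-! ### From generating series to representation zeta functions -/

/-- A group whose irreducible representations have dimensions powers of `q`, and for which the
generating series of the numbers of twist classes is a rational function. -/
theorem hasRepZeta_of_mul_eq {G : Type*} [Group G] [TopologicalSpace G] {q : ℕ} (hq : 2 ≤ q)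
    {p r : Polynomial ℂ} (hr : r ≠ 0) (hfin : ∀ d, Finite (TwistClass G d))
    (hdim : ∀ d, (∀ e, d ≠ q ^ e) → Nat.card (TwistClass G d) = 0)
    (h : (PowerSeries.mk fun e => (Nat.card (TwistClass G (q ^ e)) : ℂ)) * (r : PowerSeries ℂ) =
      p) :
    (∃ σ : ℝ, ∀ s : ℂ, σ < s.re → r.eval ((q : ℂ) ^ (-s)) ≠ 0) ∧
      HasRepZeta G fun s => p.eval ((q : ℂ) ^ (-s)) / r.eval ((q : ℂ) ^ (-s)) := by
  obtain ⟨ρ, hρ, hsum⟩ := exists_hasSum_of_mul_eq_polynomial hr h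
  obtain ⟨σ, hσ⟩ := exists_norm_natCast_cpow_neg_lt hq hρ
  refine ⟨⟨σ, fun s hs => (hsum _ (hσ s hs).1 (hσ s hs).2).1⟩, hfin, σ, fun s hs => ?_⟩
  have hs' := (hsum _ (hσ s hs).1 (hσ s hs).2).2
  have hinj : Function.Injective fun e : ℕ => q ^ e := Nat.pow_right_injective hq
  rw [LSeriesHasSum, ← hinj.hasSum_iff]
  · convert hs' using 1
    funext e
    have hq0 : q ^ e ≠ 0 := pow_ne_zero _ (by lia)
    simp only [Function.comp_apply, LSeries.term_def, if_neg hq0, PowerSeries.coeff_mk]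
    rw [Nat.cast_pow, ← Complex.natCast_cpow_natCast_mul, mul_comm (e : ℂ) s,
      Complex.cpow_mul_nat, Complex.cpow_neg, inv_pow, div_eq_mul_inv]
  · intro d hd
    rw [LSeries.term_def, hdim d fun e he => hd ⟨e, he.symm⟩]
    simp

/-! ### Indices of submodules -/

section CardQuot

variable {R M M' : Type*} [CommRing R] [AddCommGroup M] [Module R M] [AddCommGroup M'] [Module R M']

theorem cardQuot_map_of_injective (N : Submodule R M) {f : M →ₗ[R] M'}
    (hf : Function.Injective f) :
    (N.map f).cardQuot = N.cardQuot * (LinearMap.range f).cardQuot :=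
  N.toAddSubgroup.index_map_of_injective (f := f.toAddMonoidHom) hf

theorem cardQuot_comap_of_surjective (N : Submodule R M') {f : M →ₗ[R] M'}
    (hf : Function.Surjective f) : (N.comap f).cardQuot = N.cardQuot :=
  N.toAddSubgroup.index_comap_of_surjective (f := f.toAddMonoidHom) hf

theorem cardQuot_ker_of_surjective {f : M →ₗ[R] M'} (hf : Function.Surjective f) :
    (LinearMap.ker f).cardQuot = Nat.card M' := by
  rw [Submodule.cardQuot_apply]
  exact Nat.card_congr (f.quotKerEquivOfSurjective hf).toEquiv

theorem cardQuot_map_equiv (N : Submodule R M) (e : M ≃ₗ[R] M') :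
    (N.map (e : M →ₗ[R] M')).cardQuot = N.cardQuot := by
  rw [cardQuot_map_of_injective N e.injective, LinearEquiv.range, Submodule.cardQuot_top, mul_one]

/-- The scalars that kill `M ⧸ N`. -/
abbrev scalarIdeal (N : Submodule R M) : Ideal R := Module.annihilator R (M ⧸ N)

theorem mem_scalarIdeal {N : Submodule R M} {r : R} : r ∈ scalarIdeal N ↔ ∀ x : M, r • x ∈ N := by
  rw [scalarIdeal, Module.mem_annihilator]
  constructor
  · intro h x
    rw [← Submodule.Quotient.mk_eq_zero, Submodule.Quotient.mk_smul]
    exact h _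
  · intro h x
    obtain ⟨x, rfl⟩ := N.mkQ_surjective x
    rw [← map_smul, Submodule.mkQ_apply, Submodule.Quotient.mk_eq_zero]
    exact h x

theorem scalarIdeal_map_equiv (N : Submodule R M) (e : M ≃ₗ[R] M') :
    scalarIdeal (N.map (e : M →ₗ[R] M')) = scalarIdeal N := by
  ext r
  simp only [mem_scalarIdeal]
  constructor
  · intro h x
    obtain ⟨y, hy, hyx⟩ := h (e x)
    rw [← map_smul] at hyx
    rwa [← e.injective hyx]
  · intro h x
    exact ⟨_, h (e.symm x), by simp⟩

end CardQuot

/-! ### Lattices over a discrete valuation ring -/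


section DVR

variable (R : Type*) [CommRing R] [IsDomain R] [IsDiscreteValuationRing R]

/-- The cardinality of the residue field. -/
noncomputable def residueCard : ℕ := Nat.card (ResidueField R)

variable {R} in
theorem cardQuot_span_pow {ϖ : R} (hϖ : Irreducible ϖ) (k : ℕ) :
    (Ideal.span {ϖ ^ k}).cardQuot = residueCard R ^ k := by
  have hm := hϖ.maximalIdeal_eq
  rw [← Ideal.span_singleton_pow, ← hm,
    cardQuot_pow_of_prime (IsDiscreteValuationRing.not_a_field R)]
  rfl

variable [Finite (ResidueField R)]

theorem two_le_residueCard : 2 ≤ residueCard R := Finite.one_lt_card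

variable {R}

theorem finite_quotient_span_pow {ϖ : R} (hϖ : Irreducible ϖ) (k : ℕ) :
    Finite (R ⧸ Ideal.span {ϖ ^ k}) := by
  apply Nat.finite_of_card_ne_zero
  rw [← Submodule.cardQuot_apply, cardQuot_span_pow hϖ]
  exact pow_ne_zero _ (by have := two_le_residueCard R; lia)

variable {M : Type*} [AddCommGroup M] [Module R M]

/-- A finite module is killed by a power of the uniformizer. -/
theorem pow_mem_annihilator_of_finite {ϖ : R} (hϖ : Irreducible ϖ) [Finite M] :
    ϖ ^ (Nat.card M ^ Nat.card M) ∈ Module.annihilator R M := by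
  set I := Module.annihilator R M with hI
  have hinj : Function.Injective (fun r : R ⧸ I => Quotient.liftOn' r (fun r (x : M) => r • x)
      (fun a b hab => by
        funext x
        rw [Submodule.quotientRel_def] at hab
        have := Module.mem_annihilator.mp hab x
        rwa [sub_smul, sub_eq_zero] at this)) := by
    intro a b
    induction a using Quotient.inductionOn' with | _ a =>
    induction b using Quotient.inductionOn' with | _ b =>
    intro h
    refine Quotient.sound' ?_
    rw [Submodule.quotientRel_def, hI, Module.mem_annihilator]
    intro x
    rw [sub_smul, sub_eq_zero]
    exact congrFun h x
  have hfin : Finite (R ⧸ I) := Finite.of_injective _ hinj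
  have hne : I ≠ ⊥ := by
    intro h
    rw [h] at hfin
    have : Finite R := Finite.of_equiv _ (RingEquiv.quotientBot R).toEquiv
    exact IsDiscreteValuationRing.not_isField R (Finite.isField_of_domain R)
  obtain ⟨k, hk⟩ := IsDiscreteValuationRing.ideal_eq_span_pow_irreducible hne hϖ
  have hcard := Nat.card_le_card_of_injective _ hinj
  rw [← Submodule.cardQuot_apply, hk, cardQuot_span_pow hϖ, Nat.card_fun] at hcard
  have : k ≤ Nat.card M ^ Nat.card M :=
    (Nat.lt_pow_self (by have := two_le_residueCard R; lia)).le.trans hcard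
  rw [hk, Ideal.mem_span_singleton]
  exact pow_dvd_pow _ this

theorem pow_mem_scalarIdeal {ϖ : R} (hϖ : Irreducible ϖ) {N : Submodule R M}
    (hN : N.cardQuot ≠ 0) : ϖ ^ (N.cardQuot ^ N.cardQuot) ∈ scalarIdeal N := by
  rw [Submodule.cardQuot_apply] at hN ⊢
  have := Nat.finite_of_card_ne_zero hN
  exact pow_mem_annihilator_of_finite hϖ

theorem finite_quotient_of_pow_mem [Module.Finite R M] {ϖ : R} (hϖ : Irreducible ϖ)
    {N : Submodule R M} {k : ℕ} (h : ϖ ^ k ∈ scalarIdeal N) : Finite (M ⧸ N) := by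
  have := finite_quotient_span_pow hϖ k
  have h2 : Finite (M ⧸ (Ideal.span {ϖ ^ k} • ⊤ : Submodule R M)) :=
    Submodule.finite_quotient_smul _ Module.Finite.fg_top
  have hle : (Ideal.span {ϖ ^ k} • ⊤ : Submodule R M) ≤ N := by
    rw [Submodule.smul_le]
    intro r hr x _
    obtain ⟨c, rfl⟩ := Ideal.mem_span_singleton.mp hr
    rw [mul_comm, mul_smul]
    exact N.smul_mem _ (mem_scalarIdeal.mp h x)
  exact Finite.of_surjective _ (Submodule.factor_surjective hle)

/-- There are finitely many submodules of given finite index. -/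
theorem finite_setOf_cardQuot_eq [Module.Finite R M] {c : ℕ} (hc : c ≠ 0) :
    Finite {N : Submodule R M // N.cardQuot = c} := by
  obtain ⟨ϖ, hϖ⟩ := IsDiscreteValuationRing.exists_irreducible R
  set L : Submodule R M := Ideal.span {ϖ ^ (c ^ c)} • ⊤ with hL
  have := finite_quotient_span_pow hϖ (c ^ c)
  have h2 : Finite (M ⧸ L) := Submodule.finite_quotient_smul _ Module.Finite.fg_top
  have h3 : Finite (Submodule R (M ⧸ L)) :=
    Finite.of_injective (fun N : Submodule R (M ⧸ L) => (N : Set (M ⧸ L))) SetLike.coe_injective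
  have h4 : Finite (Set.Ici L) := Finite.of_equiv _ (Submodule.comapMkQRelIso L).toEquiv
  refine Finite.of_injective (β := Set.Ici L) (fun N => ⟨N.1, ?_⟩) ?_
  · rw [Set.mem_Ici, hL, Submodule.smul_le]
    intro r hr x _
    obtain ⟨s, rfl⟩ := Ideal.mem_span_singleton.mp hr
    have h := pow_mem_scalarIdeal hϖ (N := N.1) (by rw [N.2]; exact hc)
    rw [N.2] at h
    rw [mul_comm, mul_smul]
    exact N.1.smul_mem _ (mem_scalarIdeal.mp h x)
  · intro N N' h
    exact Subtype.ext (congrArg (fun S : Set.Ici L => S.1) h)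

/-- The cardinality of a finite module is a power of the cardinality of the residue field. -/
theorem exists_card_eq_residueCard_pow (M : Type*) [AddCommGroup M] [Module R M] [Finite M] :
    ∃ e, Nat.card M = residueCard R ^ e := by
  generalize hc : Nat.card M = c
  induction c using Nat.strong_induction_on generalizing M with
  | _ c ih =>
  rcases subsingleton_or_nontrivial M with hs | hn
  · exact ⟨0, by rw [← hc, Nat.card_unique, pow_zero]⟩
  have hlt : (maximalIdeal R • ⊤ : Submodule R M) ≠ ⊤ := by
    intro h
    have := Submodule.eq_bot_of_le_smul_of_le_jacobson_bot (maximalIdeal R) (⊤ : Submodule R M)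
      Module.Finite.fg_top (by rw [h]) (IsLocalRing.maximalIdeal_le_jacobson _)
    exact top_ne_bot this
  have hfin : Finite (M ⧸ (maximalIdeal R • ⊤ : Submodule R M)) :=
    Finite.of_surjective _ (Submodule.mkQ_surjective _)
  have hmul := Submodule.card_eq_card_quotient_mul_card (maximalIdeal R • ⊤ : Submodule R M)
  have h1 : 1 < Nat.card (M ⧸ (maximalIdeal R • ⊤ : Submodule R M)) := by
    have : Nontrivial (M ⧸ (maximalIdeal R • ⊤ : Submodule R M)) :=
      Submodule.Quotient.nontrivial_iff.mpr hlt
    exact Finite.one_lt_card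
  have h2 : 0 < Nat.card (maximalIdeal R • ⊤ : Submodule R M) := Nat.card_pos
  obtain ⟨e, he⟩ := ih (Nat.card (maximalIdeal R • ⊤ : Submodule R M))
    (by rw [← hc, hmul]; nlinarith) _ rfl
  have hq : Nat.card (M ⧸ (maximalIdeal R • ⊤ : Submodule R M)) = residueCard R ^
      @Module.finrank (R ⧸ maximalIdeal R) (M ⧸ (maximalIdeal R • ⊤ : Submodule R M)) _ _
        inferInstance := by
    let := Ideal.Quotient.field (maximalIdeal R)
    have : Finite (R ⧸ maximalIdeal R) := ‹Finite (ResidueField R)›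
    exact Module.natCard_eq_pow_finrank (K := R ⧸ maximalIdeal R)
  exact ⟨_, by rw [← hc, hmul, he, hq, ← pow_add]⟩

end DVR

/-! ### Lattices with a given reduction -/

section Fibre

variable {R A B : Type*} [CommRing R] [AddCommGroup A] [Module R A] [AddCommGroup B] [Module R B]

/-- The map `(a, b) ↦ (a, ϖ b)`. -/
def scaleSnd (A B : Type*) [AddCommGroup A] [Module R A] [AddCommGroup B] [Module R B] (ϖ : R) :
    A × B →ₗ[R] A × B :=
  LinearMap.prodMap LinearMap.id (ϖ • LinearMap.id)

theorem scaleSnd_apply (ϖ : R) (x : A × B) : scaleSnd A B ϖ x = (x.1, ϖ • x.2) := rfl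

/-- The submodule of all `(a, b)` with `b` in the class `φ a` modulo `N`. -/
def graphMod (N : Submodule R B) (φ : A →ₗ[R] B ⧸ N) : Submodule R (A × B) :=
  LinearMap.ker (φ ∘ₗ LinearMap.fst R A B - N.mkQ ∘ₗ LinearMap.snd R A B)

theorem mem_graphMod {N : Submodule R B} {φ : A →ₗ[R] B ⧸ N} {x : A × B} :
    x ∈ graphMod N φ ↔ φ x.1 = N.mkQ x.2 := by
  simp [graphMod, LinearMap.mem_ker, sub_eq_zero]

theorem cardQuot_graphMod (N : Submodule R B) (φ : A →ₗ[R] B ⧸ N) :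
    (graphMod N φ).cardQuot = N.cardQuot := by
  rw [graphMod, cardQuot_ker_of_surjective, Submodule.cardQuot_apply]
  intro y
  obtain ⟨b, rfl⟩ := N.mkQ_surjective y
  exact ⟨(0, -b), by simp⟩

/-- The lattice `{(a, ϖ b) | b ∈ φ a}`. -/
def fibreLattice (ϖ : R) (N : Submodule R B) (φ : A →ₗ[R] B ⧸ N) : Submodule R (A × B) :=
  (graphMod N φ).map (scaleSnd A B ϖ)

variable [IsDomain R]

theorem scaleSnd_injective [Module.IsTorsionFree R B] {ϖ : R} (hϖ : ϖ ≠ 0) :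
    Function.Injective (scaleSnd A B ϖ) := by
  rintro ⟨a, b⟩ ⟨a', b'⟩ h
  simp only [scaleSnd_apply, Prod.mk.injEq] at h
  exact Prod.ext h.1 (smul_right_injective B hϖ h.2)

variable {ϖ : R}

theorem fibreLattice_injective [Module.IsTorsionFree R B] (hϖ : ϖ ≠ 0) :
    Function.Injective fun x : Σ N : Submodule R B, A →ₗ[R] B ⧸ N => fibreLattice ϖ x.1 x.2 := by
  rintro ⟨N, φ⟩ ⟨N', φ'⟩ h
  have hg : graphMod N φ = graphMod N' φ' :=
    Submodule.map_injective_of_injective (scaleSnd_injective hϖ) h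
  obtain rfl : N = N' := by
    ext b
    have := SetLike.ext_iff.mp hg (0, b)
    simp only [mem_graphMod, map_zero] at this
    rwa [eq_comm, Submodule.mkQ_apply, Submodule.Quotient.mk_eq_zero, eq_comm,
      Submodule.mkQ_apply, Submodule.Quotient.mk_eq_zero] at this
  congr 1
  ext a
  obtain ⟨b, hb⟩ := N.mkQ_surjective (φ a)
  have := (SetLike.ext_iff.mp hg (a, b)).mp (mem_graphMod.mpr hb.symm)
  rw [← hb, mem_graphMod.mp this]

/-- The vector `b₀` is primitive: it forces a scalar that maps everything into the fibre lattice to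
be a multiple of the uniformizer. -/
theorem mem_scalarIdeal_fibreLattice [Module.IsTorsionFree R B] (hϖ : Irreducible ϖ)
    {b₀ : B} (hb₀ : ∀ b : B, ∀ r : R, r • b₀ = ϖ • b → ϖ ∣ r)
    (N : Submodule R B) (φ : A →ₗ[R] B ⧸ N) (r : R) :
    r ∈ scalarIdeal (fibreLattice ϖ N φ) ↔ ∃ s ∈ scalarIdeal N, r = ϖ * s := by
  rw [mem_scalarIdeal]
  constructor
  · intro h
    obtain ⟨y, -, hy⟩ := h (0, b₀)
    obtain ⟨s, rfl⟩ := hb₀ y.2 r (congrArg Prod.snd hy).symm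
    refine ⟨s, mem_scalarIdeal.mpr fun b => ?_, rfl⟩
    obtain ⟨y, hyK, hy⟩ := h (0, b)
    have h1 := congrArg Prod.fst hy
    have h2 := congrArg Prod.snd hy
    simp only [scaleSnd_apply, Prod.smul_mk, smul_zero] at h1 h2
    rw [mul_smul] at h2
    rw [← smul_right_injective B hϖ.ne_zero h2]
    have := mem_graphMod.mp hyK
    rwa [h1, map_zero, eq_comm, Submodule.mkQ_apply, Submodule.Quotient.mk_eq_zero] at this
  · rintro ⟨s, hs, rfl⟩ ⟨a, b⟩
    refine ⟨((ϖ * s) • a, s • b), mem_graphMod.mpr ?_, by simp [scaleSnd_apply, mul_smul]⟩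
    have h1 : N.mkQ (s • b) = 0 := by
      rw [Submodule.mkQ_apply, Submodule.Quotient.mk_eq_zero]
      exact mem_scalarIdeal.mp hs b
    rw [h1]
    simp only [map_smul, mul_smul]
    obtain ⟨c, hc⟩ := N.mkQ_surjective (φ a)
    have h2 : s • φ a = 0 := by
      rw [← hc, ← map_smul, Submodule.mkQ_apply, Submodule.Quotient.mk_eq_zero]
      exact mem_scalarIdeal.mp hs c
    rw [h2, smul_zero]

variable [IsDiscreteValuationRing R]

theorem fibreLattice_sup (hϖ : Irreducible ϖ) (N : Submodule R B) (φ : A →ₗ[R] B ⧸ N) :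
    fibreLattice ϖ N φ ⊔ maximalIdeal R • ⊤ = LinearMap.range (scaleSnd A B ϖ) := by
  apply le_antisymm
  · refine sup_le ?_ ?_
    · rw [fibreLattice]
      exact LinearMap.map_le_range
    · rw [hϖ.maximalIdeal_eq, Submodule.ideal_span_singleton_smul]
      rintro _ ⟨⟨a, b⟩, -, rfl⟩
      exact ⟨(ϖ • a, b), rfl⟩
  · rintro _ ⟨⟨a, b⟩, rfl⟩
    obtain ⟨b', hb'⟩ := N.mkQ_surjective (φ a)
    have h1 : scaleSnd A B ϖ (a, b') ∈ fibreLattice ϖ N φ :=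
      Submodule.mem_map_of_mem (mem_graphMod.mpr hb'.symm)
    have h2 : ϖ • ((0, b - b') : A × B) ∈ (maximalIdeal R • ⊤ : Submodule R (A × B)) := by
      refine Submodule.smul_mem_smul ?_ trivial
      rw [hϖ.maximalIdeal_eq]
      exact Ideal.mem_span_singleton_self ϖ
    convert Submodule.add_mem_sup h1 h2 using 1
    simp [scaleSnd_apply, smul_sub]

/-- By Nakayama's lemma, a lattice that reduces to `A ⧸ m A` projects onto `A`, hence is a graph
modulo its intersection with `B`. -/
theorem exists_fibreLattice_eq [Module.IsTorsionFree R B] [Module.Finite R A]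
    [Module.Projective R A] {L : Submodule R (A × B)}
    (hL : L ⊔ maximalIdeal R • ⊤ = LinearMap.range (scaleSnd A B ϖ)) :
    ∃ (N : Submodule R B) (φ : A →ₗ[R] B ⧸ N), fibreLattice ϖ N φ = L := by
  set K := L.comap (scaleSnd A B ϖ) with hK
  have hLK : K.map (scaleSnd A B ϖ) = L := by
    rw [hK, Submodule.map_comap_eq_self]
    rw [← hL]
    exact le_sup_left
  set p : K →ₗ[R] A := LinearMap.fst R A B ∘ₗ K.subtype with hp
  have hsurj : Function.Surjective p := by
    rw [← LinearMap.range_eq_top, eq_top_iff]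
    refine Submodule.le_of_le_smul_of_le_jacobson_bot (I := maximalIdeal R) Module.Finite.fg_top
      (IsLocalRing.maximalIdeal_le_jacobson _) ?_
    intro a _
    have ha : ((a, 0) : A × B) ∈ L ⊔ maximalIdeal R • ⊤ := by
      rw [hL]
      exact ⟨(a, 0), by simp [scaleSnd_apply]⟩
    obtain ⟨l, hl, z, hz, hlz⟩ := Submodule.mem_sup.mp ha
    have hfst := congrArg Prod.fst hlz
    simp only [Prod.fst_add] at hfst
    rw [← hfst]
    refine Submodule.add_mem_sup ?_ ?_
    · rw [← hLK] at hl
      obtain ⟨k, hk, rfl⟩ := hl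
      exact ⟨⟨k, hk⟩, rfl⟩
    · have := Submodule.mem_map_of_mem (f := LinearMap.fst R A B) hz
      rw [Submodule.map_smul''] at this
      exact Submodule.smul_mono le_rfl le_top this
  obtain ⟨σ, hσ⟩ := Module.projective_lifting_property p LinearMap.id hsurj
  have hσ' (a : A) : ((σ a : K) : A × B).1 = a := LinearMap.congr_fun hσ a
  set N : Submodule R B := K.comap (LinearMap.inr R A B) with hN
  refine ⟨N, N.mkQ ∘ₗ LinearMap.snd R A B ∘ₗ K.subtype ∘ₗ σ, ?_⟩
  rw [fibreLattice, ← hLK]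
  congr 1
  ext ⟨a, b⟩
  rw [mem_graphMod]
  simp only [LinearMap.comp_apply, LinearMap.snd_apply, Submodule.subtype_apply]
  rw [eq_comm, Submodule.mkQ_apply, Submodule.mkQ_apply, Submodule.Quotient.eq, hN,
    Submodule.mem_comap]
  have : LinearMap.inr R A B (b - ((σ a : K) : A × B).2) = (a, b) - (σ a : K) := by
    simp [LinearMap.inr_apply, Prod.ext_iff, hσ']
  rw [this]
  exact Submodule.sub_mem_iff_left _ (σ a).2

theorem cardQuot_scalarIdeal_fibreLattice [Module.IsTorsionFree R B] (hϖ : Irreducible ϖ)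
    {b₀ : B} (hb₀ : ∀ b : B, ∀ r : R, r • b₀ = ϖ • b → ϖ ∣ r)
    (N : Submodule R B) (φ : A →ₗ[R] B ⧸ N) :
    (scalarIdeal (fibreLattice ϖ N φ)).cardQuot =
      (scalarIdeal N).cardQuot * residueCard R := by
  have h1 : scalarIdeal (fibreLattice ϖ N φ) =
      Submodule.map (LinearMap.mulLeft R ϖ) (scalarIdeal N) := by
    ext r
    rw [mem_scalarIdeal_fibreLattice hϖ hb₀, Submodule.mem_map]
    simp only [LinearMap.mulLeft_apply, eq_comm]
  have h2 : LinearMap.range (LinearMap.mulLeft R ϖ) = Ideal.span {ϖ ^ 1} := by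
    ext r
    rw [pow_one, Ideal.mem_span_singleton, LinearMap.mem_range]
    simp only [LinearMap.mulLeft_apply, Dvd.dvd, eq_comm]
  rw [h1, cardQuot_map_of_injective _ (by
    intro a b hab
    exact mul_left_cancel₀ hϖ.ne_zero hab), h2, cardQuot_span_pow hϖ, pow_one]

theorem cardQuot_range_scaleSnd {ι κ : Type*} [Finite κ] (hϖ : Irreducible ϖ) :
    (LinearMap.range (scaleSnd (ι → R) (κ → R) ϖ)).cardQuot = residueCard R ^ Nat.card κ := by
  have := Fintype.ofFinite κ
  have h : (LinearMap.range (scaleSnd (ι → R) (κ → R) ϖ)).toAddSubgroup =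
      (⊤ : AddSubgroup (ι → R)).prod
        (AddSubgroup.pi Set.univ fun _ : κ => (Ideal.span {ϖ ^ 1}).toAddSubgroup) := by
    ext ⟨a, b⟩
    simp only [Submodule.mem_toAddSubgroup, LinearMap.mem_range, scaleSnd_apply,
      AddSubgroup.mem_prod, AddSubgroup.mem_top, true_and, AddSubgroup.mem_pi, Set.mem_univ,
      true_implies, pow_one, Ideal.mem_span_singleton, Prod.mk.injEq, Prod.exists]
    constructor
    · rintro ⟨x, y, rfl, rfl⟩ i
      exact ⟨y i, rfl⟩
    · intro hb
      choose y hy using hb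
      exact ⟨a, y, rfl, funext fun i => (hy i).symm⟩
  rw [Submodule.cardQuot, h, AddSubgroup.index_prod, AddSubgroup.index_top, one_mul,
    AddSubgroup.index_pi]
  change ∏ _ : κ, (Ideal.span {ϖ ^ 1}).cardQuot = _
  rw [cardQuot_span_pow hϖ, Finset.prod_const, Finset.card_univ, pow_one,
    Nat.card_eq_fintype_card]

theorem cardQuot_fibreLattice {ι κ : Type*} [Finite κ] (hϖ : Irreducible ϖ)
    (N : Submodule R (κ → R)) (φ : (ι → R) →ₗ[R] (κ → R) ⧸ N) :
    (fibreLattice ϖ N φ).cardQuot = N.cardQuot * residueCard R ^ Nat.card κ := by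
  rw [fibreLattice, cardQuot_map_of_injective _ (scaleSnd_injective hϖ.ne_zero),
    cardQuot_graphMod, cardQuot_range_scaleSnd hϖ]

end Fibre

/-! ### The weighted zeta function of lattices -/

section LatticeSum

variable {R : Type*} [CommRing R]

/-- The weight of a lattice `N` in `M`: the cardinality of `R ⧸ ann (M ⧸ N)` to the power `-d`. -/
noncomputable def latticeWeight (d : ℕ) {M : Type*} [AddCommGroup M] [Module R M]
    (N : Submodule R M) : ℂ := (((scalarIdeal N).cardQuot : ℂ) ^ d)⁻¹

/-- The sum of the weights of the submodules of index `c`. -/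
noncomputable def latticeSum (R : Type*) [CommRing R] (d : ℕ) (M : Type*) [AddCommGroup M]
    [Module R M] (c : ℕ) : ℂ :=
  ∑ᶠ N : {N : Submodule R M // N.cardQuot = c}, latticeWeight d N.1

/-- The sum of the weights of the submodules of index `c` with reduction `W`. -/
noncomputable def fibreSum [IsLocalRing R] (d : ℕ) {M : Type*} [AddCommGroup M]
    [Module R M] (c : ℕ) (W : Submodule R M) : ℂ :=
  ∑ᶠ N : {N : Submodule R M // N.cardQuot = c ∧ N ⊔ maximalIdeal R • ⊤ = W}, latticeWeight d N.1

variable {M M' : Type*} [AddCommGroup M] [Module R M] [AddCommGroup M'] [Module R M']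

theorem latticeWeight_map_equiv (d : ℕ) (N : Submodule R M) (g : M ≃ₗ[R] M') :
    latticeWeight d (N.map (g : M →ₗ[R] M')) = latticeWeight d N := by
  rw [latticeWeight, scalarIdeal_map_equiv, latticeWeight]

theorem latticeSum_congr (d : ℕ) (g : M ≃ₗ[R] M') (c : ℕ) :
    latticeSum R d M c = latticeSum R d M' c := by
  refine finsum_eq_of_bijective (fun N : {N : Submodule R M // N.cardQuot = c} =>
    (⟨N.1.map (g : M →ₗ[R] M'), by rw [cardQuot_map_equiv, N.2]⟩ :
      {N : Submodule R M' // N.cardQuot = c})) ⟨?_, ?_⟩ fun N => ?_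
  · intro N N' h
    exact Subtype.ext (Submodule.map_injective_of_injective g.injective (congrArg Subtype.val h))
  · rintro ⟨N, hN⟩
    refine ⟨⟨N.map (g.symm : M' →ₗ[R] M), by rw [cardQuot_map_equiv, hN]⟩, Subtype.ext ?_⟩
    simp [← Submodule.map_comp]
  · exact (latticeWeight_map_equiv d N.1 g).symm

theorem map_equiv_sup_maximalIdeal_smul_top [IsLocalRing R] (N : Submodule R M) (g : M ≃ₗ[R] M') :
    N.map (g : M →ₗ[R] M') ⊔ maximalIdeal R • ⊤ =
      (N ⊔ maximalIdeal R • ⊤).map (g : M →ₗ[R] M') := by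
  rw [Submodule.map_sup, Submodule.map_smul'', Submodule.map_top, LinearEquiv.range]

theorem fibreSum_map_equiv [IsLocalRing R] (d : ℕ) (g : M ≃ₗ[R] M') (c : ℕ) (W : Submodule R M) :
    fibreSum d c (W.map (g : M →ₗ[R] M')) = fibreSum d c W := by
  symm
  refine finsum_eq_of_bijective
    (fun N : {N : Submodule R M // N.cardQuot = c ∧ N ⊔ maximalIdeal R • ⊤ = W} =>
    (⟨N.1.map (g : M →ₗ[R] M'), by rw [cardQuot_map_equiv, N.2.1],
      by rw [map_equiv_sup_maximalIdeal_smul_top, N.2.2]⟩ :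
      {N : Submodule R M' // N.cardQuot = c ∧ N ⊔ maximalIdeal R • ⊤ =
        W.map (g : M →ₗ[R] M')})) ⟨?_, ?_⟩ fun N => ?_
  · intro N N' h
    exact Subtype.ext (Submodule.map_injective_of_injective g.injective (congrArg Subtype.val h))
  · rintro ⟨N, hN, hW⟩
    refine ⟨⟨N.map (g.symm : M' →ₗ[R] M), by rw [cardQuot_map_equiv, hN], ?_⟩, Subtype.ext ?_⟩
    · rw [map_equiv_sup_maximalIdeal_smul_top, hW]
      simp [← Submodule.map_comp]
    · simp [← Submodule.map_comp]
  · exact (latticeWeight_map_equiv d N.1 g).symm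

theorem latticeSum_one (d : ℕ) : latticeSum R d M 1 = 1 := by
  have h : ∀ N : {N : Submodule R M // N.cardQuot = 1}, N = ⟨⊤, Submodule.cardQuot_top R M⟩ := by
    rintro ⟨N, hN⟩
    exact Subtype.ext (Submodule.cardQuot_eq_one_iff.mp hN)
  have : Unique {N : Submodule R M // N.cardQuot = 1} := ⟨⟨_⟩, h⟩
  rw [latticeSum, finsum_unique, h default, latticeWeight]
  have : scalarIdeal (⊤ : Submodule R M) = ⊤ := by
    rw [Ideal.eq_top_iff_one, mem_scalarIdeal]
    exact fun _ => trivial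
  rw [this, Submodule.cardQuot_top]
  simp

theorem card_linearMap_pi {ι : Type*} [Finite ι] :
    Nat.card ((ι → R) →ₗ[R] M) = Nat.card M ^ Nat.card ι := by
  rw [← Nat.card_congr ((Pi.basisFun R ι).constr R).toEquiv, Nat.card_fun]

variable [IsDomain R] [IsDiscreteValuationRing R]

/-- A submodule of `R ^ n` that contains `m R ^ n` is standard in a suitable basis. -/
theorem exists_equiv_map_eq_range_scaleSnd {n : ℕ} {ϖ : R} (hϖ : Irreducible ϖ)
    {W : Submodule R (Fin n → R)} (hW : maximalIdeal R • ⊤ ≤ W) :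
    ∃ (p : Fin n → Prop) (g : (Fin n → R) ≃ₗ[R] ({j // p j} → R) × ({j // ¬p j} → R)),
      W.map g.toLinearMap = LinearMap.range (scaleSnd _ _ ϖ) := by
  classical
  obtain ⟨k, snf⟩ := W.smithNormalForm (Pi.basisFun R (Fin n))
  -- the elementary divisors of `W`, put to `0` outside the range of the Smith normal form
  set c : Fin n → R := fun j => if h : ∃ i, snf.f i = j then snf.a h.choose else 0 with hc
  have hcf (i : Fin k) : c (snf.f i) = snf.a i := by
    have h : ∃ i', snf.f i' = snf.f i := ⟨i, rfl⟩
    rw [hc]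
    simp only [dif_pos h]
    rw [snf.f.injective h.choose_spec]
  have hcn (j : Fin n) (hj : j ∉ Set.range snf.f) : c j = 0 := dif_neg hj
  have hmem (x : Fin n → R) : x ∈ W ↔ ∀ j, c j ∣ snf.bM.repr x j := by
    constructor
    · intro hx j
      by_cases hj : j ∈ Set.range snf.f
      · obtain ⟨i, rfl⟩ := hj
        rw [hcf, snf.repr_apply_embedding_eq_repr_smul ⟨x, hx⟩, map_smul]
        exact ⟨_, rfl⟩
      · rw [snf.repr_eq_zero_of_notMem_range ⟨x, hx⟩ hj]
        exact dvd_zero _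
    · intro h
      rw [← snf.bM.sum_repr x]
      refine W.sum_mem fun j _ => ?_
      by_cases hj : j ∈ Set.range snf.f
      · obtain ⟨i, rfl⟩ := hj
        obtain ⟨t, ht⟩ := h (snf.f i)
        rw [ht, hcf, mul_comm, mul_smul, ← snf.snf]
        exact W.smul_mem _ (snf.bN i).2
      · have := h j
        rw [hcn j hj, zero_dvd_iff] at this
        rw [this, zero_smul]
        exact W.zero_mem
  have hcϖ (j : Fin n) : c j ∣ ϖ := by
    have h1 : ϖ • snf.bM j ∈ W := by
      refine hW (Submodule.smul_mem_smul ?_ trivial)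
      rw [hϖ.maximalIdeal_eq]
      exact Ideal.mem_span_singleton_self ϖ
    simpa using (hmem _).mp h1 j
  set p : Fin n → Prop := fun j => IsUnit (c j) with hp
  set g : (Fin n → R) ≃ₗ[R] ({j // p j} → R) × ({j // ¬p j} → R) :=
    snf.bM.equivFun ≪≫ₗ LinearEquiv.funCongrLeft R R (Equiv.sumCompl p) ≪≫ₗ
      LinearEquiv.sumArrowLequivProdArrow _ _ R R with hg
  have hg1 (x : Fin n → R) (j : {j // p j}) : (g x).1 j = snf.bM.repr x j := rfl
  have hg2 (x : Fin n → R) (j : {j // ¬p j}) : (g x).2 j = snf.bM.repr x j := rfl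
  refine ⟨p, g, ?_⟩
  ext y
  have hy : y ∈ W.map g.toLinearMap ↔ g.symm y ∈ W := by
    constructor
    · rintro ⟨x, hx, rfl⟩
      simpa using hx
    · intro h
      exact ⟨_, h, by simp⟩
  rw [hy, hmem]
  obtain ⟨x, rfl⟩ := g.surjective y
  rw [g.symm_apply_apply]
  constructor
  · intro h
    have h2 (j : {j // ¬p j}) : ϖ ∣ (g x).2 j := by
      rw [hg2]
      exact ((hϖ.dvd_iff.mp (hcϖ j)).resolve_left j.2).dvd.trans (h j)
    choose b hb using h2
    exact ⟨((g x).1, b), Prod.ext rfl (funext fun j => (hb j).symm)⟩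
  · rintro ⟨z, hz⟩ j
    by_cases hj : p j
    · exact hj.dvd
    · have := congrFun (congrArg Prod.snd hz) ⟨j, hj⟩
      rw [hg2] at this
      rw [← this]
      exact (hcϖ j).trans ⟨z.2 ⟨j, hj⟩, rfl⟩

variable [Finite (ResidueField R)]

/-- The contribution of the lattices whose reduction is the standard subspace: such a lattice is a
submodule `N` of `R ^ κ` together with a homomorphism from `R ^ ι` to `R ^ κ ⧸ N`. -/
theorem fibreSum_range_scaleSnd {ι κ : Type} [Finite ι] [Finite κ] [Nonempty κ] {ϖ : R}
    (hϖ : Irreducible ϖ) (d e : ℕ) :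
    fibreSum d (residueCard R ^ e) (LinearMap.range (scaleSnd (ι → R) (κ → R) ϖ)) =
      if Nat.card κ ≤ e then ((residueCard R : ℂ) ^ d)⁻¹ *
        ((residueCard R : ℂ) ^ ((e - Nat.card κ) * Nat.card ι) *
          latticeSum R d (κ → R) (residueCard R ^ (e - Nat.card κ))) else 0 := by
  have hq := two_le_residueCard R
  have hq0 : residueCard R ≠ 0 := by lia
  obtain ⟨i₀⟩ := ‹Nonempty κ›
  classical
  have hb₀ : ∀ b : κ → R, ∀ r : R, r • (Pi.single i₀ 1 : κ → R) = ϖ • b → ϖ ∣ r := by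
    intro b r h
    have := congrFun h i₀
    simp only [Pi.smul_apply, Pi.single_eq_same, smul_eq_mul, mul_one] at this
    exact ⟨_, this⟩
  split_ifs with hκ
  · set r := Nat.card κ with hr
    have hfinN := finite_setOf_cardQuot_eq (R := R) (M := κ → R)
      (pow_ne_zero (e - r) hq0)
    have hfinQ : ∀ N : {N : Submodule R (κ → R) // N.cardQuot = residueCard R ^ (e - r)},
        Finite ((κ → R) ⧸ N.1) := fun N => Nat.finite_of_card_ne_zero (by
      rw [← Submodule.cardQuot_apply, N.2]
      exact pow_ne_zero _ hq0)
    have hcard : ∀ N : {N : Submodule R (κ → R) // N.cardQuot = residueCard R ^ (e - r)},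
        Nat.card ((ι → R) →ₗ[R] (κ → R) ⧸ N.1) = residueCard R ^ ((e - r) * Nat.card ι) :=
      fun N => by rw [card_linearMap_pi, ← Submodule.cardQuot_apply, N.2, pow_mul]
    have hfinH : ∀ N : {N : Submodule R (κ → R) // N.cardQuot = residueCard R ^ (e - r)},
        Finite ((ι → R) →ₗ[R] (κ → R) ⧸ N.1) := fun N => Nat.finite_of_card_ne_zero (by
      rw [hcard]
      exact pow_ne_zero _ hq0)
    have key : fibreSum d (residueCard R ^ e)
        (LinearMap.range (scaleSnd (ι → R) (κ → R) ϖ)) =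
        ∑ᶠ x : Σ N : {N : Submodule R (κ → R) // N.cardQuot = residueCard R ^ (e - r)},
          (ι → R) →ₗ[R] (κ → R) ⧸ N.1,
          ((residueCard R : ℂ) ^ d)⁻¹ * latticeWeight d x.1.1 := by
      symm
      refine finsum_eq_of_bijective
        (fun x : Σ N : {N : Submodule R (κ → R) // N.cardQuot = residueCard R ^ (e - r)},
          (ι → R) →ₗ[R] (κ → R) ⧸ N.1 =>
        (⟨fibreLattice ϖ x.1.1 x.2, by
          rw [cardQuot_fibreLattice hϖ, x.1.2, ← pow_add, ← hr, Nat.sub_add_cancel hκ],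
          fibreLattice_sup hϖ _ _⟩ :
        {N : Submodule R ((ι → R) × (κ → R)) // N.cardQuot = residueCard R ^ e ∧
          N ⊔ maximalIdeal R • ⊤ = LinearMap.range (scaleSnd (ι → R) (κ → R) ϖ)}))
        ⟨?_, ?_⟩ fun x => ?_
      · rintro ⟨⟨N, hN⟩, φ⟩ ⟨⟨N', hN'⟩, φ'⟩ h
        have := @fibreLattice_injective R (ι → R) (κ → R) _ _ _ _ _ _ ϖ _ hϖ.ne_zero
          ⟨N, φ⟩ ⟨N', φ'⟩ (congrArg Subtype.val h)
        cases this
        rfl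
      · rintro ⟨L, hL, hLW⟩
        obtain ⟨N, φ, rfl⟩ := exists_fibreLattice_eq hLW
        refine ⟨⟨⟨N, ?_⟩, φ⟩, rfl⟩
        rw [cardQuot_fibreLattice hϖ, ← hr] at hL
        refine Nat.eq_of_mul_eq_mul_right (pow_pos (Nat.pos_of_ne_zero hq0) r) ?_
        rw [hL, ← pow_add, Nat.sub_add_cancel hκ]
      · simp only [latticeWeight]
        rw [cardQuot_scalarIdeal_fibreLattice hϖ hb₀]
        push_cast
        rw [mul_pow, mul_inv, mul_comm]
    rw [key, latticeSum]
    have := Fintype.ofFinite {N : Submodule R (κ → R) // N.cardQuot = residueCard R ^ (e - r)}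
    have := fun N : {N : Submodule R (κ → R) // N.cardQuot = residueCard R ^ (e - r)} =>
      Fintype.ofFinite ((ι → R) →ₗ[R] (κ → R) ⧸ N.1)
    rw [finsum_eq_sum_of_fintype, finsum_eq_sum_of_fintype, Fintype.sum_sigma, Finset.mul_sum,
      Finset.mul_sum]
    refine Finset.sum_congr rfl fun N _ => ?_
    dsimp only
    rw [Finset.sum_const, Finset.card_univ, ← Nat.card_eq_fintype_card, hcard, nsmul_eq_mul]
    push_cast
    ring
  · rw [fibreSum]
    have : IsEmpty {N : Submodule R ((ι → R) × (κ → R)) // N.cardQuot = residueCard R ^ e ∧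
          N ⊔ maximalIdeal R • ⊤ = LinearMap.range (scaleSnd (ι → R) (κ → R) ϖ)} := by
      refine ⟨?_⟩
      rintro ⟨L, hL, hLW⟩
      have h1 : (LinearMap.range (scaleSnd (ι → R) (κ → R) ϖ)).cardQuot ∣ L.cardQuot := by
        rw [← hLW]
        exact AddSubgroup.index_dvd_of_le (H := L.toAddSubgroup)
          (K := (L ⊔ maximalIdeal R • ⊤ : Submodule R _).toAddSubgroup)
          (show L ≤ L ⊔ maximalIdeal R • ⊤ from le_sup_left)
      rw [cardQuot_range_scaleSnd hϖ, hL] at h1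
      exact hκ ((Nat.pow_dvd_pow_iff_le_right hq).mp h1)
    exact finsum_of_isEmpty _

end LatticeSum

/-! ### Counting subspaces -/

/-- The number of subspaces of dimension `k` of a vector space of dimension `n` over a field with
`q` elements is a Gaussian binomial coefficient: count linearly independent families of `k`
vectors by their span. -/
theorem card_subspace_eq_gaussBinom (K V : Type*) [Field K] [Finite K] [AddCommGroup V]
    [Module K V] [FiniteDimensional K V] {k : ℕ} (hk : k ≤ Module.finrank K V) :
    (Nat.card {U : Submodule K V // Module.finrank K U = k} : ℂ) =
      gaussBinom (Nat.card K) (Module.finrank K V) k := by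
  have := Fintype.ofFinite K
  have : Finite V := Module.finite_of_finite K
  have hq : 2 ≤ Nat.card K := Finite.one_lt_card
  have hspan (U : Submodule K V) (hU : Module.finrank K U = k) (v : Fin k → U)
      (hv : LinearIndependent K v) :
      Submodule.span K (Set.range fun i => (v i : V)) = U := by
    apply Submodule.eq_of_le_of_finrank_eq
    · rw [Submodule.span_le]
      rintro _ ⟨i, rfl⟩
      exact (v i).2
    · have h := finrank_span_eq_card (hv.map' U.subtype (Submodule.ker_subtype _))
      rw [Fintype.card_fin] at h
      exact h.trans hU.symm
  have hcard := Nat.card_congr <| Equiv.ofBijective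
    (fun x : Σ U : {U : Submodule K V // Module.finrank K U = k},
        {v : Fin k → U.1 // LinearIndependent K v} =>
      (⟨fun i => x.2.1 i, x.2.2.map' (Submodule.subtype _) (Submodule.ker_subtype _)⟩ :
        {v : Fin k → V // LinearIndependent K v})) (by
    constructor
    · rintro ⟨⟨U, hU⟩, ⟨v, hv⟩⟩ ⟨⟨U', hU'⟩, ⟨v', hv'⟩⟩ h
      have h1 : (fun i => (v i : V)) = fun i => (v' i : V) := congrArg Subtype.val h
      obtain rfl : U = U' := by rw [← hspan U hU v hv, ← hspan U' hU' v' hv', h1]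
      obtain rfl : v = v' := funext fun i => Subtype.ext (congrFun h1 i)
      rfl
    · rintro ⟨v, hv⟩
      exact ⟨⟨⟨Submodule.span K (Set.range v), by
          rw [finrank_span_eq_card hv, Fintype.card_fin]⟩,
        ⟨fun i => ⟨v i, Submodule.subset_span ⟨i, rfl⟩⟩,
          LinearIndependent.of_comp (Submodule.subtype _) hv⟩⟩, rfl⟩)
  have : Fintype {U : Submodule K V // Module.finrank K U = k} := by
    have : Finite (Submodule K V) :=
      Finite.of_injective (fun U : Submodule K V => (U : Set V)) SetLike.coe_injective
    exact Fintype.ofFinite _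
  rw [card_linearIndependent hk, Nat.card_sigma] at hcard
  have hU : ∀ U : {U : Submodule K V // Module.finrank K U = k},
      Nat.card {v : Fin k → U.1 // LinearIndependent K v} =
        ∏ i : Fin k, (Fintype.card K ^ k - Fintype.card K ^ (i : ℕ)) := by
    rintro ⟨U, rfl⟩
    exact card_linearIndependent le_rfl
  rw [Finset.sum_congr rfl fun U _ => hU U, Finset.sum_const, Finset.card_univ, smul_eq_mul,
    Fin.prod_univ_eq_prod_range (fun i => Fintype.card K ^ k - Fintype.card K ^ i),
    Fin.prod_univ_eq_prod_range
      (fun i => Fintype.card K ^ Module.finrank K V - Fintype.card K ^ i)] at hcard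
  simp only [← Nat.card_eq_fintype_card] at hcard
  have hcast (m : ℕ) (hm : k ≤ m) :
      ((∏ i ∈ Finset.range k, (Nat.card K ^ m - Nat.card K ^ i) : ℕ) : ℂ) =
        ∏ i ∈ Finset.range k, ((Nat.card K : ℂ) ^ m - (Nat.card K : ℂ) ^ i) := by
    rw [Nat.cast_prod]
    refine Finset.prod_congr rfl fun i hi => ?_
    rw [Nat.cast_sub (Nat.pow_le_pow_right (by lia)
      ((Finset.mem_range.mp hi).le.trans hm))]
    push_cast
    rfl
  have hcard' := congrArg (Nat.cast : ℕ → ℂ) hcard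
  rw [Nat.cast_mul, hcast _ hk, hcast _ le_rfl] at hcard'
  rw [gaussBinom, Finset.prod_div_distrib, ← hcard', mul_div_cancel_right₀]
  exact Finset.prod_ne_zero_iff.mpr fun i hi =>
    natCast_pow_sub_pow_ne_zero hq (Finset.mem_range.mp hi)

section LatticeSum

variable {R : Type*} [CommRing R] [IsDomain R] [IsDiscreteValuationRing R]

/-- Coordinatewise reduction modulo the maximal ideal. -/
noncomputable def reduction (R : Type*) [CommRing R] [IsLocalRing R] (n : ℕ) :
    (Fin n → R) →ₗ[R] (Fin n → ResidueField R) :=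
  (Algebra.linearMap R (ResidueField R)).compLeft (Fin n)

theorem reduction_surjective (n : ℕ) : Function.Surjective (reduction R n) := by
  intro y
  choose x hx using fun i => IsLocalRing.residue_surjective (y i)
  exact ⟨x, funext hx⟩

theorem ker_reduction (n : ℕ) :
    LinearMap.ker (reduction R n) = maximalIdeal R • ⊤ := by
  obtain ⟨ϖ, hϖ⟩ := IsDiscreteValuationRing.exists_irreducible R
  ext x
  rw [hϖ.maximalIdeal_eq, Submodule.ideal_span_singleton_smul, LinearMap.mem_ker, funext_iff]
  have h (i : Fin n) : reduction R n x i = 0 ↔ ϖ ∣ x i := by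
    rw [← Ideal.mem_span_singleton, ← hϖ.maximalIdeal_eq]
    exact IsLocalRing.residue_eq_zero_iff (x i)
  simp only [Pi.zero_apply, h]
  constructor
  · intro hx
    choose y hy using hx
    exact ⟨y, trivial, funext fun i => (hy i).symm⟩
  · rintro ⟨y, -, rfl⟩ i
    exact ⟨y i, rfl⟩

variable [Finite (ResidueField R)]

/-- The possible reductions of lattices of `R ^ n` are the subspaces of the reduction of `R ^ n`. -/
theorem card_submodule_cardQuot_eq_gaussBinom {n r : ℕ} (hr : r ≤ n) :
    (Nat.card {W : {W : Submodule R (Fin n → R) // maximalIdeal R • ⊤ ≤ W} //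
      W.1.cardQuot = residueCard R ^ r} : ℂ) = gaussBinom (residueCard R) n (n - r) := by
  have hfr : Module.finrank (ResidueField R) (Fin n → ResidueField R) = n := by simp
  have h := card_subspace_eq_gaussBinom (ResidueField R) (Fin n → ResidueField R)
    (k := n - r) (by rw [hfr]; lia)
  rw [hfr] at h
  rw [← residueCard] at h
  rw [← h]
  congr 1
  symm
  have hidx (U : Submodule (ResidueField R) (Fin n → ResidueField R)) :
      ((U.restrictScalars R).comap (reduction R n)).cardQuot =
        residueCard R ^ (n - Module.finrank (ResidueField R) U) := by
    rw [cardQuot_comap_of_surjective _ (reduction_surjective n), residueCard]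
    have h1 : (U.restrictScalars R).cardQuot = Nat.card ((Fin n → ResidueField R) ⧸ U) := rfl
    rw [h1, Module.natCard_eq_pow_finrank (K := ResidueField R), Submodule.finrank_quotient, hfr]
  have hker (U : Submodule (ResidueField R) (Fin n → ResidueField R)) :
      maximalIdeal R • ⊤ ≤ (U.restrictScalars R).comap (reduction R n) := by
    rw [← ker_reduction]
    exact LinearMap.ker_le_comap _
  have hle (U : Submodule (ResidueField R) (Fin n → ResidueField R)) :
      Module.finrank (ResidueField R) U ≤ n := by
    have := Submodule.finrank_le U
    rwa [hfr] at this
  have hpow : Function.Injective (residueCard R ^ ·) :=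
    Nat.pow_right_injective (two_le_residueCard R)
  refine Nat.card_congr (Equiv.ofBijective (fun U => ⟨⟨_, hker U.1⟩, ?_⟩) ⟨?_, ?_⟩)
  · rw [hidx, U.2]
    congr 1
    lia
  · intro U U' hUU
    have h1 := congrArg (fun W => W.1.1) hUU
    have h2 := Submodule.comap_injective_of_surjective (reduction_surjective n) h1
    exact Subtype.ext (Submodule.restrictScalars_injective R _ _ h2)
  · rintro ⟨⟨W, hW⟩, hWr⟩
    set U : Submodule (ResidueField R) (Fin n → ResidueField R) :=
      { (W.map (reduction R n)).toAddSubmonoid with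
        smul_mem' := by
          intro c x hx
          obtain ⟨c, rfl⟩ := IsLocalRing.residue_surjective c
          exact (W.map (reduction R n)).smul_mem c hx } with hU
    have hUW : (U.restrictScalars R).comap (reduction R n) = W := by
      have h1 : U.restrictScalars R = W.map (reduction R n) := rfl
      rw [h1, Submodule.comap_map_eq, ker_reduction, sup_eq_left]
      exact hW
    have hUr : Module.finrank (ResidueField R) U = n - r := by
      have h1 := hidx U
      rw [hUW, hWr] at h1
      have h2 := hpow h1
      have := hle U
      clear_value U
      lia
    exact ⟨⟨U, hUr⟩, Subtype.ext (Subtype.ext hUW)⟩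

/-! ### The recursion for the zeta function of lattices -/

/-- The sum over `r` on the right has at most one nonzero term; it selects the codimension `r + 1`
of `W` in the reduction of `R ^ n`. -/
theorem fibreSum_eq {n : ℕ} (d e : ℕ) {W : Submodule R (Fin n → R)}
    (hW : maximalIdeal R • ⊤ ≤ W) :
    fibreSum d (residueCard R ^ (e + 1)) W = ∑ r ∈ Finset.range n,
      if W.cardQuot = residueCard R ^ (r + 1) then
        (if r ≤ e then ((residueCard R : ℂ) ^ d)⁻¹ *
          ((residueCard R : ℂ) ^ ((e - r) * (n - (r + 1))) *
            latticeSum R d (Fin (r + 1) → R) (residueCard R ^ (e - r))) else 0)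
      else 0 := by
  obtain ⟨ϖ, hϖ⟩ := IsDiscreteValuationRing.exists_irreducible R
  have hpow : Function.Injective (residueCard R ^ ·) :=
    Nat.pow_right_injective (two_le_residueCard R)
  obtain ⟨p, g, hg⟩ := exists_equiv_map_eq_range_scaleSnd hϖ hW
  have hc : W.cardQuot = residueCard R ^ Nat.card {j // ¬p j} := by
    rw [← cardQuot_map_equiv W g, hg, cardQuot_range_scaleSnd hϖ]
  have hcard : Nat.card {j // p j} + Nat.card {j // ¬p j} = n := by
    classical
    rw [Nat.card_eq_fintype_card, Nat.card_eq_fintype_card,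
      ← Fintype.card_sum, Fintype.card_congr (Equiv.sumCompl p), Fintype.card_fin]
  rcases isEmpty_or_nonempty {j // ¬p j} with hempty | hne
  · have h0 : Nat.card {j // ¬p j} = 0 := Nat.card_of_isEmpty
    rw [h0, pow_zero] at hc
    rw [Finset.sum_eq_zero, fibreSum]
    · have : IsEmpty {N : Submodule R (Fin n → R) // N.cardQuot = residueCard R ^ (e + 1) ∧
          N ⊔ maximalIdeal R • ⊤ = W} := by
        refine ⟨?_⟩
        rintro ⟨N, hN, hNW⟩
        rw [Submodule.cardQuot_eq_one_iff.mp hc] at hNW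
        have : ⊤ ≤ N := Submodule.le_of_le_smul_of_le_jacobson_bot (I := maximalIdeal R)
          Module.Finite.fg_top (IsLocalRing.maximalIdeal_le_jacobson _) hNW.ge
        rw [top_le_iff.mp this, Submodule.cardQuot_top] at hN
        have := hpow (a₁ := 0) (a₂ := e + 1) (by simpa using hN)
        lia
      exact finsum_of_isEmpty _
    · intro r _
      rw [if_neg]
      rw [hc]
      intro h
      have := hpow (a₁ := 0) (a₂ := r + 1) (by simpa using h)
      lia
  · obtain ⟨r, hr⟩ : ∃ r, Nat.card {j // ¬p j} = r + 1 :=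
      Nat.exists_eq_succ_of_ne_zero Nat.card_pos.ne'
    rw [← fibreSum_map_equiv d g, hg, fibreSum_range_scaleSnd hϖ, hr,
      Finset.sum_eq_single_of_mem r (Finset.mem_range.mpr (by lia))]
    · rw [if_pos (show W.cardQuot = residueCard R ^ (r + 1) by rw [hc, hr])]
      simp only [Nat.add_le_add_iff_right, Nat.add_sub_add_right]
      have h1 : Nat.card {j // p j} = n - (r + 1) := by lia
      have h2 : {j // ¬p j} ≃ Fin (r + 1) := Finite.equivFinOfCardEq hr
      rw [h1, latticeSum_congr d (LinearEquiv.funCongrLeft R R h2).symm]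
    · intro r' _ hr'
      rw [if_neg]
      rw [hc, hr]
      intro h
      have := hpow h
      lia

/-- The number of lattices, weighted, satisfies the recursion that defines `latticeCoeff`. -/
theorem latticeSum_eq_latticeCoeff (R : Type*) [CommRing R] [IsDomain R]
    [IsDiscreteValuationRing R] [Finite (ResidueField R)] (d n e : ℕ) :
    latticeSum R d (Fin n → R) (residueCard R ^ e) =
      latticeCoeff (residueCard R) ((residueCard R : ℂ) ^ d)⁻¹ n e := by
  induction e using Nat.strong_induction_on generalizing n with
  | _ e ih =>
  cases e with
  | zero => rw [pow_zero, latticeSum_one, latticeCoeff]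
  | succ e =>
    have hq0 : residueCard R ≠ 0 := by have := two_le_residueCard R; lia
    have hf1 := finite_setOf_cardQuot_eq (R := R) (M := Fin n → R)
      (pow_ne_zero (e + 1) hq0)
    have hf2 : Finite {W : Submodule R (Fin n → R) // maximalIdeal R • ⊤ ≤ W} := by
      have hfq : Finite ((Fin n → R) ⧸ (maximalIdeal R • ⊤ : Submodule R (Fin n → R))) := by
        have : Finite (R ⧸ maximalIdeal R) := ‹Finite (ResidueField R)›
        exact Submodule.finite_quotient_smul _ Module.Finite.fg_top
      have : Finite (Submodule R
          ((Fin n → R) ⧸ (maximalIdeal R • ⊤ : Submodule R (Fin n → R)))) :=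
        Finite.of_injective (fun U => (U : Set ((Fin n → R) ⧸ (maximalIdeal R • ⊤ :
          Submodule R (Fin n → R))))) SetLike.coe_injective
      exact Finite.of_equiv _ (Submodule.comapMkQRelIso _).toEquiv
    have := Fintype.ofFinite
      {N : Submodule R (Fin n → R) // N.cardQuot = residueCard R ^ (e + 1)}
    have := Fintype.ofFinite {W : Submodule R (Fin n → R) // maximalIdeal R • ⊤ ≤ W}
    classical
    have hfib (W : {W : Submodule R (Fin n → R) // maximalIdeal R • ⊤ ≤ W}) :
        ∑ N : {N : {N : Submodule R (Fin n → R) // N.cardQuot = residueCard R ^ (e + 1)} //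
          (⟨N.1 ⊔ maximalIdeal R • ⊤, le_sup_right⟩ :
            {W : Submodule R (Fin n → R) // maximalIdeal R • ⊤ ≤ W}) = W},
          latticeWeight d N.1.1 = fibreSum d (residueCard R ^ (e + 1)) W.1 := by
      rw [fibreSum, ← finsum_eq_sum_of_fintype]
      refine finsum_eq_of_bijective (fun N => ⟨N.1.1, N.1.2, congrArg Subtype.val N.2⟩)
        ⟨fun N N' h => ?_, ?_⟩ fun _ => rfl
      · exact Subtype.ext (Subtype.ext (Subtype.ext_iff.mp h :))
      · rintro ⟨N, h1, h2⟩
        exact ⟨⟨⟨N, h1⟩, Subtype.ext h2⟩, rfl⟩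
    rw [latticeSum, finsum_eq_sum_of_fintype,
      ← Fintype.sum_fiberwise (fun N : {N : Submodule R (Fin n → R) //
        N.cardQuot = residueCard R ^ (e + 1)} => (⟨N.1 ⊔ maximalIdeal R • ⊤, le_sup_right⟩ :
          {W : Submodule R (Fin n → R) // maximalIdeal R • ⊤ ≤ W})),
      Finset.sum_congr rfl fun W _ => (hfib W).trans (fibreSum_eq d e W.2), Finset.sum_comm,
      latticeCoeff, Finset.mul_sum]
    refine Finset.sum_congr rfl fun r hr => ?_
    rw [← Finset.sum_filter, Finset.sum_const, ← Fintype.card_subtype,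
      ← Nat.card_eq_fintype_card, nsmul_eq_mul,
      card_submodule_cardQuot_eq_gaussBinom (by have := Finset.mem_range.mp hr; lia)]
    split_ifs with hre
    · rw [ih (e - r) (by lia)]
      ring
    · simp

end LatticeSum

/-! ### Characters of the centre and their radicals -/

namespace KGroup

variable {n : ℕ} {R : Type*} [CommRing R]

theorem pairing_smul_left (r : R) (a b : Fin n → R) : pairing (r • a) b = r • pairing a b := by
  simp only [pairing, Matrix.smul_vecMulVec, Submodule.Quotient.mk_smul]

theorem pairing_smul_right (r : R) (a b : Fin n → R) : pairing a (r • b) = r • pairing a b := by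
  simp only [pairing, Matrix.vecMulVec_smul, Submodule.Quotient.mk_smul]

/-- The left radical of the bilinear map `(a, b) ↦ ψ (∑ a_i b_j y_{ij})`. -/
def radical (ψ : AddChar (KCentre n R) ℂ) : Submodule R (Fin n → R) where
  carrier := {a | ∀ b, ψ (pairing a b) = 1}
  zero_mem' b := by rw [pairing_zero_left, AddChar.map_zero_eq_one]
  add_mem' {a a'} ha ha' b := by
    rw [pairing_add_left, AddChar.map_add_eq_mul, ha b, ha' b, mul_one]
  smul_mem' r a ha b := by
    rw [pairing_smul_left, ← pairing_smul_right]
    exact ha _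

/-- The matrices all of whose columns lie in `L`. -/
def columnSubmodule (L : Submodule R (Fin n → R)) : Submodule R (Matrix (Fin n) (Fin n) R) where
  carrier := {c | ∀ j, c.col j ∈ L}
  zero_mem' _ := L.zero_mem
  add_mem' h h' j := L.add_mem (h j) (h' j)
  smul_mem' r _ h j := L.smul_mem r (h j)

theorem mem_columnSubmodule {L : Submodule R (Fin n → R)} {c : Matrix (Fin n) (Fin n) R} :
    c ∈ columnSubmodule L ↔ ∀ j, c.col j ∈ L := Iff.rfl

/-- The submodule of the centre that is spanned by the values `pairing a b` with `a` in `L`. -/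
def centreSubmodule (L : Submodule R (Fin n → R)) : Submodule R (KCentre n R) :=
  (columnSubmodule L).map (Submodule.mkQ _)

theorem mk_eq_sum_pairing (c : Matrix (Fin n) (Fin n) R) :
    (Submodule.Quotient.mk c : KCentre n R) = ∑ j, pairing (c.col j) (Pi.single j 1) := by
  have h : c = ∑ j, Matrix.vecMulVec (c.col j) (Pi.single j 1) := by
    ext i k
    simp [Matrix.sum_apply, Matrix.vecMulVec_apply, Pi.single_apply]
  conv_lhs => rw [h]
  exact map_sum (Submodule.mkQ _) _ _

theorem pairing_mem_centreSubmodule {L : Submodule R (Fin n → R)} {a : Fin n → R} (ha : a ∈ L)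
    (b : Fin n → R) : pairing a b ∈ centreSubmodule L := by
  refine Submodule.mem_map_of_mem fun j => ?_
  have : (Matrix.vecMulVec a b).col j = b j • a := by
    ext i
    simp [Matrix.vecMulVec_apply, mul_comm]
  rw [this]
  exact L.smul_mem _ ha

theorem le_radical_iff {L : Submodule R (Fin n → R)} {ψ : AddChar (KCentre n R) ℂ} :
    L ≤ radical ψ ↔ ∀ c ∈ centreSubmodule L, ψ c = 1 := by
  constructor
  · rintro h _ ⟨c, hc, rfl⟩
    rw [Submodule.mkQ_apply, mk_eq_sum_pairing]
    exact (map_prod ψ.toMonoidHom (fun j => Multiplicative.ofAdd (pairing (c.col j) _)) _).trans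
      (Finset.prod_eq_one fun j _ => h (hc j) _)
  · exact fun h a ha b => h _ (pairing_mem_centreSubmodule ha b)

theorem centreSubmodule_top : centreSubmodule (⊤ : Submodule R (Fin n → R)) = ⊤ := by
  rw [eq_top_iff]
  rintro x -
  obtain ⟨c, rfl⟩ := Submodule.mkQ_surjective _ x
  exact Submodule.mem_map_of_mem fun _ => trivial

theorem cardQuot_columnSubmodule (L : Submodule R (Fin n → R)) :
    (columnSubmodule L).cardQuot = L.cardQuot ^ n := by
  set f : Matrix (Fin n) (Fin n) R →+ (Fin n → Fin n → R) :=
    ⟨⟨fun c => c.transpose, rfl⟩, fun _ _ => rfl⟩ with hf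
  have hfs : Function.Surjective f := fun c => ⟨Matrix.of c |>.transpose, rfl⟩
  have h : (columnSubmodule L).toAddSubgroup =
      (AddSubgroup.pi Set.univ fun _ : Fin n => L.toAddSubgroup).comap f := by
    ext c
    simp only [AddSubgroup.mem_comap, AddSubgroup.mem_pi, Set.mem_univ, true_implies]
    rfl
  rw [Submodule.cardQuot, h, AddSubgroup.index_comap_of_surjective _ hfs, AddSubgroup.index_pi,
    Finset.prod_const, Finset.card_univ, Fintype.card_fin]
  rfl

theorem smul_one_mem_columnSubmodule {L : Submodule R (Fin n → R)} {r : R} :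
    r • (1 : Matrix (Fin n) (Fin n) R) ∈ columnSubmodule L ↔ r ∈ scalarIdeal L := by
  have hcol (j : Fin n) :
      (r • (1 : Matrix (Fin n) (Fin n) R)).col j = r • (Pi.single j 1 : Fin n → R) := by
    ext i
    simp [Matrix.one_apply, Pi.single_apply]
  rw [mem_columnSubmodule, mem_scalarIdeal]
  constructor
  · intro h x
    rw [pi_eq_sum_univ' x, Finset.smul_sum]
    refine L.sum_mem fun j _ => ?_
    rw [smul_comm]
    refine L.smul_mem _ ?_
    convert h j using 1
    rw [hcol]
  · intro h j
    rw [hcol]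
    exact h _

/-- The scalar matrices meet the matrices with columns in `L` in the scalars that map `R ^ n` into
`L`, which accounts for the factor `|R ⧸ scalarIdeal L|`. -/
theorem cardQuot_centreSubmodule_mul (L : Submodule R (Fin n → R)) :
    (scalarIdeal L).cardQuot * (centreSubmodule L).cardQuot = L.cardQuot ^ n := by
  set S : Submodule R (Matrix (Fin n) (Fin n) R) := Submodule.span R {1} with hS
  set f : R →ₗ[R] Matrix (Fin n) (Fin n) R := LinearMap.toSpanSingleton R _ 1 with hf
  have h1 : (centreSubmodule L).cardQuot = (columnSubmodule L ⊔ S).cardQuot := by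
    rw [← cardQuot_comap_of_surjective _ (Submodule.mkQ_surjective S), centreSubmodule,
      Submodule.comap_map_mkQ, sup_comm]
  have h2 : (scalarIdeal L).cardQuot =
      (columnSubmodule L).toAddSubgroup.relIndex S.toAddSubgroup := by
    have hc : scalarIdeal L = (columnSubmodule L).comap f := by
      ext r
      rw [← smul_one_mem_columnSubmodule, Submodule.mem_comap]
      rfl
    have hr : S.toAddSubgroup = f.toAddMonoidHom.range := by
      rw [hS, ← LinearMap.range_toSpanSingleton]
      rfl
    rw [hc, hr, ← AddSubgroup.index_comap]
    rfl
  rw [h1, h2, ← cardQuot_columnSubmodule,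
    ← AddSubgroup.relIndex_sup_right S.toAddSubgroup (columnSubmodule L).toAddSubgroup,
    sup_comm, ← Submodule.sup_toAddSubgroup]
  exact AddSubgroup.relIndex_mul_index (Submodule.toAddSubgroup_mono le_sup_left)

theorem cardQuot_centreSubmodule_ne_zero {L : Submodule R (Fin n → R)} (hL : L.cardQuot ≠ 0) :
    (centreSubmodule L).cardQuot ≠ 0 := by
  intro h
  have := cardQuot_centreSubmodule_mul L
  rw [h, mul_zero] at this
  exact pow_ne_zero _ hL this.symm

end KGroup

section CharacterCount

variable {R A : Type*} [CommRing R] [AddCommGroup A] [Module R A]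

/-- The characters that are trivial on a submodule are those of the quotient. -/
noncomputable def addCharQuotientEquiv (N : Submodule R A) :
    AddChar (A ⧸ N) ℂ ≃ {ψ : AddChar A ℂ // ∀ c ∈ N, ψ c = 1} where
  toFun χ := ⟨χ.compAddMonoidHom N.mkQ.toAddMonoidHom, fun c hc => by
    have : N.mkQ c = 0 := by rwa [Submodule.mkQ_apply, Submodule.Quotient.mk_eq_zero]
    change χ (N.mkQ c) = 1
    rw [this, AddChar.map_zero_eq_one]⟩
  invFun ψ := AddChar.toAddMonoidHomEquiv.symm
    (QuotientAddGroup.lift N.toAddSubgroup (AddChar.toAddMonoidHomEquiv ψ.1) ψ.2)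
  left_inv χ := by
    ext x
    obtain ⟨x, rfl⟩ := N.mkQ_surjective x
    rfl
  right_inv ψ := by
    ext x
    rfl

theorem finite_addChar_trivial_on {N : Submodule R A} (hN : N.cardQuot ≠ 0) :
    Finite {ψ : AddChar A ℂ // ∀ c ∈ N, ψ c = 1} := by
  have : Finite (A ⧸ N) := Nat.finite_of_card_ne_zero hN
  exact Finite.of_equiv _ (addCharQuotientEquiv N)

theorem card_addChar_trivial_on {N : Submodule R A} (hN : N.cardQuot ≠ 0) :
    Nat.card {ψ : AddChar A ℂ // ∀ c ∈ N, ψ c = 1} = N.cardQuot := by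
  have : Finite (A ⧸ N) := Nat.finite_of_card_ne_zero hN
  have := Fintype.ofFinite (A ⧸ N)
  rw [← Nat.card_congr (addCharQuotientEquiv N), Submodule.cardQuot_apply, Nat.card_eq_fintype_card,
    Nat.card_eq_fintype_card, AddChar.card_eq]

end CharacterCount

theorem KGroup.finite_le_radical {n : ℕ} {R : Type*} [CommRing R]
    {L : Submodule R (Fin n → R)} (hL : L.cardQuot ≠ 0) :
    Finite {ψ : AddChar (KCentre n R) ℂ // L ≤ radical ψ} := by
  have := finite_addChar_trivial_on (cardQuot_centreSubmodule_ne_zero hL)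
  exact Finite.of_equiv _ (Equiv.subtypeEquivRight fun ψ => le_radical_iff.symm)

/-! ### Counting characters by the index of their radical -/

theorem mem_pow_maximalIdeal {R : Type*} [CommRing R] [IsDomain R] [IsDiscreteValuationRing R]
    {ϖ : R} (hϖ : Irreducible ϖ) {k : ℕ} {r : R} :
    r ∈ maximalIdeal R ^ k ↔ ϖ ^ k ∣ r := by
  rw [hϖ.maximalIdeal_eq, Ideal.span_singleton_pow, Ideal.mem_span_singleton]

section Convolution

variable {R : Type*} [CommRing R] [IsDomain R] [IsDiscreteValuationRing R]
  [Finite (ResidueField R)]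

theorem residueCard_pow_ne_zero (e : ℕ) : residueCard R ^ e ≠ 0 :=
  pow_ne_zero _ (by have := two_le_residueCard R; lia)

theorem cardQuot_scalarIdeal_ne_zero {M : Type*} [AddCommGroup M] [Module R M]
    {N : Submodule R M} (hN : N.cardQuot ≠ 0) : (scalarIdeal N).cardQuot ≠ 0 := by
  obtain ⟨ϖ, hϖ⟩ := IsDiscreteValuationRing.exists_irreducible R
  have := finite_quotient_of_pow_mem hϖ (N := scalarIdeal N) (k := N.cardQuot ^ N.cardQuot) (by
    rw [mem_scalarIdeal]
    exact fun r => Ideal.mul_mem_right _ _ (pow_mem_scalarIdeal hϖ hN))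
  rw [Submodule.cardQuot_apply]
  exact Nat.card_pos.ne'

/-- Over a discrete valuation ring, a submodule of finite index in `R ^ n` is isomorphic to
`R ^ n`. -/
theorem nonempty_equiv_of_cardQuot_ne_zero {n : ℕ} {N : Submodule R (Fin n → R)}
    (hN : N.cardQuot ≠ 0) : Nonempty (N ≃ₗ[R] (Fin n → R)) := by
  obtain ⟨ϖ, hϖ⟩ := IsDiscreteValuationRing.exists_irreducible R
  have hr := mem_scalarIdeal.mp (pow_mem_scalarIdeal hϖ hN)
  set r := ϖ ^ (N.cardQuot ^ N.cardQuot)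
  have hr0 : r ≠ 0 := pow_ne_zero _ hϖ.ne_zero
  have h1 : Module.finrank R (Fin n → R) ≤ Module.finrank R N :=
    LinearMap.finrank_le_finrank_of_injective
      (f := LinearMap.codRestrict N (r • LinearMap.id) hr) (by
        intro x y hxy
        exact smul_right_injective _ hr0 (congrArg Subtype.val hxy))
  have h2 : Module.finrank R N ≤ Module.finrank R (Fin n → R) :=
    LinearMap.finrank_le_finrank_of_injective N.injective_subtype
  exact ⟨LinearEquiv.ofFinrankEq _ _ (h2.antisymm h1)⟩

/-- The number of submodules of index `c` in a submodule of finite index. -/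
theorem card_submodule_le {n i j : ℕ} {N : Submodule R (Fin n → R)}
    (hN : N.cardQuot = residueCard R ^ i) :
    Nat.card {L : Submodule R (Fin n → R) // L ≤ N ∧ L.cardQuot = residueCard R ^ (i + j)} =
      Nat.card {L : Submodule R (Fin n → R) // L.cardQuot = residueCard R ^ j} := by
  obtain ⟨e⟩ := nonempty_equiv_of_cardQuot_ne_zero (hN ▸ residueCard_pow_ne_zero i)
  set f : (Fin n → R) →ₗ[R] (Fin n → R) := N.subtype ∘ₗ e.symm.toLinearMap with hf
  have hinj : Function.Injective f := N.injective_subtype.comp e.symm.injective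
  have hrange : LinearMap.range f = N := by
    rw [hf, LinearMap.range_comp_of_range_eq_top _ e.symm.range, Submodule.range_subtype]
  have hcard (L : Submodule R (Fin n → R)) :
      (L.map f).cardQuot = residueCard R ^ (i + j) ↔ L.cardQuot = residueCard R ^ j := by
    rw [cardQuot_map_of_injective L hinj, hrange, hN, add_comm, pow_add]
    exact Nat.mul_left_inj (residueCard_pow_ne_zero i)
  refine (Nat.card_congr (Equiv.ofBijective (fun L :
    {L : Submodule R (Fin n → R) // L.cardQuot = residueCard R ^ j} =>
    (⟨L.1.map f, hrange ▸ LinearMap.map_le_range, (hcard L.1).mpr L.2⟩ :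
      {L : Submodule R (Fin n → R) // L ≤ N ∧ L.cardQuot = residueCard R ^ (i + j)}))
    ⟨?_, ?_⟩)).symm
  · intro L L' h
    exact Subtype.ext (Submodule.map_injective_of_injective hinj (congrArg Subtype.val h))
  · rintro ⟨L, hL, hc⟩
    have h := Submodule.map_comap_eq_self (f := f) (hrange.symm ▸ hL)
    exact ⟨⟨L.comap f, (hcard _).mp (h.symm ▸ hc)⟩, Subtype.ext h⟩

namespace KGroup

variable {n : ℕ}

theorem card_le_radical {L : Submodule R (Fin n → R)} (hL : L.cardQuot ≠ 0) :
    (Nat.card {ψ : AddChar (KCentre n R) ℂ // L ≤ radical ψ} : ℂ) =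
      (L.cardQuot : ℂ) ^ n * latticeWeight 1 L := by
  rw [Nat.card_congr (Equiv.subtypeEquivRight fun ψ : AddChar (KCentre n R) ℂ =>
    le_radical_iff (L := L)), card_addChar_trivial_on (cardQuot_centreSubmodule_ne_zero hL),
    latticeWeight, pow_one, ← Nat.cast_pow, ← cardQuot_centreSubmodule_mul, Nat.cast_mul]
  have : ((scalarIdeal L).cardQuot : ℂ) ≠ 0 :=
    Nat.cast_ne_zero.mpr (cardQuot_scalarIdeal_ne_zero hL)
  field_simp

theorem finite_cardQuot_radical_eq {c : ℕ} (hc : c ≠ 0) :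
    Finite {ψ : AddChar (KCentre n R) ℂ // (radical ψ).cardQuot = c} := by
  have := finite_setOf_cardQuot_eq (R := R) (M := Fin n → R) hc
  have (L : {L : Submodule R (Fin n → R) // L.cardQuot = c}) :
      Finite {ψ : AddChar (KCentre n R) ℂ // L.1 ≤ radical ψ} :=
    finite_le_radical (by rw [L.2]; exact hc)
  refine Finite.of_injective (β := Σ L : {L : Submodule R (Fin n → R) // L.cardQuot = c},
    {ψ : AddChar (KCentre n R) ℂ // L.1 ≤ radical ψ})
    (fun ψ => ⟨⟨radical ψ.1, ψ.2⟩, ⟨ψ.1, le_rfl⟩⟩) fun ψ ψ' h => ?_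
  have h2 := congrArg (fun x : Σ L : {L : Submodule R (Fin n → R) // L.cardQuot = c},
    {ψ : AddChar (KCentre n R) ℂ // L.1 ≤ radical ψ} => x.2.1) h
  exact Subtype.ext h2

/-- A radical of finite index is open in the adic topology. -/
theorem exists_pow_maximalIdeal_trivial {ψ : AddChar (KCentre n R) ℂ}
    (hψ : (radical ψ).cardQuot ≠ 0) :
    ∃ k, ∀ a : Fin n → R, (∀ i, a i ∈ maximalIdeal R ^ k) → a ∈ radical ψ := by
  obtain ⟨ϖ, hϖ⟩ := IsDiscreteValuationRing.exists_irreducible R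
  refine ⟨(radical ψ).cardQuot ^ (radical ψ).cardQuot, fun a ha => ?_⟩
  choose b hb using fun i => (mem_pow_maximalIdeal hϖ).mp (ha i)
  rw [show a = ϖ ^ ((radical ψ).cardQuot ^ (radical ψ).cardQuot) • b from funext hb]
  exact mem_scalarIdeal.mp (pow_mem_scalarIdeal hϖ hψ) b

/-- A character of the centre whose radical contains a lattice of index `q ^ e` has a radical of
index `q ^ i` with `i ≤ e`, in which the lattice has index `q ^ (e - i)`. -/
theorem card_sigma_le_radical (e : ℕ) :
    Nat.card (Σ L : {L : Submodule R (Fin n → R) // L.cardQuot = residueCard R ^ e},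
      {ψ : AddChar (KCentre n R) ℂ // L.1 ≤ radical ψ}) =
    ∑ p ∈ Finset.HasAntidiagonal.antidiagonal e,
      Nat.card {ψ : AddChar (KCentre n R) ℂ // (radical ψ).cardQuot = residueCard R ^ p.1} *
        Nat.card {L : Submodule R (Fin n → R) // L.cardQuot = residueCard R ^ p.2} := by
  have hfin (i : ℕ) := finite_cardQuot_radical_eq (R := R) (n := n)
    (residueCard_pow_ne_zero (R := R) i)
  have hfin' (i : ℕ) := finite_setOf_cardQuot_eq (R := R) (M := Fin n → R)
    (residueCard_pow_ne_zero (R := R) i)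
  set B : Finset.HasAntidiagonal.antidiagonal e → Type _ := fun p =>
    Σ ψ : {ψ : AddChar (KCentre n R) ℂ // (radical ψ).cardQuot = residueCard R ^ p.1.1},
      {L : Submodule R (Fin n → R) // L ≤ radical ψ.1 ∧ L.cardQuot = residueCard R ^ e} with hB
  have hfib (p : Finset.HasAntidiagonal.antidiagonal e)
      (ψ : {ψ : AddChar (KCentre n R) ℂ // (radical ψ).cardQuot = residueCard R ^ p.1.1}) :
      Nat.card {L : Submodule R (Fin n → R) //
        L ≤ radical ψ.1 ∧ L.cardQuot = residueCard R ^ e} =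
      Nat.card {L : Submodule R (Fin n → R) // L.cardQuot = residueCard R ^ p.1.2} := by
    have := card_submodule_le (j := p.1.2) ψ.2
    rwa [Finset.HasAntidiagonal.mem_antidiagonal.mp p.2] at this
  have hfibfin (p : Finset.HasAntidiagonal.antidiagonal e)
      (ψ : {ψ : AddChar (KCentre n R) ℂ // (radical ψ).cardQuot = residueCard R ^ p.1.1}) :
      Finite {L : Submodule R (Fin n → R) //
        L ≤ radical ψ.1 ∧ L.cardQuot = residueCard R ^ e} :=
    Finite.of_injective (β := {L : Submodule R (Fin n → R) // L.cardQuot = residueCard R ^ e})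
      (fun L => ⟨L.1, L.2.2⟩) fun L L' h => Subtype.ext (congrArg (fun x => x.1) h)
  have hcardB (p : Finset.HasAntidiagonal.antidiagonal e) : Nat.card (B p) =
      Nat.card {ψ : AddChar (KCentre n R) ℂ // (radical ψ).cardQuot = residueCard R ^ p.1.1} *
        Nat.card {L : Submodule R (Fin n → R) // L.cardQuot = residueCard R ^ p.1.2} := by
    have := Fintype.ofFinite
      {ψ : AddChar (KCentre n R) ℂ // (radical ψ).cardQuot = residueCard R ^ p.1.1}
    rw [hB, Nat.card_sigma, Finset.sum_congr rfl fun ψ _ => hfib p ψ, Finset.sum_const,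
      Finset.card_univ, smul_eq_mul, ← Nat.card_eq_fintype_card]
  rw [← Finset.sum_coe_sort, ← Finset.sum_congr rfl fun p _ => hcardB p, ← Nat.card_sigma]
  refine (Nat.card_congr (Equiv.ofBijective (fun x : Σ p, B p =>
    (⟨⟨x.2.2.1, x.2.2.2.2⟩, ⟨x.2.1.1, x.2.2.2.1⟩⟩ :
      Σ L : {L : Submodule R (Fin n → R) // L.cardQuot = residueCard R ^ e},
        {ψ : AddChar (KCentre n R) ℂ // L.1 ≤ radical ψ})) ⟨?_, ?_⟩)).symm
  · rintro ⟨⟨⟨i, j⟩, hp⟩, ⟨ψ, hψ⟩, ⟨L, hL⟩⟩ ⟨⟨⟨i', j'⟩, hp'⟩, ⟨ψ', hψ'⟩, ⟨L', hL'⟩⟩ h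
    rw [Sigma.mk.injEq] at h
    obtain ⟨h1, h2⟩ := h
    obtain rfl : L = L' := congrArg Subtype.val h1
    have h3 := eq_of_heq h2
    obtain rfl : ψ = ψ' := congrArg Subtype.val h3
    have hi : i = i' := Nat.pow_right_injective (two_le_residueCard R) (hψ.symm.trans hψ')
    subst hi
    have hj : j = j' := by
      have h4 := Finset.HasAntidiagonal.mem_antidiagonal.mp hp
      have h5 := Finset.HasAntidiagonal.mem_antidiagonal.mp hp'
      simp only at h4 h5
      lia
    subst hj
    rfl
  · rintro ⟨⟨L, hL⟩, ψ, hψ⟩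
    have hL0 : L.cardQuot ≠ 0 := hL ▸ residueCard_pow_ne_zero e
    have hdvd : (radical ψ).cardQuot ∣ L.cardQuot :=
      AddSubgroup.index_dvd_of_le (Submodule.toAddSubgroup_mono hψ)
    have : Finite ((Fin n → R) ⧸ radical ψ) := by
      refine Nat.finite_of_card_ne_zero ?_
      rw [← Submodule.cardQuot_apply]
      exact ne_zero_of_dvd_ne_zero hL0 hdvd
    obtain ⟨i, hi⟩ := exists_card_eq_residueCard_pow (R := R) ((Fin n → R) ⧸ radical ψ)
    rw [← Submodule.cardQuot_apply] at hi
    rw [hi, hL] at hdvd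
    have hie : i ≤ e := (Nat.pow_dvd_pow_iff_le_right (two_le_residueCard R)).mp hdvd
    exact ⟨⟨⟨(i, e - i), Finset.HasAntidiagonal.mem_antidiagonal.mpr (by simp; lia)⟩,
      ⟨ψ, hi⟩, ⟨L, hψ, hL⟩⟩, rfl⟩

/-- The convolution formula `card_sigma_le_radical` says that the generating series of the
characters by the index of their radical, times the zeta function of lattices, is the weighted zeta
function of lattices. -/
theorem mk_card_radical_eq_repSeries (n : ℕ) :
    (PowerSeries.mk fun e => (Nat.card {ψ : AddChar (KCentre n R) ℂ //
      (radical ψ).cardQuot = residueCard R ^ e} : ℂ)) = repSeries n (residueCard R) := by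
  apply eq_repSeries
  ext e
  have hcount (j : ℕ) : (Nat.card {L : Submodule R (Fin n → R) // L.cardQuot = residueCard R ^ j}
      : ℂ) = latticeCoeff (residueCard R) 1 n j := by
    have := finite_setOf_cardQuot_eq (R := R) (M := Fin n → R) (residueCard_pow_ne_zero (R := R) j)
    have := Fintype.ofFinite
      {L : Submodule R (Fin n → R) // L.cardQuot = residueCard R ^ j}
    have h := latticeSum_eq_latticeCoeff R 0 n j
    rw [pow_zero, inv_one] at h
    rw [← h, latticeSum, finsum_eq_sum_of_fintype]
    simp [latticeWeight]
  have hfin := finite_setOf_cardQuot_eq (R := R) (M := Fin n → R)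
    (residueCard_pow_ne_zero (R := R) e)
  have := Fintype.ofFinite {L : Submodule R (Fin n → R) // L.cardQuot = residueCard R ^ e}
  have (L : {L : Submodule R (Fin n → R) // L.cardQuot = residueCard R ^ e}) :
      Finite {ψ : AddChar (KCentre n R) ℂ // L.1 ≤ radical ψ} :=
    finite_le_radical (by rw [L.2]; exact residueCard_pow_ne_zero e)
  have h := congrArg (Nat.cast (R := ℂ)) (card_sigma_le_radical (R := R) (n := n) e)
  rw [Nat.card_sigma, Nat.cast_sum, Nat.cast_sum] at h
  rw [PowerSeries.coeff_mul]
  simp only [latticeSeries, PowerSeries.coeff_mk, zero_mul, pow_zero, one_mul]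
  have h1 := latticeSum_eq_latticeCoeff R 1 n e
  rw [pow_one] at h1
  rw [← h1, latticeSum, finsum_eq_sum_of_fintype, Finset.mul_sum]
  refine Eq.trans ?_ (h.symm.trans ?_)
  · refine Finset.sum_congr rfl fun p _ => ?_
    rw [Nat.cast_mul, hcount]
  · refine Finset.sum_congr rfl fun L _ => ?_
    rw [card_le_radical (by rw [L.2]; exact residueCard_pow_ne_zero e), L.2, Nat.cast_pow,
      ← pow_mul, mul_comm e, mul_comm]

end KGroup

end Convolution

/-! ### Irreducible representations with a given central character -/

section Representation

open Module

/-- Commuting operators on a nonzero finite-dimensional complex vector space have a common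
eigenvector: on a minimal nonzero invariant subspace, every one of them is a scalar. -/
theorem exists_common_eigenvector {ι V : Type*} [AddCommGroup V] [Module ℂ V]
    [FiniteDimensional ℂ V] [Nontrivial V] (T : ι → End ℂ V)
    (hT : ∀ i j v, T i (T j v) = T j (T i v)) :
    ∃ v ≠ 0, ∀ i, ∃ μ : ℂ, T i v = μ • v := by
  obtain ⟨W, ⟨hW0, hW⟩, hmin⟩ := (wellFounded_lt (α := Submodule ℂ V)).has_min
    {W | W ≠ ⊥ ∧ ∀ i, ∀ v ∈ W, T i v ∈ W} ⟨⊤, top_ne_bot, fun _ _ _ => trivial⟩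
  obtain ⟨v, hv, hv0⟩ := W.ne_bot_iff.mp hW0
  refine ⟨v, hv0, fun i => ?_⟩
  have : Nontrivial W := Submodule.nontrivial_iff_ne_bot.mpr hW0
  obtain ⟨μ, hμ⟩ := End.exists_eigenvalue ((T i).restrict (hW i))
  obtain ⟨w, hw⟩ := hμ.exists_hasEigenvector
  have hw' : T i w = μ • (w : V) := congrArg Subtype.val hw.apply_eq_smul
  refine ⟨μ, ?_⟩
  by_contra hne
  refine hmin (W ⊓ End.eigenspace (T i) μ) ⟨?_, ?_⟩ ?_
  · refine (Submodule.ne_bot_iff _).mpr ⟨w, ⟨w.2, End.mem_eigenspace_iff.mpr hw'⟩, ?_⟩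
    simpa using hw.2
  · rintro j u ⟨hu, hu'⟩
    refine ⟨hW j u hu, End.mem_eigenspace_iff.mpr ?_⟩
    rw [hT, End.mem_eigenspace_iff.mp hu', map_smul]
  · refine lt_of_le_of_ne inf_le_left fun h => hne ?_
    rw [← h] at hv
    exact End.mem_eigenspace_iff.mp hv.2

namespace Representation.IsIrreducible

variable {G V V' : Type*} [Group G] [AddCommGroup V] [Module ℂ V] [AddCommGroup V'] [Module ℂ V']
  {ρ : Representation ℂ G V} {ρ' : Representation ℂ G V'}

theorem nontrivial_space (h : ρ.IsIrreducible) : Nontrivial V := by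
  by_contra hV
  rw [not_nontrivial_iff_subsingleton] at hV
  refine bot_ne_top (α := Subrepresentation ρ) (Subrepresentation.toSubmodule_injective ?_)
  exact Subsingleton.elim _ _

theorem eq_top_of_ne_bot (h : ρ.IsIrreducible) {W : Submodule ℂ V}
    (hW : ∀ g, ∀ v ∈ W, ρ g v ∈ W) (h0 : W ≠ ⊥) : W = ⊤ := by
  rcases h.eq_bot_or_eq_top ⟨W, hW⟩ with hb | ht
  · exact absurd (congrArg Subrepresentation.toSubmodule hb) h0
  · exact congrArg Subrepresentation.toSubmodule ht

theorem of_forall_eq_top [Nontrivial V]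
    (h : ∀ W : Submodule ℂ V, (∀ g, ∀ v ∈ W, ρ g v ∈ W) → W ≠ ⊥ → W = ⊤) :
    ρ.IsIrreducible where
  exists_pair_ne := ⟨⊥, ⊤, fun hbt =>
    bot_ne_top (α := Submodule ℂ V) (congrArg Subrepresentation.toSubmodule hbt)⟩
  eq_bot_or_eq_top W := by
    by_cases h0 : W.toSubmodule = ⊥
    · exact Or.inl (Subrepresentation.toSubmodule_injective h0)
    · exact Or.inr (Subrepresentation.toSubmodule_injective
        (h _ (fun g v hv => W.apply_mem_toSubmodule g hv) h0))

/-- Schur's lemma. -/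
theorem exists_eq_smul [FiniteDimensional ℂ V] (h : ρ.IsIrreducible) {f : End ℂ V}
    (hf : ∀ g v, f (ρ g v) = ρ g (f v)) : ∃ μ : ℂ, ∀ v, f v = μ • v := by
  have := h.nontrivial_space
  obtain ⟨μ, hμ⟩ := End.exists_eigenvalue f
  refine ⟨μ, fun v => ?_⟩
  have htop := h.eq_top_of_ne_bot (W := End.eigenspace f μ) (fun g v hv => by
    rw [End.mem_eigenspace_iff] at hv ⊢
    rw [hf, hv, map_smul]) hμ
  exact End.mem_eigenspace_iff.mp (htop ▸ Submodule.mem_top)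

/-- An intertwining map up to scalars has an invariant kernel and an invariant range. -/
theorem bijective_of_ne_zero (h : ρ.IsIrreducible) (h' : ρ'.IsIrreducible) {f : V' →ₗ[ℂ] V}
    (hf0 : f ≠ 0) {χ : G → ℂ} (hf : ∀ g v, ρ g (f v) = χ g • f (ρ' g v)) :
    Function.Bijective f := by
  constructor
  · rw [← LinearMap.ker_eq_bot]
    by_contra hk
    refine hf0 (LinearMap.ker_eq_top.mp (h'.eq_top_of_ne_bot (fun g v hv => ?_) hk))
    -- unless `f = 0`, the scalar `χ g` is invertible
    have hχ : χ g * χ g⁻¹ = 1 ∨ ∀ v, f v = 0 := by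
      by_cases hall : ∀ v, f v = 0
      · exact Or.inr hall
      · push Not at hall
        obtain ⟨w, hw⟩ := hall
        have h1 : ρ g (ρ g⁻¹ (f w)) = f w := by
          rw [← Module.End.mul_apply, ← map_mul, mul_inv_cancel, map_one, Module.End.one_apply]
        have h2 : ρ' g (ρ' g⁻¹ w) = w := by
          rw [← Module.End.mul_apply, ← map_mul, mul_inv_cancel, map_one, Module.End.one_apply]
        rw [hf, map_smul, hf, h2, smul_smul, mul_comm] at h1
        exact Or.inl (smul_left_injective ℂ hw (by simpa using h1))
    rcases hχ with hχ | hall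
    · have := hf g v
      rw [LinearMap.mem_ker.mp hv, map_zero, eq_comm, smul_eq_zero] at this
      exact LinearMap.mem_ker.mpr (this.resolve_left (left_ne_zero_of_mul_eq_one hχ))
    · exact hall _
  · rw [← LinearMap.range_eq_top]
    refine h.eq_top_of_ne_bot ?_ (fun hr => hf0 (LinearMap.range_eq_bot.mp hr))
    rintro g _ ⟨v, rfl⟩
    exact ⟨χ g • ρ' g v, by rw [map_smul, hf]⟩

/-- Two irreducible representations on which all commutators act by the same scalars are twists of
each other: the group acts on the homomorphisms between them through commuting operators. -/
theorem exists_twist [FiniteDimensional ℂ V] [FiniteDimensional ℂ V'] (h : ρ.IsIrreducible)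
    (h' : ρ'.IsIrreducible)
    (hcomm : ∀ g k, ∃ μ : ℂ, μ ≠ 0 ∧ (∀ v, ρ (g * k * g⁻¹ * k⁻¹) v = μ • v) ∧
      ∀ v, ρ' (g * k * g⁻¹ * k⁻¹) v = μ • v) :
    ∃ (χ : G →* ℂˣ) (e : V' ≃ₗ[ℂ] V), ∀ g v, ρ g (e v) = (χ g : ℂ) • e (ρ' g v) := by
  have := h.nontrivial_space
  have := h'.nontrivial_space
  have hmul (g k : G) (v : V) : ρ (g * k) v = ρ g (ρ k v) := by
    rw [map_mul, Module.End.mul_apply]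
  have hmul' (g k : G) (v : V') : ρ' (g * k) v = ρ' g (ρ' k v) := by
    rw [map_mul, Module.End.mul_apply]
  set T : Representation ℂ G (V' →ₗ[ℂ] V) := linHom ρ' ρ
  have hTapp (g : G) (f : V' →ₗ[ℂ] V) (v : V') : T g f v = ρ g (f (ρ' g⁻¹ v)) := rfl
  obtain ⟨f, hf0, hf⟩ := exists_common_eigenvector (fun g => T g) (by
    intro g k f
    obtain ⟨μ, hμ, h1, h2⟩ := hcomm g k
    ext v
    simp only [hTapp, ← hmul, ← hmul']
    have e1 : g * k = (g * k * g⁻¹ * k⁻¹) * (k * g) := by group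
    have e2 : k⁻¹ * g⁻¹ = (g⁻¹ * k⁻¹) * (g * k * g⁻¹ * k⁻¹)⁻¹ := by group
    have h3 (v : V') : ρ' (g * k * g⁻¹ * k⁻¹)⁻¹ v = μ⁻¹ • v := by
      have h4 := h2 (ρ' (g * k * g⁻¹ * k⁻¹)⁻¹ v)
      rw [← hmul', mul_inv_cancel, map_one, Module.End.one_apply] at h4
      rw [eq_inv_smul_iff₀ hμ]
      exact h4.symm
    rw [e1, hmul, h1, e2, hmul', h3, map_smul, map_smul, map_smul, smul_smul,
      mul_inv_cancel₀ hμ, one_smul])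
  choose χ hχ using hf
  have hχ1 : χ 1 = 1 := by
    have := hχ 1
    rw [map_one, Module.End.one_apply] at this
    exact smul_left_injective ℂ hf0 (by simpa using this.symm)
  have hχmul (g k : G) : χ (g * k) = χ g * χ k := by
    have := hχ (g * k)
    rw [map_mul, Module.End.mul_apply, hχ k, map_smul, hχ g, smul_smul, mul_comm] at this
    exact smul_left_injective ℂ hf0 this.symm
  have hinter (g : G) (v : V') : ρ g (f v) = χ g • f (ρ' g v) := by
    have := LinearMap.congr_fun (hχ g) (ρ' g v)
    rwa [hTapp, ← hmul', inv_mul_cancel, map_one, Module.End.one_apply] at this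
  exact ⟨MonoidHom.toHomUnits ⟨⟨χ, hχ1⟩, hχmul⟩,
    LinearEquiv.ofBijective f (h.bijective_of_ne_zero h' hf0 hinter), hinter⟩

end Representation.IsIrreducible

end Representation

/-! ### Central characters -/

/-- The multiplicative group of `ℂ` has no small subgroups: squaring expands the distance to `1`. -/
theorem Complex.eq_one_of_forall_norm_pow_sub_one_le {z : ℂ} (h : ∀ k : ℕ, ‖z ^ k - 1‖ ≤ 1 / 2) :
    z = 1 := by
  have hstep (m : ℕ) : (3 / 2 : ℝ) ^ m * ‖z - 1‖ ≤ ‖z ^ 2 ^ m - 1‖ := by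
    induction m with
    | zero => simp
    | succ m ih =>
      set w := z ^ 2 ^ m with hw
      have h1 : z ^ 2 ^ (m + 1) - 1 = 2 * (w - 1) - -(w - 1) ^ 2 := by
        rw [pow_succ, pow_mul, ← hw]
        ring
      have h2 : 2 * ‖w - 1‖ - ‖w - 1‖ ^ 2 ≤ ‖z ^ 2 ^ (m + 1) - 1‖ := by
        rw [h1]
        refine le_trans ?_ (norm_sub_norm_le _ _)
        simp
      have h3 := h (2 ^ m)
      rw [← hw] at h3
      have h4 := norm_nonneg (w - 1)
      rw [pow_succ]
      nlinarith
  by_contra hz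
  have hpos : 0 < ‖z - 1‖ := norm_pos_iff.mpr (sub_ne_zero.mpr hz)
  obtain ⟨m, hm⟩ := pow_unbounded_of_one_lt (1 / ‖z - 1‖) (show (1 : ℝ) < 3 / 2 by norm_num)
  rw [div_lt_iff₀ hpos] at hm
  linarith [hstep m, h (2 ^ m)]

namespace KGroup

section CentralCharacter

variable {n : ℕ} {R : Type*} [CommRing R]

/-- The centre acts through the character `ψ`. -/
def HasCentralCharacter {V : Type*} [AddCommGroup V] [Module ℂ V]
    (ρ : Representation ℂ (KGroup n R) V) (ψ : AddChar (KCentre n R) ℂ) : Prop :=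
  ∀ c v, ρ ⟨0, 0, c⟩ v = ψ c • v

theorem central_mul_comm (c : KCentre n R) (g : KGroup n R) :
    (⟨0, 0, c⟩ : KGroup n R) * g = g * ⟨0, 0, c⟩ := by
  simp [mul_def, pairing_zero_left, pairing_zero_right, add_comm]

theorem central_mul_central (c c' : KCentre n R) :
    (⟨0, 0, c⟩ : KGroup n R) * ⟨0, 0, c'⟩ = ⟨0, 0, c + c'⟩ := by
  simp [mul_def, pairing_zero_left]

variable {V V' : Type*} [AddCommGroup V] [Module ℂ V] [AddCommGroup V'] [Module ℂ V']
  {ρ : Representation ℂ (KGroup n R) V} {ρ' : Representation ℂ (KGroup n R) V'}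
  {ψ : AddChar (KCentre n R) ℂ}

theorem exists_hasCentralCharacter [FiniteDimensional ℂ V] (h : ρ.IsIrreducible) :
    ∃ ψ, HasCentralCharacter ρ ψ := by
  have := h.nontrivial_space
  obtain ⟨v, hv⟩ := exists_ne (0 : V)
  choose μ hμ using fun c => h.exists_eq_smul (f := ρ ⟨0, 0, c⟩) (fun g v => by
    rw [← Module.End.mul_apply, ← map_mul, central_mul_comm, map_mul, Module.End.mul_apply])
  refine ⟨⟨μ, ?_, fun c c' => ?_⟩, hμ⟩
  · refine smul_left_injective ℂ hv ?_
    have := hμ 0 v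
    rw [← one_def, map_one, Module.End.one_apply] at this
    simpa using this.symm
  · refine smul_left_injective ℂ hv ?_
    have := hμ (c + c') v
    rw [← central_mul_central, map_mul, Module.End.mul_apply, hμ c', map_smul, hμ c, smul_smul,
      mul_comm] at this
    exact this.symm

theorem HasCentralCharacter.unique [Nontrivial V] {ψ' : AddChar (KCentre n R) ℂ}
    (h : HasCentralCharacter ρ ψ) (h' : HasCentralCharacter ρ ψ') : ψ = ψ' := by
  obtain ⟨v, hv⟩ := exists_ne (0 : V)
  ext c
  exact smul_left_injective ℂ hv ((h c v).symm.trans (h' c v))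

/-- The centre is generated by commutators, on which one-dimensional representations are
trivial. -/
theorem hom_central_eq_one (χ : KGroup n R →* ℂˣ) (c : KCentre n R) :
    χ ⟨0, 0, c⟩ = 1 := by
  set ψ : AddChar (KCentre n R) ℂ :=
    ⟨fun c => (χ ⟨0, 0, c⟩ : ℂ), by rw [← one_def]; simp, fun c c' => by
      rw [← central_mul_central, map_mul, Units.val_mul]⟩ with hψ
  have h : (⊤ : Submodule R (Fin n → R)) ≤ radical ψ := by
    intro a _ b
    have := commutator_eq (⟨a, 0, 0⟩ : KGroup n R) ⟨0, b, 0⟩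
    rw [pairing_zero_left, sub_zero] at this
    change ((χ ⟨0, 0, pairing a b⟩ : ℂˣ) : ℂ) = 1
    rw [← this]
    simp [mul_comm]
  have := le_radical_iff.mp h c (by rw [centreSubmodule_top]; trivial)
  exact Units.ext this

theorem HasCentralCharacter.exists_twist [FiniteDimensional ℂ V] [FiniteDimensional ℂ V']
    (h : ρ.IsIrreducible) (h' : ρ'.IsIrreducible) (hψ : HasCentralCharacter ρ ψ)
    (hψ' : HasCentralCharacter ρ' ψ) :
    ∃ (χ : KGroup n R →* ℂˣ) (e : V' ≃ₗ[ℂ] V), ∀ g v, ρ g (e v) = (χ g : ℂ) • e (ρ' g v) :=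
  h.exists_twist h' fun g k => by
    rw [commutator_eq]
    exact ⟨_, (AddChar.val_isUnit ψ _).ne_zero, hψ _, hψ' _⟩

end CentralCharacter

/-! ### The Schrödinger model -/

section Model

variable {n : ℕ} {R : Type*} [CommRing R] (ψ : AddChar (KCentre n R) ℂ)

/-- The pairing `(x, b) ↦ ψ (∑ x_i b_j y_{ij})` with `x` taken modulo the radical. -/
def quotPairing (x : (Fin n → R) ⧸ radical ψ) (b : Fin n → R) : ℂ :=
  Quotient.liftOn' x (fun a => ψ (pairing a b)) fun a a' h => by
    have h1 := (Submodule.quotientRel_def _).mp h b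
    have h2 := AddChar.map_add_eq_mul ψ (pairing (a - a') b) (pairing a' b)
    rwa [← pairing_add_left, sub_add_cancel, h1, one_mul] at h2

theorem quotPairing_mk (a b : Fin n → R) :
    quotPairing ψ (Submodule.Quotient.mk a) b = ψ (pairing a b) := rfl

theorem quotPairing_add_mk (x : (Fin n → R) ⧸ radical ψ) (a b : Fin n → R) :
    quotPairing ψ (x + Submodule.Quotient.mk a) b = quotPairing ψ x b * ψ (pairing a b) := by
  obtain ⟨x, rfl⟩ := Submodule.Quotient.mk_surjective _ x
  rw [← Submodule.Quotient.mk_add, quotPairing_mk, quotPairing_mk, pairing_add_left,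
    AddChar.map_add_eq_mul]

theorem quotPairing_add (x : (Fin n → R) ⧸ radical ψ) (b b' : Fin n → R) :
    quotPairing ψ x (b + b') = quotPairing ψ x b * quotPairing ψ x b' := by
  obtain ⟨x, rfl⟩ := Submodule.Quotient.mk_surjective _ x
  rw [quotPairing_mk, quotPairing_mk, quotPairing_mk, pairing_add_right, AddChar.map_add_eq_mul]

theorem quotPairing_zero (x : (Fin n → R) ⧸ radical ψ) : quotPairing ψ x 0 = 1 := by
  obtain ⟨x, rfl⟩ := Submodule.Quotient.mk_surjective _ x
  rw [quotPairing_mk, pairing_zero_right, AddChar.map_zero_eq_one]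

theorem exists_quotPairing_ne {x y : (Fin n → R) ⧸ radical ψ} (h : x ≠ y) :
    ∃ b, quotPairing ψ x b ≠ quotPairing ψ y b := by
  by_contra! hb
  refine h ?_
  obtain ⟨a, ha⟩ := Submodule.Quotient.mk_surjective _ (x - y)
  have hx : x = y + Submodule.Quotient.mk a := by rw [ha, add_sub_cancel]
  rw [← sub_eq_zero, ← ha, Submodule.Quotient.mk_eq_zero]
  intro b
  have h1 := hb b
  have h2 : quotPairing ψ y b ≠ 0 := by
    obtain ⟨y, rfl⟩ := Submodule.Quotient.mk_surjective _ y
    exact (AddChar.val_isUnit ψ _).ne_zero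
  rw [hx, quotPairing_add_mk] at h1
  exact mul_left_cancel₀ h2 (by rw [h1, mul_one])

variable {ι : Type*} (σ : ι ≃ (Fin n → R) ⧸ radical ψ)

/-- The Schrödinger model: the group acts on functions on `R ^ n` modulo the radical of `ψ` by
`(ρ (a, b, c) f) x = ψ (c + ∑ x_i b_j y_{ij}) f (x + a)`. The quotient is indexed by `ι`. -/
def schroedinger : Representation ℂ (KGroup n R) (ι → ℂ) where
  toFun g :=
    { toFun f i := ψ g.c * quotPairing ψ (σ i) g.b *
        f (σ.symm (σ i + Submodule.Quotient.mk g.a))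
      map_add' f f' := by
        ext i
        simp only [Pi.add_apply]
        ring
      map_smul' r f := by
        ext i
        simp only [Pi.smul_apply, smul_eq_mul, RingHom.id_apply]
        ring }
  map_one' := by
    ext f i
    simp [one_def, quotPairing_zero]
  map_mul' g h := by
    refine LinearMap.ext fun f => funext fun i => ?_
    simp only [mul_def, LinearMap.coe_mk, AddHom.coe_mk, Module.End.mul_apply,
      AddChar.map_add_eq_mul, Submodule.Quotient.mk_add, quotPairing_add, Equiv.apply_symm_apply,
      quotPairing_add_mk, add_assoc]
    ring

theorem schroedinger_apply (g : KGroup n R) (f : ι → ℂ) (i : ι) :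
    schroedinger ψ σ g f i = ψ g.c * quotPairing ψ (σ i) g.b *
      f (σ.symm (σ i + Submodule.Quotient.mk g.a)) := rfl

theorem hasCentralCharacter_schroedinger : HasCentralCharacter (schroedinger ψ σ) ψ := by
  intro c f
  ext i
  simp [schroedinger_apply, quotPairing_zero]

/-- A nonzero function of minimal support in an invariant subspace is supported at one point, since
the multiplication operators separate points; its translates span. -/
theorem isIrreducible_schroedinger [Finite ι] [Nonempty ι] :
    (schroedinger ψ σ).IsIrreducible := by
  classical
  have := Fintype.ofFinite ι
  refine Representation.IsIrreducible.of_forall_eq_top fun W hW hW0 => ?_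
  obtain ⟨f, ⟨hf, hf0⟩, hmin⟩ :=
    (measure fun f : ι → ℂ => (Finset.univ.filter (f · ≠ 0)).card).wf.has_min
      {f | f ∈ W ∧ f ≠ 0} (W.ne_bot_iff.mp hW0)
  obtain ⟨i, hi⟩ := Function.ne_iff.mp hf0
  have hsupp (j : ι) (hj : f j ≠ 0) : j = i := by
    by_contra hji
    obtain ⟨b, hb⟩ := exists_quotPairing_ne ψ (σ.injective.ne hji)
    set f' : ι → ℂ := schroedinger ψ σ ⟨0, b, 0⟩ f - quotPairing ψ (σ i) b • f with hf'
    have hval (k : ι) : f' k = (quotPairing ψ (σ k) b - quotPairing ψ (σ i) b) * f k := by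
      simp only [hf', Pi.sub_apply, schroedinger_apply, Pi.smul_apply, smul_eq_mul,
        AddChar.map_zero_eq_one, Submodule.Quotient.mk_zero, add_zero, Equiv.symm_apply_apply]
      ring
    refine hmin f' ⟨W.sub_mem (hW _ _ hf) (W.smul_mem _ hf), ?_⟩ ?_
    · refine Function.ne_iff.mpr ⟨j, ?_⟩
      rw [hval]
      exact mul_ne_zero (sub_ne_zero.mpr hb) hj
    · refine Finset.card_lt_card ((Finset.ssubset_iff_of_subset fun k hk => ?_).mpr ⟨i, ?_, ?_⟩)
      · rw [Finset.mem_filter, hval] at hk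
        exact Finset.mem_filter.mpr ⟨hk.1, right_ne_zero_of_mul hk.2⟩
      · exact Finset.mem_filter.mpr ⟨Finset.mem_univ _, hi⟩
      · simp [hval]
  have hsingle (j : ι) : (Pi.single j 1 : ι → ℂ) ∈ W := by
    obtain ⟨a, ha⟩ := Submodule.Quotient.mk_surjective _ (σ i - σ j)
    have h1 := W.smul_mem (f i)⁻¹ (hW ⟨a, 0, 0⟩ f hf)
    convert h1 using 1
    ext k
    simp only [Pi.smul_apply, schroedinger_apply, AddChar.map_zero_eq_one, quotPairing_zero,
      smul_eq_mul, one_mul, ha]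
    by_cases hk : k = j
    · subst hk
      rw [add_sub_cancel, Equiv.symm_apply_apply, inv_mul_cancel₀ hi, Pi.single_eq_same]
    · rw [Pi.single_eq_of_ne hk]
      by_contra hne
      have h2 := hsupp _ (right_ne_zero_of_mul (Ne.symm hne))
      rw [Equiv.symm_apply_eq, add_sub_left_comm, add_eq_left, sub_eq_zero] at h2
      exact hk (σ.injective h2)
  rw [eq_top_iff]
  rintro f -
  rw [pi_eq_sum_univ' f]
  refine W.sum_mem fun j _ => W.smul_mem _ ?_
  convert hsingle j using 1

end Model

end KGroup

/-! ### Continuity and the classification of the twist classes -/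

/-- A function that is invariant under a neighbourhood of zero is locally constant. -/
theorem continuous_of_forall_add_eq {A X : Type*} [AddCommGroup A] [TopologicalSpace A]
    [IsTopologicalAddGroup A] [TopologicalSpace X] {H : Set A} (hH : H ∈ 𝓝 0) {f : A → X}
    (hf : ∀ a, ∀ h ∈ H, f (a + h) = f a) : Continuous f := by
  refine continuous_iff_continuousAt.mpr fun a => ?_
  have h : ∀ᶠ x in 𝓝 a, f x = f a := by
    have h1 : Tendsto (fun x => x - a) (𝓝 a) (𝓝 0) := by
      simpa using (continuous_sub_right a).tendsto a
    filter_upwards [h1 hH] with x hx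
    simpa using hf a _ hx
  exact (continuousAt_congr h).mpr continuousAt_const

namespace KGroup

variable {n : ℕ} {R : Type*} [CommRing R] [TopologicalSpace R]

theorem continuous_central : Continuous fun c : KCentre n R => (⟨0, 0, c⟩ : KGroup n R) :=
  continuous_induced_rng.mpr (by
    exact continuous_const.prodMk (continuous_const.prodMk continuous_id))

theorem continuous_coordinates : Continuous fun g : KGroup n R => (g.a, g.b, g.c) :=
  continuous_induced_dom

theorem continuous_a : Continuous fun g : KGroup n R => g.a :=
  continuous_fst.comp continuous_coordinates

theorem continuous_b : Continuous fun g : KGroup n R => g.b :=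
  (continuous_fst.comp continuous_snd).comp continuous_coordinates

theorem continuous_c : Continuous fun g : KGroup n R => g.c :=
  (continuous_snd.comp continuous_snd).comp continuous_coordinates

theorem HasCentralCharacter.continuous {d : ℕ} {ρ : ContIrrep (KGroup n R) d}
    {ψ : AddChar (KCentre n R) ℂ} (h : HasCentralCharacter ρ.1 ψ) : Continuous ψ := by
  have := ρ.2.1.nontrivial_space
  obtain ⟨v, hv⟩ := exists_ne (0 : Fin d → ℂ)
  obtain ⟨i, hi⟩ := Function.ne_iff.mp hv
  have h1 : (ψ : KCentre n R → ℂ) = fun c => ρ.1 ⟨0, 0, c⟩ v i / v i := by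
    ext c
    rw [h, Pi.smul_apply, smul_eq_mul, mul_div_cancel_right₀ _ hi]
  rw [h1]
  exact (((continuous_apply i).comp ((ρ.2.2 v).comp continuous_central))).div_const _

/-- Continuous irreducible representations of the same dimension with the same central character are
twist equivalent. -/
theorem twistEquivalent_of_hasCentralCharacter {d : ℕ} {ρ ρ' : ContIrrep (KGroup n R) d}
    {ψ : AddChar (KCentre n R) ℂ} (h : HasCentralCharacter ρ.1 ψ)
    (h' : HasCentralCharacter ρ'.1 ψ) : TwistEquivalent ρ ρ' := by
  obtain ⟨χ, e, he⟩ := HasCentralCharacter.exists_twist ρ'.2.1 ρ.2.1 h' h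
  -- near `g₀`, the value `χ g` is the quotient of a nonzero coordinate of two continuous functions
  have hχ : Continuous fun g => (χ g : ℂ) := by
    refine continuous_iff_continuousAt.mpr fun g₀ => ?_
    have := ρ.2.1.nontrivial_space
    obtain ⟨v, hv⟩ := exists_ne (0 : Fin d → ℂ)
    have hv' : e (ρ.1 g₀ v) ≠ 0 := by
      intro h0
      have h1 := he g₀ v
      rw [h0, smul_zero] at h1
      have h2 := congrArg (ρ'.1 g₀⁻¹) h1
      rw [← Module.End.mul_apply, ← map_mul, inv_mul_cancel, map_one, Module.End.one_apply,
        map_zero] at h2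
      exact hv (e.map_eq_zero_iff.mp h2)
    obtain ⟨i, hi⟩ := Function.ne_iff.mp hv'
    have hc1 : Continuous fun g => ρ'.1 g (e v) i := (continuous_apply i).comp (ρ'.2.2 _)
    have hc2 : Continuous fun g => e (ρ.1 g v) i := (continuous_apply i).comp
      ((LinearMap.continuous_of_finiteDimensional e.toLinearMap).comp (ρ.2.2 v))
    refine (hc1.continuousAt.div hc2.continuousAt hi).congr ?_
    filter_upwards [hc2.continuousAt.eventually_ne hi] with g hg
    rw [Pi.div_apply, he, Pi.smul_apply, smul_eq_mul, mul_div_cancel_right₀ _ hg]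
  refine ⟨χ⁻¹, e, ?_, fun g v => ?_⟩
  · simpa [Pi.inv_def] using hχ.inv₀ fun g => (χ g).ne_zero
  · rw [he]
    simp [smul_smul]

theorem HasCentralCharacter.eq_of_twistEquivalent {d : ℕ} {ρ ρ' : ContIrrep (KGroup n R) d}
    {ψ ψ' : AddChar (KCentre n R) ℂ} (h : HasCentralCharacter ρ.1 ψ)
    (h' : HasCentralCharacter ρ'.1 ψ') (hρ : TwistEquivalent ρ ρ') : ψ = ψ' := by
  have := ρ.2.1.nontrivial_space
  obtain ⟨χ, e, -, he⟩ := hρ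
  refine h.unique fun c v => e.injective ?_
  rw [he, hom_central_eq_one, h', map_smul, Units.val_one, one_smul]

theorem isEmpty_twistClass_zero : IsEmpty (TwistClass (KGroup n R) 0) := by
  refine ⟨fun x => ?_⟩
  induction x using Quotient.inductionOn with | _ ρ =>
  have := ρ.2.1.nontrivial_space
  exact not_subsingleton (Fin 0 → ℂ) inferInstance

variable [IsTopologicalRing R] [IsDomain R] [IsDiscreteValuationRing R]

theorem pow_maximalIdeal_mem_nhds (hR : IsAdic (maximalIdeal R)) {ι : Type*} [Finite ι] (k : ℕ) :
    {x : ι → R | ∀ i, x i ∈ maximalIdeal R ^ k} ∈ 𝓝 0 := by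
  have h : ((maximalIdeal R ^ k : Ideal R) : Set R) ∈ 𝓝 0 :=
    ((isAdic_iff.mp hR).1 k).mem_nhds (zero_mem _)
  exact eventually_all.mpr fun i => (continuous_apply i).continuousAt.eventually h

variable [Finite (ResidueField R)]

/-- A continuous character of the centre is trivial on the multiples of a high power of the
uniformizer, so that its radical is open. -/
theorem cardQuot_radical_ne_zero (hR : IsAdic (maximalIdeal R)) {ψ : AddChar (KCentre n R) ℂ}
    (hψ : Continuous ψ) : (radical ψ).cardQuot ≠ 0 := by
  obtain ⟨ϖ, hϖ⟩ := IsDiscreteValuationRing.exists_irreducible R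
  -- on each matrix entry, an ideal on which `ψ` is close to `1` is one on which it is equal to `1`
  have h1 (i j : Fin n) : ∃ k, ∀ r : R, ϖ ^ k ∣ r →
      ψ (Submodule.Quotient.mk (Matrix.single i j r)) = 1 := by
    set φ : R → ℂ := fun r => ψ (Submodule.Quotient.mk (Matrix.single i j r)) with hφ
    have hφc : Continuous φ := by
      refine hψ.comp ((Submodule.continuous_mkQ _).comp ?_)
      refine continuous_matrix fun i' j' => ?_
      simp only [Matrix.single_apply]
      split_ifs
      · exact continuous_id
      · exact continuous_const
    have hφ0 : φ 0 = 1 := by simp [hφ]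
    have hφn (m : ℕ) (r : R) : φ (m • r) = φ r ^ m := by
      simp only [hφ]
      rw [← Matrix.smul_single, Submodule.Quotient.mk_smul, AddChar.map_nsmul_eq_pow]
    have hnhds : {r | ‖φ r - 1‖ < 1 / 2} ∈ 𝓝 (0 : R) := by
      refine (isOpen_lt (hφc.sub continuous_const).norm continuous_const).mem_nhds ?_
      simp [hφ0]
    obtain ⟨k, hk⟩ := (isAdic_iff.mp hR).2 _ hnhds
    refine ⟨k, fun r hr => Complex.eq_one_of_forall_norm_pow_sub_one_le fun m => ?_⟩
    rw [← hφn]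
    exact (hk ((mem_pow_maximalIdeal hϖ).mpr (dvd_smul_of_dvd m hr))).le
  choose k hk using h1
  obtain ⟨K, hK⟩ := Finite.exists_le fun p : Fin n × Fin n => k p.1 p.2
  have hmem : ϖ ^ K ∈ scalarIdeal (radical ψ) := by
    rw [mem_scalarIdeal]
    intro a b
    have h2 : pairing (ϖ ^ K • a) b = ∑ i, ∑ j,
        (Submodule.Quotient.mk (Matrix.single i j (ϖ ^ K * a i * b j)) : KCentre n R) := by
      rw [pairing, Matrix.matrix_eq_sum_single (Matrix.vecMulVec (ϖ ^ K • a) b)]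
      simp only [← Submodule.mkQ_apply, map_sum, Matrix.vecMulVec_apply, Pi.smul_apply,
        smul_eq_mul]
    have h3 : ∀ c ∈ (AddSubmonoid.closure {c : KCentre n R | ψ c = 1}), ψ c = 1 := by
      intro c hc
      induction hc using AddSubmonoid.closure_induction with
      | mem c hc => exact hc
      | zero => exact AddChar.map_zero_eq_one ψ
      | add c c' _ _ h h' => rw [AddChar.map_add_eq_mul, h, h', mul_one]
    refine h3 _ ?_
    rw [h2]
    refine sum_mem fun i _ => sum_mem fun j _ => AddSubmonoid.subset_closure (hk i j _ ?_)
    rw [mul_assoc]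
    exact (pow_dvd_pow ϖ (hK (i, j))).trans (dvd_mul_right _ _)
  have := finite_quotient_of_pow_mem hϖ hmem
  rw [Submodule.cardQuot_apply]
  exact Nat.card_pos.ne'

theorem continuous_schroedinger (hR : IsAdic (maximalIdeal R)) {ψ : AddChar (KCentre n R) ℂ}
    (hψ : (radical ψ).cardQuot ≠ 0) {ι : Type*} (σ : ι ≃ (Fin n → R) ⧸ radical ψ) (f : ι → ℂ) :
    Continuous fun g => schroedinger ψ σ g f := by
  obtain ⟨k, hk⟩ := exists_pow_maximalIdeal_trivial hψ
  refine continuous_pi fun i => ?_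
  simp only [schroedinger_apply]
  refine ((Continuous.comp ?_ continuous_c).mul
    (Continuous.comp (g := fun b => quotPairing ψ (σ i) b) ?_ continuous_b)).mul
    (Continuous.comp (g := fun a => f (σ.symm (σ i + Submodule.Quotient.mk a))) ?_ continuous_a)
  · rw [(Submodule.isQuotientMap_mkQ _).continuous_iff]
    have hnhds : {c : Matrix (Fin n) (Fin n) R | ∀ j, c.col j ∈ radical ψ} ∈ 𝓝 0 := by
      have h1 (j : Fin n) : Continuous fun c : Matrix (Fin n) (Fin n) R => c.col j :=
        continuous_pi fun i => continuous_id.matrix_elem i j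
      refine eventually_all.mpr fun j => ?_
      filter_upwards [(h1 j).continuousAt.eventually (pow_maximalIdeal_mem_nhds hR k)] with c hc
      exact hk _ hc
    refine continuous_of_forall_add_eq hnhds fun c c' hc' => ?_
    simp only [Function.comp_apply, map_add, AddChar.map_add_eq_mul]
    rw [le_radical_iff.mp le_rfl _ (Submodule.mem_map_of_mem hc'), mul_one]
  · refine continuous_of_forall_add_eq (pow_maximalIdeal_mem_nhds hR k) fun b b' hb' => ?_
    rw [quotPairing_add]
    obtain ⟨ϖ, hϖ⟩ := IsDiscreteValuationRing.exists_irreducible R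
    choose t ht using fun i => (mem_pow_maximalIdeal hϖ).mp (hb' i)
    obtain ⟨x, hx⟩ := Submodule.Quotient.mk_surjective _ (σ i)
    rw [show b' = ϖ ^ k • t from funext ht, ← hx, quotPairing_mk ψ x (ϖ ^ k • t),
      pairing_smul_right, ← pairing_smul_left]
    rw [hk (ϖ ^ k • x) (fun i => (mem_pow_maximalIdeal hϖ).mpr (dvd_mul_right _ _)) t, mul_one]
  · refine continuous_of_forall_add_eq (pow_maximalIdeal_mem_nhds hR k) fun a a' ha' => ?_
    have : (Submodule.Quotient.mk a' : (Fin n → R) ⧸ radical ψ) = 0 :=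
      (Submodule.Quotient.mk_eq_zero _).mpr (hk a' ha')
    rw [Submodule.Quotient.mk_add, this, add_zero]

theorem exists_contIrrep (hR : IsAdic (maximalIdeal R)) {ψ : AddChar (KCentre n R) ℂ}
    (hψ : (radical ψ).cardQuot ≠ 0) :
    ∃ ρ : ContIrrep (KGroup n R) (radical ψ).cardQuot, HasCentralCharacter ρ.1 ψ := by
  have : NeZero (radical ψ).cardQuot := ⟨hψ⟩
  rw [Submodule.cardQuot_apply] at hψ
  have := Nat.finite_of_card_ne_zero hψ
  have σ : Fin (radical ψ).cardQuot ≃ (Fin n → R) ⧸ radical ψ :=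
    (Finite.equivFinOfCardEq (Submodule.cardQuot_apply _).symm).symm
  exact ⟨⟨schroedinger ψ σ, isIrreducible_schroedinger ψ σ,
    continuous_schroedinger hR (by rwa [Submodule.cardQuot_apply]) σ⟩,
    hasCentralCharacter_schroedinger ψ σ⟩

/-- The Schrödinger model is a twist of every representation with the same central character, so it
has the same dimension. -/
theorem HasCentralCharacter.cardQuot_radical (hR : IsAdic (maximalIdeal R)) {d : ℕ}
    {ρ : ContIrrep (KGroup n R) d} {ψ : AddChar (KCentre n R) ℂ}
    (h : HasCentralCharacter ρ.1 ψ) : (radical ψ).cardQuot = d := by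
  obtain ⟨ρ', h'⟩ := exists_contIrrep hR (cardQuot_radical_ne_zero hR h.continuous)
  obtain ⟨-, e, -⟩ := HasCentralCharacter.exists_twist ρ.2.1 ρ'.2.1 h h'
  simpa using e.finrank_eq

/-- Twist classes of dimension `d` correspond to the characters of the centre whose radical has
index `d`. -/
theorem nonempty_twistClass_equiv (hR : IsAdic (maximalIdeal R)) {d : ℕ} (hd : d ≠ 0) :
    Nonempty (TwistClass (KGroup n R) d ≃
      {ψ : AddChar (KCentre n R) ℂ // (radical ψ).cardQuot = d}) := by
  choose ψ hψ using fun ρ : ContIrrep (KGroup n R) d => exists_hasCentralCharacter ρ.2.1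
  refine ⟨Equiv.ofBijective (Quotient.lift
    (fun ρ => ⟨ψ ρ, (hψ ρ).cardQuot_radical hR⟩)
    fun ρ ρ' h => Subtype.ext ((hψ ρ).eq_of_twistEquivalent (hψ ρ') h)) ⟨?_, ?_⟩⟩
  · intro x y h
    induction x using Quotient.inductionOn with | _ ρ =>
    induction y using Quotient.inductionOn with | _ ρ' =>
    have h1 : ψ ρ = ψ ρ' := congrArg Subtype.val h
    exact Quotient.sound (twistEquivalent_of_hasCentralCharacter (hψ ρ) (h1 ▸ hψ ρ'))
  · rintro ⟨ψ', rfl⟩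
    obtain ⟨ρ, hρ⟩ := exists_contIrrep hR hd
    have := ρ.2.1.nontrivial_space
    exact ⟨Quotient.mk _ ρ, Subtype.ext ((hψ ρ).unique hρ)⟩

end KGroup

/-! ### Completions of rings of integers -/

section Completion

open IsDedekindDomain

variable (F : Type*) [Field F] [NumberField F] (v : HeightOneSpectrum (𝓞 F))

theorem mem_maximalIdeal_adicCompletionIntegers {x : v.adicCompletionIntegers F} :
    x ∈ maximalIdeal (v.adicCompletionIntegers F) ↔ Valued.v (x : v.adicCompletion F) < 1 := by
  rw [mem_maximalIdeal, mem_nonunits_iff,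
    HeightOneSpectrum.adicCompletionIntegers.isUnit_iff_valued_eq_one]
  exact ⟨fun h => lt_of_le_of_ne x.2 h, fun h => h.ne⟩

/-- The valuation topology on the integers of the completion is the adic topology. -/
theorem isAdic_adicCompletionIntegers :
    IsAdic (maximalIdeal (v.adicCompletionIntegers F)) := by
  obtain ⟨ϖ, hϖ⟩ := IsDiscreteValuationRing.exists_irreducible (v.adicCompletionIntegers F)
  have hϖ0 : (ϖ : v.adicCompletion F) ≠ 0 := fun h => hϖ.ne_zero (Subtype.ext h)
  refine isAdic_iff.mpr ⟨fun k => ?_, fun s hs => ?_⟩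
  -- the multiples of `ϖ ^ k` are a preimage of the open valuation ring under a multiplication
  · have hset : ((maximalIdeal (v.adicCompletionIntegers F) ^ k : Ideal _) : Set _) =
        (fun x : v.adicCompletionIntegers F =>
          (x : v.adicCompletion F) * ((ϖ : v.adicCompletion F) ^ k)⁻¹) ⁻¹'
          (v.adicCompletionIntegers F : Set (v.adicCompletion F)) := by
      ext x
      rw [SetLike.mem_coe, mem_pow_maximalIdeal hϖ, Set.mem_preimage, SetLike.mem_coe]
      constructor
      · rintro ⟨y, rfl⟩
        have : ((ϖ ^ k * y : v.adicCompletionIntegers F) : v.adicCompletion F) *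
            ((ϖ : v.adicCompletion F) ^ k)⁻¹ = y := by
          push_cast
          field_simp
        rw [this]
        exact y.2
      · intro h
        refine ⟨⟨_, h⟩, Subtype.ext ?_⟩
        push_cast
        field_simp
    rw [hset]
    exact (Valued.isOpen_valuationSubring _).preimage (continuous_subtype_val.mul continuous_const)
  · rw [nhds_subtype_eq_comap, mem_comap] at hs
    obtain ⟨U, hU, hUs⟩ := hs
    rw [ZeroMemClass.coe_zero, Valued.mem_nhds_zero] at hU
    obtain ⟨γ, hγ⟩ := hU
    have hϖ1 : Valued.v (ϖ : v.adicCompletion F) < 1 := by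
      rw [← mem_maximalIdeal_adicCompletionIntegers, hϖ.maximalIdeal_eq]
      exact Ideal.mem_span_singleton_self ϖ
    obtain ⟨k, hk⟩ := ((Valued.tendsto_zero_pow_of_v_lt_one hϖ1).eventually
      (Valued.mem_nhds_zero.mpr ⟨γ, subset_rfl⟩)).exists
    refine ⟨k, fun x hx => hUs (hγ (lt_of_le_of_lt ?_ hk))⟩
    obtain ⟨y, rfl⟩ := (mem_pow_maximalIdeal hϖ).mp hx
    rw [Valuation.restrict_le_iff]
    push_cast
    rw [map_mul]
    exact mul_le_of_le_one_right' y.2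

theorem exists_algebraMap_sub_mem_maximalIdeal (y : v.adicCompletionIntegers F) :
    ∃ a : 𝓞 F, algebraMap (𝓞 F) (v.adicCompletionIntegers F) a - y ∈
      maximalIdeal (v.adicCompletionIntegers F) := by
  have hopen : {x : v.adicCompletion F | Valued.v (x - y) < 1} ∈ 𝓝 (y : v.adicCompletion F) :=
    Valued.mem_nhds.mpr ⟨1, fun x hx => (Valuation.restrict_lt_one_iff _).mp hx⟩
  obtain ⟨z, ⟨k, hkz⟩, hx⟩ :=
    (HeightOneSpectrum.denseRange_algebraMap (K := F) v).inter_nhds_nonempty hopen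
  have hvz : Valued.v z = v.valuation F k := by
    rw [← hkz]
    exact HeightOneSpectrum.valuedAdicCompletion_eq_valuation' v k
  have hk : v.valuation F k ≤ 1 := by
    rw [← hvz, ← sub_add_cancel z y]
    exact (Valuation.map_add _ _ _).trans (max_le (le_of_lt hx) y.2)
  obtain ⟨a, ha⟩ := v.exists_valuation_sub_lt_of_integer hk 1
  refine ⟨a, (mem_maximalIdeal_adicCompletionIntegers F v).mpr ?_⟩
  have h1 : Valued.v (algebraMap F (v.adicCompletion F) (algebraMap (𝓞 F) F a) - z) < 1 := by
    rw [← hkz, ← map_sub]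
    exact lt_of_eq_of_lt (HeightOneSpectrum.valuedAdicCompletion_eq_valuation' v _) ha
  have h2 : ((algebraMap (𝓞 F) (v.adicCompletionIntegers F) a - y : v.adicCompletionIntegers F) :
      v.adicCompletion F) =
      (algebraMap F (v.adicCompletion F) (algebraMap (𝓞 F) F a) - z) + (z - y) := by
    rw [sub_add_sub_cancel]
    rfl
  rw [h2]
  exact Valuation.map_add_lt _ h1 hx

/-- The residue field of the completion is that of the ring of integers. -/
theorem card_residueField_adicCompletionIntegers :
    Nat.card (ResidueField (v.adicCompletionIntegers F)) = Ideal.absNorm v.asIdeal := by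
  set φ : 𝓞 F →+* ResidueField (v.adicCompletionIntegers F) :=
    (residue _).comp (algebraMap (𝓞 F) (v.adicCompletionIntegers F)) with hφ
  have hφs : Function.Surjective φ := by
    intro z
    obtain ⟨y, rfl⟩ := residue_surjective z
    obtain ⟨a, ha⟩ := exists_algebraMap_sub_mem_maximalIdeal F v y
    exact ⟨a, Ideal.Quotient.eq.mpr ha⟩
  have hker : RingHom.ker φ = v.asIdeal := by
    ext a
    rw [RingHom.mem_ker, hφ, RingHom.comp_apply, residue_eq_zero_iff,
      mem_maximalIdeal_adicCompletionIntegers,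
      HeightOneSpectrum.algebraMap_adicCompletionIntegers_apply,
      HeightOneSpectrum.valuedAdicCompletion_eq_valuation',
      HeightOneSpectrum.valuation_lt_one_iff_mem]
  rw [Ideal.absNorm_apply, Submodule.cardQuot_apply, ← hker]
  exact (Nat.card_congr (RingHom.quotientKerEquivOfSurjective hφs).toEquiv).symm

end Completion

/-! ### The topological representation zeta function -/

namespace KGroup

section LocalZeta

variable {n : ℕ} {R : Type*} [CommRing R] [TopologicalSpace R] [IsTopologicalRing R] [IsDomain R]
  [IsDiscreteValuationRing R] [Finite (ResidueField R)]

theorem finite_twistClass (hR : IsAdic (maximalIdeal R)) (d : ℕ) :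
    Finite (TwistClass (KGroup n R) d) := by
  rcases eq_or_ne d 0 with rfl | hd
  · have := isEmpty_twistClass_zero (n := n) (R := R)
    infer_instance
  · obtain ⟨e⟩ := nonempty_twistClass_equiv (n := n) hR hd
    have := finite_cardQuot_radical_eq (R := R) (n := n) hd
    exact Finite.of_equiv _ e.symm

theorem card_twistClass_eq_zero (hR : IsAdic (maximalIdeal R)) {d : ℕ}
    (hd : ∀ e, d ≠ residueCard R ^ e) : Nat.card (TwistClass (KGroup n R) d) = 0 := by
  rcases eq_or_ne d 0 with rfl | hd0
  · have := isEmpty_twistClass_zero (n := n) (R := R)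
    exact Nat.card_of_isEmpty
  · obtain ⟨e⟩ := nonempty_twistClass_equiv (n := n) hR hd0
    have : IsEmpty {ψ : AddChar (KCentre n R) ℂ // (radical ψ).cardQuot = d} := by
      refine ⟨fun ⟨ψ, hψ⟩ => ?_⟩
      rw [Submodule.cardQuot_apply] at hψ
      have := Nat.finite_of_card_ne_zero (hψ ▸ hd0)
      obtain ⟨k, hk⟩ := exists_card_eq_residueCard_pow (R := R) ((Fin n → R) ⧸ radical ψ)
      exact hd k (hψ.symm.trans hk)
    rw [Nat.card_congr e]
    exact Nat.card_of_isEmpty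

theorem mk_card_twistClass_eq_repSeries (hR : IsAdic (maximalIdeal R)) (n : ℕ) :
    (PowerSeries.mk fun e => (Nat.card (TwistClass (KGroup n R) (residueCard R ^ e)) : ℂ)) =
      repSeries n (residueCard R) := by
  rw [← mk_card_radical_eq_repSeries]
  congr 1
  ext e
  obtain ⟨f⟩ := nonempty_twistClass_equiv (n := n) hR (residueCard_pow_ne_zero (R := R) e)
  rw [Nat.card_congr f]

theorem hasRepZeta (hR : IsAdic (maximalIdeal R)) {p r : Polynomial ℂ} (hr : r ≠ 0)
    (h : repSeries n (residueCard R) * (r : PowerSeries ℂ) = p) :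
    (∃ σ : ℝ, ∀ s : ℂ, σ < s.re → r.eval ((residueCard R : ℂ) ^ (-s)) ≠ 0) ∧
      HasRepZeta (KGroup n R) fun s =>
        p.eval ((residueCard R : ℂ) ^ (-s)) / r.eval ((residueCard R : ℂ) ^ (-s)) :=
  hasRepZeta_of_mul_eq (two_le_residueCard R) hr (finite_twistClass hR)
    (fun _ hd => card_twistClass_eq_zero hR hd) (by rwa [mk_card_twistClass_eq_repSeries hR])

end LocalZeta

end KGroup

/-- The numerator and the denominator that show that `repSeries n q` is rational in `q` serve all
completions of all number fields at once, apart from finitely many small `q`. -/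
theorem isTopRepZeta_latticeLeading_div (n : ℕ) :
    IsTopRepZeta n (latticeLeading 1 n n / latticeLeading 0 n 0) := by
  obtain ⟨E, ⟨P, Q, hQ, hE, q₀, hq₀⟩, hc⟩ := hasConstantTerm_repSeries n
  obtain ⟨q₁, hq₁⟩ := exists_specialize_ne_zero hQ
  refine ⟨P, Q, hQ, fun F _ _ => ?_, E, hE, hc⟩
  filter_upwards [eventually_le_absNorm F (max q₀ q₁)] with v hv
  have hcard := card_residueField_adicCompletionIntegers F v
  have hfin : Finite (ResidueField (v.adicCompletionIntegers F)) := by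
    refine Nat.finite_of_card_ne_zero ?_
    rw [hcard]
    exact (zero_lt_one.trans (NumberField.HeightOneSpectrum.one_lt_absNorm v)).ne'
  have hq : residueCard (v.adicCompletionIntegers F) = Ideal.absNorm v.asIdeal := hcard
  have h := KGroup.hasRepZeta (n := n) (isAdic_adicCompletionIntegers F v)
    (hq₁ _ (hq ▸ le_of_max_le_right hv)) (hq₀ _ (hq ▸ le_of_max_le_left hv))
  simpa only [hq, ← evalAt_eq_eval_specialize] using h

theorem sum_Icc_one_div_lt_sq {n : ℕ} (hn : 2 ≤ n) :
    ∑ k ∈ Finset.Icc 1 n, 1 / (k : ℚ) < (n : ℚ) ^ 2 := by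
  have h1 : ∑ k ∈ Finset.Icc 1 n, 1 / (k : ℚ) ≤ ∑ k ∈ Finset.Icc 1 n, (1 : ℚ) := by
    refine Finset.sum_le_sum fun k hk => ?_
    have : (1 : ℚ) ≤ k := by exact_mod_cast (Finset.mem_Icc.mp hk).1
    exact div_le_one_of_le₀ this (by linarith)
  have h2 : (2 : ℚ) ≤ n := by exact_mod_cast hn
  simp only [Finset.sum_const, Nat.card_Icc, add_tsub_cancel_right, nsmul_eq_mul, mul_one] at h1
  nlinarith

theorem mainTheorem6 (n : ℕ) (hn : 1 ≤ n) :
    (∃! Z : RatFunc ℚ, IsTopRepZeta n Z) ∧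
    (∀ Z : RatFunc ℚ, IsTopRepZeta n Z →
      HasOmega Z ((n : ℚ) ^ 2 - ∑ k ∈ Finset.Icc 1 n, 1 / (k : ℚ))) ∧
    (2 ≤ n → 0 < (n : ℚ) ^ 2 - ∑ k ∈ Finset.Icc 1 n, 1 / (k : ℚ)) := by
  have hZ := isTopRepZeta_latticeLeading_div n
  refine ⟨⟨_, hZ, fun Z h => h.unique hZ⟩, fun Z h => ?_, fun hn => ?_⟩
  · rw [h.unique hZ]
    have hω := hasOmega_latticeLeading_div n n 0
    rwa [Nat.cast_zero, sub_zero, ← sq] at hω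
  · exact sub_pos.mpr (sum_Icc_one_div_lt_sq hn)
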